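/- Consider the Kolmogorov (remarkable Fokker--Planck) equation $$u_t+x\,u_y=u_{xx}\qquad(*)$$ for a real function $u$ of $(t,x,y)\in\mathbb R^3$; solutions are $C^\infty$ functions on open subsets of $\mathbb R^3$. A \emph{point symmetry} of $(*)$ is a $C^\infty$ diffeomorphism $\Phi$ between open subsets of the space $\mathbb R^4$ with coordinates $(t,x,y,u)$ such that, whenever $\Phi$ maps the graph of a smooth function $u$ over an open set (the graph lying in $\operatorname{dom}\Phi$) onto the graph of a smooth function $\tilde u$ over an open set, $u$ is a solution of $(*)$ if and only if $\tilde u$ is. For a matrix $A=\begin{pmatrix}\alpha&\beta\\ \gamma&\delta\end{pmatrix}\in\mathrm{SL}(2,\mathbb R)$, constants $\lambda_0,\dots,\lambda_3\in\mathbb R$ and $\sigma\neq0$, and a solution $f$ of $(*)$ on an open set $\operatorname{dom}f\subseteq\mathbb R^3$, consider the transformation $$\tilde t=\frac{\alpha t+\beta}{\gamma t+\delta},\quad \tilde x=\frac{\hat x}{\gamma t+\delta}-\frac{3\gamma\hat y}{(\gamma t+\delta)^2},\quad \tilde y=\frac{\hat y}{(\gamma t+\delta)^3},$$ $$\tilde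 u=\sigma(\gamma t+\delta)^2\exp\Big(\frac{\gamma\hat x^2}{\gamma t+\delta}-\frac{3\gamma^2\hat x\hat y}{(\gamma t+\delta)^2}+\frac{3\gamma^3\hat y^2}{(\gamma t+\delta)^3}\Big)\exp\big(3\lambda_3(y-tx)-\lambda_2x-(3\lambda_3^2t^3+3\lambda_3\lambda_2t^2+\lambda_2^2t)\big)\,\big(u+f(t,x,y)\big),\qquad(**)$$ where $\hat x=x+3\lambda_3t^2+2\lambda_2t+\lambda_1$ and $\hat y=y+\lambda_3t^3+\lambda_2t^2+\lambda_1t+\lambda_0$, with the natural domain $\{(t,x,y,u):(t,x,y)\in\operatorname{dom}f,\ \gamma t+\delta\ne0\}$. Let $G$ be the set of all these transformations on their natural domains, $G^{\rm ess}\subset G$ the set of those with $f=0$ on $\mathbb R^3$, and $G^{\rm lin}\subset G$ the set of those with $A$ the identity matrix, $\lambda_0=\dots=\lambda_3=0$, $\sigma=1$, i.e. of the maps $(t,x,y,u)\mapsto(t,x,y,u+f(t,x,y))$. \textbf{Theorem.} (1) The point symmetries of $(*)$ form a pseudogroup. Every element of $G$ is a point symmetry of $(*)$, and a homeomorphism between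 open subsets of $\mathbb R^4$ is a point symmetry of $(*)$ if and only if in a neighbourhood of each point of its domain it is of the form $(**)$ (with $\gamma t+\delta\ne0$). If its domain $D$ is connected and the intersection of $D$ with every line $\{(t,x,y)\}\times\mathbb R$ is connected (possibly empty), then it is a point symmetry if and only if it is of the form $(**)$ on the whole of $D$ with one tuple of parameters $(A,\lambda_0,\dots,\lambda_3,\sigma)$, $\gamma t+\delta\neq0$ on $D$, and one solution $f$ defined on the projection of $D$ to $\mathbb R^3_{t,x,y}$. (2) The transformation with parameters $(A,\lambda,\sigma,f)$ is the composition of the addition of $f$ (parameters $(1,0,1,f)$), followed by the transformation with parameters $(1,\lambda,\sigma,0)$ (a Heisenberg-type shift combined with a scaling of $u$), followed by the transformation with parameters $(A,0,1,0)$. (3) $G$ and $G^{\rm lin}$ are closed under composition and inversion, $G^{\rm ess}\subset G$, $G^{\rm lin}\subset G$, and $\Phi\circ L\circ\Phi^{-1}\in G^{\rm lin}$ for all $\Phi\in G$, $L\in G^{\rm lin}$. Moreover $G=G^{\rm ess}\ltimes G^{\rm lin}$: each $\Phi\in G$ is $\Phi=E\circ L$ with $E\in G^{\rm ess}$, $L\in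 G^{\rm lin}$; if its domain is nonempty, $E$ is unique and $L$ is unique on $\operatorname{dom}\Phi$; and $G^{\rm ess}\cap G^{\rm lin}=\{\mathrm{id}\}$. (4) With respect to the modified composition (the modified composition of $\Phi_1,\Phi_2$ is the continuous extension of $\Phi_1\circ\Phi_2$ restricted to the interior of its domain), $G^{\rm ess}$ is a group, whose inverses are the inverse maps, and $G^{\rm ess}\cong\mathrm{SL}(2,\mathbb R)\ltimes(\mathrm H(2,\mathbb R)\times\mathbb Z_2)$, where $\mathrm H(2,\mathbb R)$ is the rank-two Heisenberg group of real matrices $\begin{pmatrix}1&a_1&a_2&c\\0&1&0&b_1\\0&0&1&b_2\\0&0&0&1\end{pmatrix}$ and $\mathbb Z_2=\{\pm1\}$. Under a suitable such isomorphism the product $A\cdot(h,z)$, with $A\in\mathrm{SL}(2,\mathbb R)$, $z\in\{\pm1\}$ and $h$ the matrix with $a_1=3\lambda_3$, $a_2=-\lambda_2$, $b_1=\lambda_0$, $b_2=\lambda_1$ and the entry $c$, corresponds to the transformation $(**)$ with parameters $A$, $\lambda_0,\dots,\lambda_3$, $\sigma=z\,\mathrm e^{c}$ and $f=0$. -/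

import Mathlib

open scoped ContDiff Topology

noncomputable section

namespace Kolmogorov

/-- The space of the independent variables `(t, x, y)`. -/
abbrev Base : Type := ℝ × ℝ × ℝ

/-- The space with coordinates `((t, x, y), u)`. -/
abbrev Total : Type := Base × ℝ

/-- The equation `u_t + x u_y = u_xx` at the point `b = (t, x, y)`. -/
def SatisfiesAt (u : Base → ℝ) (b : Base) : Prop :=
  deriv (fun s => u (s, b.2.1, b.2.2)) b.1 + b.2.1 * deriv (fun s => u (b.1, b.2.1, s)) b.2.2
    = iteratedDeriv 2 (fun s => u (b.1, s, b.2.2)) b.2.1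

/-- `u` is a (smooth) solution of the equation on the (open) set `Ω`. -/
def IsSolutionOn (u : Base → ℝ) (Ω : Set Base) : Prop :=
  ContDiffOn ℝ ∞ u Ω ∧ ∀ b ∈ Ω, SatisfiesAt u b

/-- The graph of `u` over `Ω`. -/
def graphOver (u : Base → ℝ) (Ω : Set Base) : Set Total :=
  (fun b => (b, u b)) '' Ω

/-- A point symmetry of the equation: a diffeomorphism between two open subsets of the space
`(t, x, y, u)` under which, whenever the graph of a smooth function over an open set is mapped
onto the graph of a smooth function over an open set, the first function is a solution if and
only if the second one is. -/
def IsPointSymmetry (Φ : OpenPartialHomeomorph Total Total) : Prop :=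
  ContDiffOn ℝ ∞ Φ Φ.source ∧ ContDiffOn ℝ ∞ Φ.symm Φ.target ∧
    ∀ (Ω Ω' : Set Base) (u u' : Base → ℝ), IsOpen Ω → IsOpen Ω' →
      ContDiffOn ℝ ∞ u Ω → ContDiffOn ℝ ∞ u' Ω' →
      graphOver u Ω ⊆ Φ.source → Φ '' graphOver u Ω = graphOver u' Ω' →
      (IsSolutionOn u Ω ↔ IsSolutionOn u' Ω')

/-- `SL(2, ℝ)`; the matrix `A = (α, β; γ, δ)` has `α = A 0 0`, `β = A 0 1`, `γ = A 1 0`,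
`δ = A 1 1`. -/
abbrev SL2 : Type := Matrix.SpecialLinearGroup (Fin 2) ℝ

/-- `γ t + δ`. -/
def den (A : SL2) (t : ℝ) : ℝ := A 1 0 * t + A 1 1

/-- `x̂ = x + 3 λ₃ t² + 2 λ₂ t + λ₁`. -/
def xHat (l : Fin 4 → ℝ) (b : Base) : ℝ :=
  b.2.1 + 3 * l 3 * b.1 ^ 2 + 2 * l 2 * b.1 + l 1

/-- `ŷ = y + λ₃ t³ + λ₂ t² + λ₁ t + λ₀`. -/
def yHat (l : Fin 4 → ℝ) (b : Base) : ℝ :=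
  b.2.2 + l 3 * b.1 ^ 3 + l 2 * b.1 ^ 2 + l 1 * b.1 + l 0

/-- The components for `t`, `x` and `y` of the transformation. -/
def baseMap (A : SL2) (l : Fin 4 → ℝ) (b : Base) : Base :=
  ((A 0 0 * b.1 + A 0 1) / den A b.1,
    xHat l b / den A b.1 - 3 * A 1 0 * yHat l b / den A b.1 ^ 2,
    yHat l b / den A b.1 ^ 3)

/-- The factor by which `u + f(t, x, y)` is multiplied. -/
def multiplier (A : SL2) (l : Fin 4 → ℝ) (σ : ℝ) (b : Base) : ℝ :=
  σ * den A b.1 ^ 2 *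
    Real.exp (A 1 0 * xHat l b ^ 2 / den A b.1
      - 3 * A 1 0 ^ 2 * xHat l b * yHat l b / den A b.1 ^ 2
      + 3 * A 1 0 ^ 3 * yHat l b ^ 2 / den A b.1 ^ 3) *
    Real.exp (3 * l 3 * (b.2.2 - b.1 * b.2.1) - l 2 * b.2.1
      - (3 * l 3 ^ 2 * b.1 ^ 3 + 3 * l 3 * l 2 * b.1 ^ 2 + l 2 ^ 2 * b.1))

/-- The transformation with the parameters `A`, `λ₀, …, λ₃`, `σ`, `f` (where `γ t + δ ≠ 0`). -/
def formula (A : SL2) (l : Fin 4 → ℝ) (σ : ℝ) (f : Base → ℝ) (p : Total) : Total :=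
  (baseMap A l p.1, multiplier A l σ p.1 * (p.2 + f p.1))

/-- The natural domain of the transformation when `f` is defined on `Ω`. -/
def naturalDomain (A : SL2) (Ω : Set Base) : Set Total :=
  {p | p.1 ∈ Ω ∧ den A p.1.1 ≠ 0}

/-- `Φ` is the transformation with the given parameters, `f` being considered on `Ω`,
on its natural domain. -/
def HasForm (A : SL2) (l : Fin 4 → ℝ) (σ : ℝ) (f : Base → ℝ) (Ω : Set Base)
    (Φ : OpenPartialHomeomorph Total Total) : Prop :=
  Φ.source = naturalDomain A Ω ∧ Set.EqOn Φ (formula A l σ f) Φ.source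

/-- All transformations of the form under consideration, each on its natural domain. -/
def groupG : Set (OpenPartialHomeomorph Total Total) :=
  {Φ | ∃ (A : SL2) (l : Fin 4 → ℝ) (σ : ℝ) (f : Base → ℝ) (Ω : Set Base),
    σ ≠ 0 ∧ IsOpen Ω ∧ IsSolutionOn f Ω ∧ HasForm A l σ f Ω Φ}

/-- The transformations with `f = 0`. -/
def groupEss : Set (OpenPartialHomeomorph Total Total) :=
  {Φ | ∃ (A : SL2) (l : Fin 4 → ℝ) (σ : ℝ), σ ≠ 0 ∧ HasForm A l σ 0 Set.univ Φ}

/-- The transformations `(t, x, y, u) ↦ (t, x, y, u + f(t, x, y))` on `dom f × ℝ`,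
`f` a solution. -/
def groupLin : Set (OpenPartialHomeomorph Total Total) :=
  {Φ | ∃ (f : Base → ℝ) (Ω : Set Base), IsOpen Ω ∧ IsSolutionOn f Ω ∧
    Φ.source = {p | p.1 ∈ Ω} ∧ ∀ p ∈ Φ.source, Φ p = (p.1, p.2 + f p.1)}

/-- `Ψ` is the modified composition of `Φ₁` and `Φ₂`: the restriction of the continuous
extension of `Φ₁ ∘ Φ₂` to the interior of the domain of this extension. -/
def IsModifiedComp (Φ₁ Φ₂ Ψ : OpenPartialHomeomorph Total Total) : Prop :=
  Ψ.source = interior {p | p ∈ closure (Φ₂.trans Φ₁).source ∧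
      ∃ q, Filter.Tendsto (Φ₂.trans Φ₁) (𝓝[(Φ₂.trans Φ₁).source] p) (𝓝 q)} ∧
    ∀ p ∈ Ψ.source, Filter.Tendsto (Φ₂.trans Φ₁) (𝓝[(Φ₂.trans Φ₁).source] p) (𝓝 (Ψ p))

/-- The matrix `(1, a₁, a₂, c; 0, 1, 0, b₁; 0, 0, 1, b₂; 0, 0, 0, 1)`. -/
def heisMatrix (a₁ a₂ b₁ b₂ c : ℝ) : Matrix (Fin 4) (Fin 4) ℝ :=
  !![1, a₁, a₂, c; 0, 1, 0, b₁; 0, 0, 1, b₂; 0, 0, 0, 1]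

theorem heisMatrix_mul (a₁ a₂ b₁ b₂ c a₁' a₂' b₁' b₂' c' : ℝ) :
    heisMatrix a₁ a₂ b₁ b₂ c * heisMatrix a₁' a₂' b₁' b₂' c' =
      heisMatrix (a₁ + a₁') (a₂ + a₂') (b₁ + b₁') (b₂ + b₂')
        (c + c' + a₁ * b₁' + a₂ * b₂') := by
  ext i j
  fin_cases i <;> fin_cases j <;>
    simp [heisMatrix, Matrix.mul_apply, Fin.sum_univ_four] <;> ring

theorem heisMatrix_zero : heisMatrix 0 0 0 0 0 = 1 := by
  ext i j
  fin_cases i <;> fin_cases j <;> simp [heisMatrix, Matrix.one_apply]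

/-- `heisMatrix` as an invertible matrix. -/
def heisGL (a₁ a₂ b₁ b₂ c : ℝ) : GL (Fin 4) ℝ where
  val := heisMatrix a₁ a₂ b₁ b₂ c
  inv := heisMatrix (-a₁) (-a₂) (-b₁) (-b₂) (a₁ * b₁ + a₂ * b₂ - c)
  val_inv := by
    rw [heisMatrix_mul, ← heisMatrix_zero]; congr 1 <;> ring
  inv_val := by
    rw [heisMatrix_mul, ← heisMatrix_zero]; congr 1 <;> ring

/-- The rank-two real Heisenberg group `H(2, ℝ)`. -/
def heisenbergGroup : Subgroup (GL (Fin 4) ℝ) where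
  carrier := {M | ∃ a₁ a₂ b₁ b₂ c : ℝ, M = heisGL a₁ a₂ b₁ b₂ c}
  mul_mem' := by
    rintro _ _ ⟨a₁, a₂, b₁, b₂, c, rfl⟩ ⟨a₁', a₂', b₁', b₂', c', rfl⟩
    exact ⟨_, _, _, _, _, Units.ext (heisMatrix_mul _ _ _ _ _ _ _ _ _ _)⟩
  one_mem' := ⟨0, 0, 0, 0, 0, Units.ext heisMatrix_zero.symm⟩
  inv_mem' := by
    rintro _ ⟨a₁, a₂, b₁, b₂, c, rfl⟩
    exact ⟨_, _, _, _, _, Units.ext rfl⟩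

/-- The element of `H(2, ℝ)` with the given entries. -/
def heis (a₁ a₂ b₁ b₂ c : ℝ) : heisenbergGroup :=
  ⟨heisGL a₁ a₂ b₁ b₂ c, a₁, a₂, b₁, b₂, c, rfl⟩

end Kolmogorov

end

/-! Sufficiency is a change of variables. Suppose `u' (T, X, Y) = M * u` and `T`, `X`, `Y`, `M`
satisfy a short list of differential identities. Then the residuals of the two equations are
proportional (`satisfiesAt_transfer`). For the explicit formulas the identities are checked by
differentiating along lines (`satisfiesAt_baseMap_iff`), and the summand `f` is absorbed by
linearity. The formulas are governed by the cubic p(t) = λ₀ + λ₁t + λ₂t² + λ₃t³: ŷ = y + p(t), x̂ =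
x + p'(t), and SL(2, ℝ) acts on cubics by `pull`. Compositions thus reduce to shift with shift,
SL(2, ℝ) with SL(2, ℝ), and a shift after SL(2, ℝ). Multipliers compose up to the constant factor
exp of `cocycle`.

Necessity is the substantial half. A symmetry is only known to act on graphs of solutions, so
identities for Φ = (T, X, Y, U) must be extracted from actual solutions. Where the image of a graph
is transversal to the fibres, the inverse function theorem presents it as the graph of a solution
(`IsPointSymmetry.push`). Add to the image a solution with zero 1-jet at the point and pull back
(`IsPointSymmetry.perturb`). The 1-jet of the source is unchanged, and so is its `u_xx`, because the
equation expresses `u_xx` by first derivatives. Comparing second x-derivatives for two polynomial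
perturbations forces the total x-derivatives of T and Y to vanish. Varying the slope of the
solution, T and Y are independent of x and u (`IsPointSymmetry.t_y_indep`). Polynomial solutions
with arbitrary 1-jets then give T_t + x T_y = X_x², Y_t + x Y_y = X X_x², X_u = 0, U_uu = 0 and two
relations for U (`DeterminingEquations`).

To integrate these, put D = X_x. Cross-differentiation shows that D depends on t only and that D
D_tt = 2 D_t². So 1/D is affine in t and T is a Möbius map (`IsPointSymmetry.exists_moebius`).
Composing with the inverse element of SL(2, ℝ) leaves the case T = t, D = 1. There X, Y and U_u are
found by comparing first derivatives on a ball, and f is a solution because the image of a constant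
solution is one (`IsPointSymmetry.formAt`).

The parameters are determined by the germ of the map (`params_unique`), hence constant on a
connected domain. The summand f descends to the projection when the fibres are connected. The same
rigidity gives uniqueness in the splitting of G. For the essential part, `pair` is the Heisenberg
cocycle. Its antisymmetrization is the invariant symplectic form on cubics, so SL(2, ℝ) acts on the
Heisenberg group once the central coordinate is corrected by `pullShift`. -/

namespace Kolmogorov

/-! ### Directional derivatives -/

section DirectionalDerivative

variable {E : Type*} [NormedAddCommGroup E] [NormedSpace ℝ E]

/-- The derivative of `f` at `x` in the direction `v`. -/
noncomputable def pd (v : E) (f : E → ℝ) (x : E) : ℝ := fderiv ℝ f x v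

theorem pd_congr {v : E} {f g : E → ℝ} {x : E} (h : f =ᶠ[𝓝 x] g) : pd v f x = pd v g x := by
  rw [pd, pd, h.fderiv_eq]

theorem pd_eventuallyEq {v : E} {f g : E → ℝ} {x : E} (h : f =ᶠ[𝓝 x] g) :
    pd v f =ᶠ[𝓝 x] pd v g :=
  h.fderiv.mono fun y hy => by rw [pd, pd, hy]

theorem pd_const (v : E) (c : ℝ) (x : E) : pd v (fun _ => c) x = 0 := by
  simp [pd]

theorem pd_add_dir (v w : E) (f : E → ℝ) (x : E) : pd (v + w) f x = pd v f x + pd w f x := by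
  simp [pd]

theorem pd_smul_dir (c : ℝ) (v : E) (f : E → ℝ) (x : E) : pd (c • v) f x = c * pd v f x := by
  simp [pd]

theorem pd_clm (v : E) (f : E →L[ℝ] ℝ) (x : E) : pd v f x = f v := by
  simp [pd]

theorem pd_add {v : E} {f g : E → ℝ} {x : E} (hf : DifferentiableAt ℝ f x)
    (hg : DifferentiableAt ℝ g x) : pd v (fun y => f y + g y) x = pd v f x + pd v g x := by
  simp [pd, fderiv_fun_add hf hg]

theorem pd_sub {v : E} {f g : E → ℝ} {x : E} (hf : DifferentiableAt ℝ f x)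
    (hg : DifferentiableAt ℝ g x) : pd v (fun y => f y - g y) x = pd v f x - pd v g x := by
  simp [pd, fderiv_fun_sub hf hg]

theorem pd_mul {v : E} {f g : E → ℝ} {x : E} (hf : DifferentiableAt ℝ f x)
    (hg : DifferentiableAt ℝ g x) :
    pd v (fun y => f y * g y) x = pd v f x * g x + f x * pd v g x := by
  simp [pd, fderiv_fun_mul hf hg]
  ring

/-- Derivatives of explicit formulas are computed through this reduction to one variable.
Differentiability is a separate hypothesis since a derivative along one line does not imply it. -/
theorem pd_of_hasDerivAt {v : E} {f : E → ℝ} {x : E} {f' : ℝ} (hf : DifferentiableAt ℝ f x)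
    (h : HasDerivAt (fun s : ℝ => f (x + s • v)) f' 0) : pd v f x = f' := by
  have h1 : HasDerivAt (fun s : ℝ => x + s • v) v 0 := by
    simpa using ((hasDerivAt_id (0 : ℝ)).smul_const v).const_add x
  have h2 : HasFDerivAt f (fderiv ℝ f x) (x + (0 : ℝ) • v) := by simpa using hf.hasFDerivAt
  exact (h2.comp_hasDerivAt 0 h1).unique h

theorem pd_comp_deriv {v : E} {f : E → ℝ} {x : E} {g : ℝ → ℝ} {g' : ℝ}
    (hg : HasDerivAt g g' (f x)) (hf : DifferentiableAt ℝ f x) :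
    pd v (fun y => g (f y)) x = g' * pd v f x := by
  have := (hg.comp_hasFDerivAt x hf.hasFDerivAt).fderiv
  simp only [Function.comp_def] at this
  simp [pd, this]

theorem _root_.ContDiffAt.pd {f : E → ℝ} {x : E} (hf : ContDiffAt ℝ ∞ f x) (v : E) :
    ContDiffAt ℝ ∞ (Kolmogorov.pd v f) x :=
  ((hf.fderiv_right (m := ∞) (by simp)).clm_apply contDiffAt_const)

theorem pd_comm {f : E → ℝ} {x : E} (hf : ContDiffAt ℝ ∞ f x) (v w : E) :
    pd v (pd w f) x = pd w (pd v f) x := by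
  have h : DifferentiableAt ℝ (fderiv ℝ f) x :=
    (hf.fderiv_right (m := ∞) (by simp)).differentiableAt (by simp)
  have key : ∀ a b : E, pd a (pd b f) x = fderiv ℝ (fderiv ℝ f) x a b := fun a b => by
    have := (h.hasFDerivAt.clm_apply (hasFDerivAt_const b x)).fderiv
    change fderiv ℝ (fun y => fderiv ℝ f y b) x a = _
    rw [this]; simp
  rw [key, key]
  exact (hf.isSymmSndFDerivAt (by
    rw [minSmoothness_of_isRCLikeNormedField]
    exact WithTop.coe_le_coe.2 (le_top : (2 : ℕ∞) ≤ ⊤))).eq v w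

theorem _root_.ContDiffAt.diff {f : E → ℝ} {x : E} (hf : ContDiffAt ℝ ∞ f x) :
    DifferentiableAt ℝ f x := hf.differentiableAt (by simp)

/-- Second derivative of a product. -/
theorem pd_pd_mul {v : E} {f g : E → ℝ} {x : E}
    (hf : ∀ᶠ y in 𝓝 x, ContDiffAt ℝ ∞ f y) (hg : ∀ᶠ y in 𝓝 x, ContDiffAt ℝ ∞ g y) :
    pd v (pd v (fun y => f y * g y)) x =
      pd v (pd v f) x * g x + 2 * (pd v f x * pd v g x) + f x * pd v (pd v g) x := by
  have h : pd v (fun y => f y * g y) =ᶠ[𝓝 x] fun y => pd v f y * g y + f y * pd v g y := by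
    filter_upwards [hf, hg] with y h1 h2 using pd_mul h1.diff h2.diff
  have f0 := hf.self_of_nhds
  have g0 := hg.self_of_nhds
  rw [pd_congr h, pd_add ((f0.pd v).diff.fun_mul g0.diff) (f0.diff.fun_mul (g0.pd v).diff),
    pd_mul (f0.pd v).diff g0.diff, pd_mul f0.diff (g0.pd v).diff]
  ring

theorem pd_pd_add {v : E} {f g : E → ℝ} {x : E}
    (hf : ∀ᶠ y in 𝓝 x, ContDiffAt ℝ ∞ f y) (hg : ∀ᶠ y in 𝓝 x, ContDiffAt ℝ ∞ g y) :
    pd v (pd v (fun y => f y + g y)) x = pd v (pd v f) x + pd v (pd v g) x := by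
  have h : pd v (fun y => f y + g y) =ᶠ[𝓝 x] fun y => pd v f y + pd v g y := by
    filter_upwards [hf, hg] with y h1 h2 using pd_add h1.diff h2.diff
  rw [pd_congr h, pd_add (hf.self_of_nhds.pd v).diff (hg.self_of_nhds.pd v).diff]

end DirectionalDerivative

/-! ### Coordinate directions and chain rules -/

/-- The direction of `∂_t`. -/
abbrev et : Base := (1, 0, 0)
/-- The direction of `∂_x`. -/
abbrev ex : Base := (0, 1, 0)
/-- The direction of `∂_y`. -/
abbrev ey : Base := (0, 0, 1)

theorem base_eq (v : Base) : v = v.1 • et + v.2.1 • ex + v.2.2 • ey := by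
  ext <;> simp

theorem pd_base (v : Base) (f : Base → ℝ) (b : Base) :
    pd v f b = v.1 * pd et f b + v.2.1 * pd ex f b + v.2.2 * pd ey f b := by
  conv_lhs => rw [base_eq v]
  rw [pd_add_dir, pd_add_dir, pd_smul_dir, pd_smul_dir, pd_smul_dir]

theorem pd_total (v : Base) (w : ℝ) (f : Total → ℝ) (p : Total) :
    pd (v, w) f p = pd (v, 0) f p + w * pd (0, 1) f p := by
  rw [← pd_smul_dir, ← pd_add_dir]; simp

theorem pd_total_base (v : Base) (f : Total → ℝ) (p : Total) :
    pd (v, 0) f p = v.1 * pd (et, 0) f p + v.2.1 * pd (ex, 0) f p + v.2.2 * pd (ey, 0) f p := by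
  rw [← pd_smul_dir, ← pd_smul_dir, ← pd_smul_dir, ← pd_add_dir, ← pd_add_dir]; simp

section Chain

variable {E : Type*} [NormedAddCommGroup E] [NormedSpace ℝ E]

theorem pd_comp3 {v : E} {x : E} {T X Y : E → ℝ} {w : Base → ℝ}
    (hT : DifferentiableAt ℝ T x) (hX : DifferentiableAt ℝ X x) (hY : DifferentiableAt ℝ Y x)
    (hw : DifferentiableAt ℝ w (T x, X x, Y x)) :
    pd v (fun y => w (T y, X y, Y y)) x =
      pd v T x * pd et w (T x, X x, Y x) + pd v X x * pd ex w (T x, X x, Y x)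
        + pd v Y x * pd ey w (T x, X x, Y x) := by
  have h := hw.hasFDerivAt.comp x
    (hT.hasFDerivAt.prodMk (hX.hasFDerivAt.prodMk hY.hasFDerivAt))
  have h2 := h.fderiv
  simp only [Function.comp_def] at h2
  change fderiv ℝ (fun y => w (T y, X y, Y y)) x v = _
  rw [h2]
  exact pd_base (fderiv ℝ T x v, fderiv ℝ X x v, fderiv ℝ Y x v) w (T x, X x, Y x)

theorem pd_comp_graph {v : Base} {b : Base} {u : Base → ℝ} {F : Total → ℝ}
    (hu : DifferentiableAt ℝ u b) (hF : DifferentiableAt ℝ F (b, u b)) :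
    pd v (fun y => F (y, u y)) b = pd (v, 0) F (b, u b) + pd v u b * pd (0, 1) F (b, u b) := by
  have h := (hF.hasFDerivAt.comp b ((hasFDerivAt_id b).prodMk hu.hasFDerivAt)).fderiv
  simp only [Function.comp_def] at h
  change fderiv ℝ (fun y => F (y, u y)) b v = _
  rw [← pd_total]
  change fderiv ℝ (fun x ↦ F (id x, u x)) b v = _
  rw [h]; simp [pd]

/-- Apply the first-order rule twice; the mixed terms merge by symmetry of second derivatives. The
point for later use is that the result involves `u` only through its value, its first derivative
along `v` and its second derivative along `v`. -/
theorem pd_pd_comp_graph {v : Base} {b : Base} {u : Base → ℝ} {F : Total → ℝ}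
    (hu : ∀ᶠ y in 𝓝 b, ContDiffAt ℝ ∞ u y)
    (hF : ∀ᶠ q in 𝓝 (b, u b), ContDiffAt ℝ ∞ F q) :
    pd v (pd v (fun y => F (y, u y))) b =
      pd (v, 0) (pd (v, 0) F) (b, u b) + 2 * pd v u b * pd (v, 0) (pd (0, 1) F) (b, u b)
        + pd v u b ^ 2 * pd (0, 1) (pd (0, 1) F) (b, u b)
        + pd v (pd v u) b * pd (0, 1) F (b, u b) := by
  have u0 := hu.self_of_nhds
  have F0 := hF.self_of_nhds
  have hc : ContinuousAt (fun y => (y, u y)) b := continuousAt_id.prodMk u0.continuousAt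
  have hF' : ∀ᶠ y in 𝓝 b, ContDiffAt ℝ ∞ F (y, u y) := hc.eventually hF
  have h : pd v (fun y => F (y, u y)) =ᶠ[𝓝 b]
      fun y => pd (v, 0) F (y, u y) + pd v u y * pd (0, 1) F (y, u y) := by
    filter_upwards [hu, hF'] with y h1 h2 using pd_comp_graph h1.diff h2.diff
  have hg : DifferentiableAt ℝ (fun y => (y, u y)) b := differentiableAt_id.prodMk u0.diff
  have e1 : DifferentiableAt ℝ (fun y => pd (v, 0) F (y, u y)) b :=
    DifferentiableAt.comp b (f := fun y => (y, u y)) (F0.pd _).diff hg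
  have e2 : DifferentiableAt ℝ (fun y => pd (0, 1) F (y, u y)) b :=
    DifferentiableAt.comp b (f := fun y => (y, u y)) (F0.pd _).diff hg
  rw [pd_congr h, pd_add e1 ((u0.pd v).diff.fun_mul e2), pd_mul (u0.pd v).diff e2,
    pd_comp_graph u0.diff (F0.pd _).diff, pd_comp_graph u0.diff (F0.pd _).diff,
    pd_comm F0 (0, 1) (v, 0)]
  ring

/-- Second derivative in a direction in which the outer components are constant. -/
theorem pd_pd_comp3 {v : E} {x : E} {T X Y : E → ℝ} {w : Base → ℝ}
    (hT : ∀ᶠ y in 𝓝 x, ContDiffAt ℝ ∞ T y) (hX : ∀ᶠ y in 𝓝 x, ContDiffAt ℝ ∞ X y)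
    (hY : ∀ᶠ y in 𝓝 x, ContDiffAt ℝ ∞ Y y)
    (hw : ∀ᶠ q in 𝓝 (T x, X x, Y x), ContDiffAt ℝ ∞ w q)
    (hTv : ∀ᶠ y in 𝓝 x, pd v T y = 0) (hYv : ∀ᶠ y in 𝓝 x, pd v Y y = 0) :
    pd v (pd v (fun y => w (T y, X y, Y y))) x =
      pd v X x ^ 2 * pd ex (pd ex w) (T x, X x, Y x)
        + pd v (pd v X) x * pd ex w (T x, X x, Y x) := by
  have T0 := hT.self_of_nhds
  have X0 := hX.self_of_nhds
  have Y0 := hY.self_of_nhds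
  have w0 := hw.self_of_nhds
  have hc : ContinuousAt (fun y => (T y, X y, Y y)) x :=
    T0.continuousAt.prodMk (X0.continuousAt.prodMk Y0.continuousAt)
  have hd : DifferentiableAt ℝ (fun y => (T y, X y, Y y)) x :=
    T0.diff.prodMk (X0.diff.prodMk Y0.diff)
  have hw' : ∀ᶠ y in 𝓝 x, ContDiffAt ℝ ∞ w (T y, X y, Y y) := hc.eventually hw
  have h : pd v (fun y => w (T y, X y, Y y)) =ᶠ[𝓝 x]
      fun y => pd v X y * pd ex w (T y, X y, Y y) := by
    filter_upwards [hT, hX, hY, hw', hTv, hYv] with y h1 h2 h3 h4 h5 h6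
    rw [pd_comp3 h1.diff h2.diff h3.diff h4.diff, h5, h6]; ring
  have e : DifferentiableAt ℝ (fun y => pd ex w (T y, X y, Y y)) x :=
    DifferentiableAt.comp x (f := fun y => (T y, X y, Y y)) (w0.pd _).diff hd
  rw [pd_congr h, pd_mul (X0.pd v).diff e, pd_comp3 T0.diff X0.diff Y0.diff (w0.pd _).diff,
    hTv.self_of_nhds, hYv.self_of_nhds]
  ring

end Chain

/-! ### The equation in directional derivatives and germs of solutions -/

theorem deriv_t_eq_pd {u : Base → ℝ} {b : Base} (hu : DifferentiableAt ℝ u b) :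
    deriv (fun s => u (s, b.2.1, b.2.2)) b.1 = pd et u b := by
  have h : HasDerivAt (fun s : ℝ => ((s, b.2.1, b.2.2) : Base)) et b.1 :=
    (hasDerivAt_id _).prodMk ((hasDerivAt_const _ _).prodMk (hasDerivAt_const _ _))
  exact (HasFDerivAt.comp_hasDerivAt (f := fun s : ℝ => ((s, b.2.1, b.2.2) : Base)) b.1
    hu.hasFDerivAt h).deriv

theorem deriv_x_eq_pd {u : Base → ℝ} {b : Base} (hu : DifferentiableAt ℝ u b) :
    deriv (fun s => u (b.1, s, b.2.2)) b.2.1 = pd ex u b := by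
  have h : HasDerivAt (fun s : ℝ => ((b.1, s, b.2.2) : Base)) ex b.2.1 :=
    (hasDerivAt_const _ _).prodMk ((hasDerivAt_id _).prodMk (hasDerivAt_const _ _))
  exact (HasFDerivAt.comp_hasDerivAt (f := fun s : ℝ => ((b.1, s, b.2.2) : Base)) b.2.1
    hu.hasFDerivAt h).deriv

theorem deriv_y_eq_pd {u : Base → ℝ} {b : Base} (hu : DifferentiableAt ℝ u b) :
    deriv (fun s => u (b.1, b.2.1, s)) b.2.2 = pd ey u b := by
  have h : HasDerivAt (fun s : ℝ => ((b.1, b.2.1, s) : Base)) ey b.2.2 :=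
    (hasDerivAt_const _ _).prodMk ((hasDerivAt_const _ _).prodMk (hasDerivAt_id _))
  exact (HasFDerivAt.comp_hasDerivAt (f := fun s : ℝ => ((b.1, b.2.1, s) : Base)) b.2.2
    hu.hasFDerivAt h).deriv

/-- Smoothness is required near `b`, not only at `b`: the iterated one-variable derivative in x is
rewritten by identifying the first derivative at all nearby points of the line. -/
theorem satisfiesAt_iff {u : Base → ℝ} {b : Base} (hu : ∀ᶠ y in 𝓝 b, ContDiffAt ℝ ∞ u y) :
    SatisfiesAt u b ↔ pd et u b + b.2.1 * pd ey u b = pd ex (pd ex u) b := by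
  have u0 := hu.self_of_nhds
  have hc : ContinuousAt (fun s : ℝ => ((b.1, s, b.2.2) : Base)) b.2.1 := by fun_prop
  have h : deriv (fun s => u (b.1, s, b.2.2)) =ᶠ[𝓝 b.2.1] fun s => pd ex u (b.1, s, b.2.2) := by
    filter_upwards [hc.eventually hu] with s hs
    exact deriv_x_eq_pd (b := (b.1, s, b.2.2)) hs.diff
  rw [SatisfiesAt, deriv_t_eq_pd u0.diff, deriv_y_eq_pd u0.diff, iteratedDeriv_succ,
    iteratedDeriv_one, h.deriv_eq, deriv_x_eq_pd (u0.pd _).diff]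

theorem satisfiesAt_congr {u v : Base → ℝ} {b : Base} (h : u =ᶠ[𝓝 b] v) :
    SatisfiesAt u b ↔ SatisfiesAt v b := by
  have ht : ContinuousAt (fun s : ℝ => ((s, b.2.1, b.2.2) : Base)) b.1 := by fun_prop
  have hx : ContinuousAt (fun s : ℝ => ((b.1, s, b.2.2) : Base)) b.2.1 := by fun_prop
  have hy : ContinuousAt (fun s : ℝ => ((b.1, b.2.1, s) : Base)) b.2.2 := by fun_prop
  have h1 := Filter.EventuallyEq.deriv_eq (ht.tendsto.eventually h :
    (fun s => u (s, b.2.1, b.2.2)) =ᶠ[𝓝 b.1] fun s => v (s, b.2.1, b.2.2))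
  have h2 := Filter.EventuallyEq.iteratedDeriv_eq 2 (hx.tendsto.eventually h :
    (fun s => u (b.1, s, b.2.2)) =ᶠ[𝓝 b.2.1] fun s => v (b.1, s, b.2.2))
  have h3 := Filter.EventuallyEq.deriv_eq (hy.tendsto.eventually h :
    (fun s => u (b.1, b.2.1, s)) =ᶠ[𝓝 b.2.2] fun s => v (b.1, b.2.1, s))
  rw [SatisfiesAt, SatisfiesAt, h1, h2, h3]

/-- `u` is a smooth solution near `b`. -/
def SolAt (u : Base → ℝ) (b : Base) : Prop :=
  ∀ᶠ y in 𝓝 b, ContDiffAt ℝ ∞ u y ∧ SatisfiesAt u y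

theorem SolAt.smooth {u : Base → ℝ} {b : Base} (h : SolAt u b) :
    ∀ᶠ y in 𝓝 b, ContDiffAt ℝ ∞ u y := h.mono fun _ h => h.1

theorem SolAt.eq {u : Base → ℝ} {b : Base} (h : SolAt u b) :
    pd et u b + b.2.1 * pd ey u b = pd ex (pd ex u) b :=
  (satisfiesAt_iff h.smooth).1 h.self_of_nhds.2

theorem solAt_iff {u : Base → ℝ} {b : Base} :
    SolAt u b ↔ ∀ᶠ y in 𝓝 b, ContDiffAt ℝ ∞ u y ∧
      pd et u y + y.2.1 * pd ey u y = pd ex (pd ex u) y := by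
  constructor
  · intro h
    filter_upwards [h, h.smooth.eventually_nhds] with y h1 h2
    exact ⟨h1.1, (satisfiesAt_iff h2).1 h1.2⟩
  · intro h
    filter_upwards [h, (h.mono fun _ h => h.1).eventually_nhds] with y h1 h2
    exact ⟨h1.1, (satisfiesAt_iff h2).2 h1.2⟩

theorem SolAt.congr {u v : Base → ℝ} {b : Base} (h : SolAt u b) (huv : u =ᶠ[𝓝 b] v) :
    SolAt v b := by
  filter_upwards [h, huv.eventually_nhds] with y h1 h2
  exact ⟨h1.1.congr_of_eventuallyEq (Filter.EventuallyEq.symm h2), (satisfiesAt_congr h2).1 h1.2⟩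

theorem isSolutionOn_iff {u : Base → ℝ} {Ω : Set Base} (hΩ : IsOpen Ω) :
    IsSolutionOn u Ω ↔ ∀ b ∈ Ω, SolAt u b := by
  constructor
  · intro h b hb
    filter_upwards [hΩ.mem_nhds hb] with y hy
    exact ⟨h.1.contDiffAt (hΩ.mem_nhds hy), h.2 y hy⟩
  · intro h
    exact ⟨fun b hb => (h b hb).self_of_nhds.1.contDiffWithinAt,
      fun b hb => (h b hb).self_of_nhds.2⟩

theorem SolAt.add {u v : Base → ℝ} {b : Base} (hu : SolAt u b) (hv : SolAt v b) :
    SolAt (fun y => u y + v y) b := by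
  refine solAt_iff.2 ?_
  filter_upwards [solAt_iff.1 hu, solAt_iff.1 hv, hu.smooth.eventually_nhds,
    hv.smooth.eventually_nhds] with y h1 h2 h3 h4
  refine ⟨h1.1.add h2.1, ?_⟩
  rw [pd_add h1.1.diff h2.1.diff, pd_add h1.1.diff h2.1.diff, pd_pd_add h3 h4, ← h1.2, ← h2.2]
  ring

theorem SolAt.const_mul {u : Base → ℝ} {b : Base} (c : ℝ) (hu : SolAt u b) :
    SolAt (fun y => c * u y) b := by
  refine solAt_iff.2 ?_
  filter_upwards [solAt_iff.1 hu, hu.smooth.eventually_nhds] with y h1 h3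
  refine ⟨contDiffAt_const.mul h1.1, ?_⟩
  rw [pd_mul (differentiableAt_const c) h1.1.diff, pd_mul (differentiableAt_const c) h1.1.diff,
    pd_pd_mul (Filter.Eventually.of_forall fun _ => contDiffAt_const) h3, ← h1.2]
  have : pd ex (fun _ : Base => c) = fun _ => 0 := funext fun x => pd_const _ _ _
  rw [this]
  simp only [pd_const]
  ring

theorem solAt_zero (b : Base) : SolAt (fun _ => 0) b := by
  refine solAt_iff.2 (Filter.Eventually.of_forall fun y => ⟨contDiffAt_const, ?_⟩)
  have : pd ex (fun _ : Base => (0 : ℝ)) = fun _ => 0 := funext fun x => pd_const _ _ _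
  rw [this]
  simp [pd_const]

end Kolmogorov

/-! ### Change of variables in the equation -/

namespace Kolmogorov

/-- The equation is preserved by a change of variables satisfying the determining equations. -/
theorem satisfiesAt_transfer {b : Base} {T X Y M m u u' : Base → ℝ}
    (hT : ∀ᶠ y in 𝓝 b, ContDiffAt ℝ ∞ T y) (hX : ∀ᶠ y in 𝓝 b, ContDiffAt ℝ ∞ X y)
    (hY : ∀ᶠ y in 𝓝 b, ContDiffAt ℝ ∞ Y y) (hM : ∀ᶠ y in 𝓝 b, ContDiffAt ℝ ∞ M y)
    (hu : ∀ᶠ y in 𝓝 b, ContDiffAt ℝ ∞ u y)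
    (hu' : ∀ᶠ y in 𝓝 (T b, X b, Y b), ContDiffAt ℝ ∞ u' y)
    (heq : ∀ᶠ y in 𝓝 b, u' (T y, X y, Y y) = M y * u y)
    (hTx : ∀ᶠ y in 𝓝 b, pd ex T y = 0) (hYx : ∀ᶠ y in 𝓝 b, pd ex Y y = 0)
    (hm : DifferentiableAt ℝ m b) (hMx : ∀ᶠ y in 𝓝 b, pd ex M y = m y * M y)
    (hD : pd ex X b ≠ 0) (hM0 : M b ≠ 0) (hXxx : pd ex (pd ex X) b = 0)
    (hVT : pd et T b + b.2.1 * pd ey T b = pd ex X b ^ 2)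
    (hVY : pd et Y b + b.2.1 * pd ey Y b = X b * pd ex X b ^ 2)
    (hVX : pd et X b + b.2.1 * pd ey X b = -2 * pd ex X b * m b)
    (hVM : pd et M b + b.2.1 * pd ey M b = (pd ex m b - m b ^ 2) * M b) :
    SatisfiesAt u b ↔ SatisfiesAt u' (T b, X b, Y b) := by
  rw [satisfiesAt_iff hu, satisfiesAt_iff hu']
  have T0 := hT.self_of_nhds.diff
  have X0 := hX.self_of_nhds.diff
  have Y0 := hY.self_of_nhds.diff
  have M0 := hM.self_of_nhds.diff
  have u0 := hu.self_of_nhds.diff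
  have u0' := hu'.self_of_nhds.diff
  have first : ∀ v : Base, pd v T b * pd et u' (T b, X b, Y b) + pd v X b *
      pd ex u' (T b, X b, Y b) + pd v Y b * pd ey u' (T b, X b, Y b) =
      pd v M b * u b + M b * pd v u b := fun v => by
    rw [← pd_comp3 T0 X0 Y0 u0', ← pd_mul M0 u0]
    exact pd_congr heq
  have second : pd ex X b ^ 2 * pd ex (pd ex u') (T b, X b, Y b) + pd ex (pd ex X) b *
      pd ex u' (T b, X b, Y b) = pd ex (pd ex M) b * u b + 2 * (pd ex M b * pd ex u b)
      + M b * pd ex (pd ex u) b := by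
    rw [← pd_pd_comp3 hT hX hY hu' hTx hYx, ← pd_pd_mul hM hu]
    exact pd_congr (pd_eventuallyEq heq)
  have hMx0 := hMx.self_of_nhds
  have hMxx : pd ex (pd ex M) b = (pd ex m b + m b ^ 2) * M b := by
    rw [pd_congr hMx, pd_mul hm M0, hMx0]; ring
  have hx := first ex
  have ht := first et
  have hy := first ey
  rw [hTx.self_of_nhds, hYx.self_of_nhds, hMx0] at hx
  rw [hMxx, hXxx, hMx0] at second
  -- The residuals of the two equations are proportional. In the combination below, `2 * m * hx`
  -- cancels the term in u_x produced by the second derivative of `M * u`, and `hVM` cancels the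
  -- remaining multiple of u.
  have key : pd ex X b ^ 2 * (pd et u' (T b, X b, Y b) + X b * pd ey u' (T b, X b, Y b)
      - pd ex (pd ex u') (T b, X b, Y b))
      = M b * (pd et u b + b.2.1 * pd ey u b - pd ex (pd ex u) b) := by
    linear_combination ht + b.2.1 * hy - second + 2 * m b * hx
      - pd et u' (T b, X b, Y b) * hVT - pd ey u' (T b, X b, Y b) * hVY
      - pd ex u' (T b, X b, Y b) * hVX + u b * hVM
  constructor
  · intro h
    rw [h, sub_self, mul_zero] at key
    exact sub_eq_zero.1 ((mul_eq_zero.1 key).resolve_left (pow_ne_zero _ hD))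
  · intro h
    change pd et u' (T b, X b, Y b) + X b * pd ey u' (T b, X b, Y b)
      = pd ex (pd ex u') (T b, X b, Y b) at h
    rw [h, sub_self, mul_zero] at key
    exact sub_eq_zero.1 ((mul_eq_zero.1 key.symm).resolve_left hM0)

/-! ### The explicit transformations satisfy the identities for a change of variables -/

section Formula

variable (A : SL2) (l : Fin 4 → ℝ) (σ : ℝ)

theorem contDiff_den : ContDiff ℝ ∞ fun b : Base => den A b.1 := by
  unfold den; fun_prop

theorem contDiff_xHat : ContDiff ℝ ∞ (xHat l) := by
  unfold xHat; fun_prop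

theorem contDiff_yHat : ContDiff ℝ ∞ (yHat l) := by
  unfold yHat; fun_prop

theorem isOpen_den_ne : IsOpen {b : Base | den A b.1 ≠ 0} :=
  isOpen_ne_fun (contDiff_den A).continuous continuous_const

theorem eventually_den_ne {b : Base} (hb : den A b.1 ≠ 0) : ∀ᶠ y : Base in 𝓝 b, den A y.1 ≠ 0 :=
  (isOpen_den_ne A).mem_nhds hb

variable {A} in
theorem contDiffAt_baseMap {b : Base} (hb : den A b.1 ≠ 0) : ContDiffAt ℝ ∞ (baseMap A l) b := by
  have h1 := (contDiff_den A).contDiffAt (x := b)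
  have h2 := (contDiff_xHat l).contDiffAt (x := b)
  have h3 := (contDiff_yHat l).contDiffAt (x := b)
  unfold baseMap
  refine ContDiffAt.prodMk ?_ (ContDiffAt.prodMk ?_ ?_)
  · exact ContDiffAt.div (by fun_prop) h1 hb
  · exact (h2.div h1 hb).sub ((contDiffAt_const.mul h3).div (h1.pow 2) (pow_ne_zero _ hb))
  · exact h3.div (h1.pow 3) (pow_ne_zero _ hb)

/-- The exponent of the first exponential factor of the multiplier. -/
noncomputable def expA (b : Base) : ℝ :=
  A 1 0 * xHat l b ^ 2 / den A b.1 - 3 * A 1 0 ^ 2 * xHat l b * yHat l b / den A b.1 ^ 2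
      + 3 * A 1 0 ^ 3 * yHat l b ^ 2 / den A b.1 ^ 3

/-- The exponent of the second exponential factor of the multiplier. -/
noncomputable def expL (b : Base) : ℝ :=
  3 * l 3 * (b.2.2 - b.1 * b.2.1) - l 2 * b.2.1
      - (3 * l 3 ^ 2 * b.1 ^ 3 + 3 * l 3 * l 2 * b.1 ^ 2 + l 2 ^ 2 * b.1)

theorem multiplier_eq (b : Base) :
    multiplier A l σ b = σ * den A b.1 ^ 2 * Real.exp (expA A l b) * Real.exp (expL l b) := rfl

theorem contDiff_expL : ContDiff ℝ ∞ (expL l) := by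
  unfold expL; fun_prop

variable {A} in
theorem contDiffAt_expA {b : Base} (hb : den A b.1 ≠ 0) : ContDiffAt ℝ ∞ (expA A l) b := by
  have h1 := (contDiff_den A).contDiffAt (x := b)
  have h2 := (contDiff_xHat l).contDiffAt (x := b)
  have h3 := (contDiff_yHat l).contDiffAt (x := b)
  unfold expA
  exact (((contDiffAt_const.mul (h2.pow 2)).div h1 hb).sub
    (((contDiffAt_const.mul h2).mul h3).div (h1.pow 2) (pow_ne_zero _ hb))).add
    ((contDiffAt_const.mul (h3.pow 2)).div (h1.pow 3) (pow_ne_zero _ hb))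

variable {A} in
theorem contDiffAt_multiplier {b : Base} (hb : den A b.1 ≠ 0) :
    ContDiffAt ℝ ∞ (multiplier A l σ) b := by
  have h1 := (contDiff_den A).contDiffAt (x := b)
  exact ((contDiffAt_const.mul (h1.pow 2)).mul (contDiffAt_expA l hb).exp).mul
    ((contDiff_expL l).contDiffAt).exp

variable {A σ} in
theorem multiplier_ne_zero {b : Base} (hb : den A b.1 ≠ 0) (hσ : σ ≠ 0) :
    multiplier A l σ b ≠ 0 := by
  rw [multiplier_eq]
  exact mul_ne_zero (mul_ne_zero (mul_ne_zero hσ (pow_ne_zero _ hb)) (Real.exp_ne_zero _))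
    (Real.exp_ne_zero _)

theorem det_eq : A 0 0 * A 1 1 - A 0 1 * A 1 0 = 1 := by
  rw [← Matrix.det_fin_two]; exact A.2

variable (b v : Base)

theorem hasDerivAt_den_line :
    HasDerivAt (fun s : ℝ => den A (b + s • v).1) (A 1 0 * v.1) 0 := by
  have : HasDerivAt (fun s : ℝ => A 1 0 * (b.1 + s * v.1) + A 1 1) (A 1 0 * (1 * v.1)) 0 :=
    ((((hasDerivAt_id (0 : ℝ)).mul_const v.1).const_add b.1).const_mul (A 1 0)).add_const _
  simpa [den] using this

theorem hasDerivAt_t_line : HasDerivAt (fun s : ℝ => (b + s • v).1) v.1 0 := by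
  simpa using (((hasDerivAt_id (0 : ℝ)).mul_const v.1).const_add b.1)

theorem hasDerivAt_x_line : HasDerivAt (fun s : ℝ => (b + s • v).2.1) v.2.1 0 := by
  simpa using (((hasDerivAt_id (0 : ℝ)).mul_const v.2.1).const_add b.2.1)

theorem hasDerivAt_y_line : HasDerivAt (fun s : ℝ => (b + s • v).2.2) v.2.2 0 := by
  simpa using (((hasDerivAt_id (0 : ℝ)).mul_const v.2.2).const_add b.2.2)

theorem hasDerivAt_xHat_line : HasDerivAt (fun s : ℝ => xHat l (b + s • v))
    (v.2.1 + (6 * l 3 * b.1 + 2 * l 2) * v.1) 0 := by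
  have h1 := hasDerivAt_t_line b v
  have h2 := hasDerivAt_x_line b v
  have := (((h2.add ((h1.pow 2).const_mul (3 * l 3))).add (h1.const_mul (2 * l 2))).add_const (l 1))
  unfold xHat
  refine this.congr_deriv ?_
  simp; ring

theorem hasDerivAt_yHat_line : HasDerivAt (fun s : ℝ => yHat l (b + s • v))
    (v.2.2 + (3 * l 3 * b.1 ^ 2 + 2 * l 2 * b.1 + l 1) * v.1) 0 := by
  have h1 := hasDerivAt_t_line b v
  have h2 := hasDerivAt_y_line b v
  have := ((((h2.add ((h1.pow 3).const_mul (l 3))).add ((h1.pow 2).const_mul (l 2))).add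
    (h1.const_mul (l 1))).add_const (l 0))
  unfold yHat
  refine this.congr_deriv ?_
  simp; ring

theorem hasDerivAt_expL_line : HasDerivAt (fun s : ℝ => expL l (b + s • v))
    (3 * l 3 * (v.2.2 - (v.1 * b.2.1 + b.1 * v.2.1)) - l 2 * v.2.1 -
      (9 * l 3 ^ 2 * b.1 ^ 2 + 6 * l 3 * l 2 * b.1 + l 2 ^ 2) * v.1) 0 := by
  have h1 := hasDerivAt_t_line b v
  have h2 := hasDerivAt_x_line b v
  have h3 := hasDerivAt_y_line b v
  have := (((h3.sub (h1.mul h2)).const_mul (3 * l 3)).sub (h2.const_mul (l 2))).sub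
    ((((h1.pow 3).const_mul (3 * l 3 ^ 2)).add ((h1.pow 2).const_mul (3 * l 3 * l 2))).add
      (h1.const_mul (l 2 ^ 2)))
  unfold expL
  refine this.congr_deriv ?_
  simp; ring

variable {b} in
-- The derivatives of the denominator, of x̂ and of ŷ enter as free values, so that each direction
-- supplies them already simplified and the final algebra stays small.
theorem hasDerivAt_expA_line (hb : den A b.1 ≠ 0) {r' x' y' : ℝ} (hr' : A 1 0 * v.1 = r')
    (hx' : v.2.1 + (6 * l 3 * b.1 + 2 * l 2) * v.1 = x')
    (hy' : v.2.2 + (3 * l 3 * b.1 ^ 2 + 2 * l 2 * b.1 + l 1) * v.1 = y') :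
    HasDerivAt (fun s : ℝ => expA A l (b + s • v))
    (A 1 0 * (2 * xHat l b * x' / den A b.1 - xHat l b ^ 2 * r' / den A b.1 ^ 2)
      - 3 * A 1 0 ^ 2 * ((x' * yHat l b + xHat l b * y') / den A b.1 ^ 2
        - 2 * xHat l b * yHat l b * r' / den A b.1 ^ 3)
      + 3 * A 1 0 ^ 3 * (2 * yHat l b * y' / den A b.1 ^ 3
        - 3 * yHat l b ^ 2 * r' / den A b.1 ^ 4)) 0 := by
  have h1 := hasDerivAt_den_line A b v
  have h2 := hasDerivAt_xHat_line l b v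
  have h3 := hasDerivAt_yHat_line l b v
  rw [hr'] at h1
  rw [hx'] at h2
  rw [hy'] at h3
  have e : b + (0 : ℝ) • v = b := by simp
  have hb' : den A (b + (0 : ℝ) • v).1 ≠ 0 := by rwa [e]
  have := ((((h2.pow 2).const_mul (A 1 0)).div h1 hb').sub
    (((h2.const_mul (3 * A 1 0 ^ 2)).mul h3).div (h1.pow 2) (pow_ne_zero _ hb'))).add
    (((h3.pow 2).const_mul (3 * A 1 0 ^ 3)).div (h1.pow 3) (pow_ne_zero _ hb'))
  unfold expA
  refine this.congr_deriv ?_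
  rw [e]
  simp only [Pi.pow_apply, Pi.mul_apply, e, Nat.cast_ofNat]
  field_simp
  simp only [Nat.add_one_sub_one, pow_one]
  ring

variable {b} in
theorem hasDerivAt_multiplier_line (hb : den A b.1 ≠ 0) {a' l' : ℝ}
    (ha : HasDerivAt (fun s : ℝ => expA A l (b + s • v)) a' 0)
    (hl : HasDerivAt (fun s : ℝ => expL l (b + s • v)) l' 0) :
    HasDerivAt (fun s : ℝ => multiplier A l σ (b + s • v))
      ((2 * (A 1 0 * v.1) / den A b.1 + a' + l') * multiplier A l σ b) 0 := by
  have h1 := hasDerivAt_den_line A b v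
  have := (((h1.pow 2).const_mul σ).mul ha.exp).mul hl.exp
  simp only [multiplier_eq]
  refine this.congr_deriv ?_
  simp only [Pi.pow_apply, zero_smul, add_zero, Nat.cast_ofNat]
  field_simp
  simp
  ring

/-- The logarithmic derivative of the multiplier with respect to `x`. -/
noncomputable def logDerivX (b : Base) : ℝ :=
  2 * A 1 0 * xHat l b / den A b.1 - 3 * A 1 0 ^ 2 * yHat l b / den A b.1 ^ 2
    - (3 * l 3 * b.1 + l 2)

variable {b}

theorem hasDerivAt_baseMap_x_line (hb : den A b.1 ≠ 0) {r' x' y' : ℝ} (hr' : A 1 0 * v.1 = r')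
    (hx' : v.2.1 + (6 * l 3 * b.1 + 2 * l 2) * v.1 = x')
    (hy' : v.2.2 + (3 * l 3 * b.1 ^ 2 + 2 * l 2 * b.1 + l 1) * v.1 = y') :
    HasDerivAt (fun s : ℝ => (baseMap A l (b + s • v)).2.1)
      (x' / den A b.1 - xHat l b * r' / den A b.1 ^ 2 - 3 * A 1 0 * (y' / den A b.1 ^ 2
        - 2 * yHat l b * r' / den A b.1 ^ 3)) 0 := by
  have h1 := hasDerivAt_den_line A b v
  have h2 := hasDerivAt_xHat_line l b v
  have h3 := hasDerivAt_yHat_line l b v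
  rw [hr'] at h1
  rw [hx'] at h2
  rw [hy'] at h3
  have e : b + (0 : ℝ) • v = b := by simp
  have hb' : den A (b + (0 : ℝ) • v).1 ≠ 0 := by rwa [e]
  have := (h2.div h1 hb').sub ((h3.const_mul (3 * A 1 0)).div (h1.pow 2) (pow_ne_zero _ hb'))
  unfold baseMap
  refine this.congr_deriv ?_
  rw [e]
  simp only [Pi.pow_apply, e, Nat.cast_ofNat]
  field_simp
  simp only [Nat.add_one_sub_one, pow_one]
  ring

theorem hasDerivAt_baseMap_y_line (hb : den A b.1 ≠ 0) {r' y' : ℝ} (hr' : A 1 0 * v.1 = r')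
    (hy' : v.2.2 + (3 * l 3 * b.1 ^ 2 + 2 * l 2 * b.1 + l 1) * v.1 = y') :
    HasDerivAt (fun s : ℝ => (baseMap A l (b + s • v)).2.2)
      (y' / den A b.1 ^ 3 - 3 * yHat l b * r' / den A b.1 ^ 4) 0 := by
  have h1 := hasDerivAt_den_line A b v
  have h3 := hasDerivAt_yHat_line l b v
  rw [hr'] at h1
  rw [hy'] at h3
  have e : b + (0 : ℝ) • v = b := by simp
  have hb' : den A (b + (0 : ℝ) • v).1 ≠ 0 := by rwa [e]
  have := h3.div (h1.pow 3) (pow_ne_zero _ hb')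
  unfold baseMap
  refine this.congr_deriv ?_
  simp only [Pi.pow_apply, e, Nat.cast_ofNat]
  field_simp
  simp only [Nat.reduceSub]
  ring

theorem hasDerivAt_baseMap_t_line (hb : den A b.1 ≠ 0) :
    HasDerivAt (fun s : ℝ => (baseMap A l (b + s • v)).1) (v.1 / den A b.1 ^ 2) 0 := by
  have h1 := hasDerivAt_den_line A b v
  have h2 := hasDerivAt_t_line b v
  have e : b + (0 : ℝ) • v = b := by simp
  have hb' : den A (b + (0 : ℝ) • v).1 ≠ 0 := by rwa [e]
  have := ((h2.const_mul (A 0 0)).add_const (A 0 1)).div h1 hb'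
  unfold baseMap
  refine this.congr_deriv ?_
  rw [e]
  congr 1
  unfold den
  linear_combination v.1 * det_eq A

/-- The transformation (without the summand `f`) maps solutions to solutions. -/
theorem satisfiesAt_baseMap_iff (hb : den A b.1 ≠ 0) (hσ : σ ≠ 0) {u u' : Base → ℝ}
    (hu : ∀ᶠ y in 𝓝 b, ContDiffAt ℝ ∞ u y)
    (hu' : ∀ᶠ y in 𝓝 (baseMap A l b), ContDiffAt ℝ ∞ u' y)
    (heq : ∀ᶠ y in 𝓝 b, u' (baseMap A l y) = multiplier A l σ y * u y) :
    SatisfiesAt u b ↔ SatisfiesAt u' (baseMap A l b) := by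
  have near := eventually_den_ne A hb
  have sm : ∀ {y : Base}, den A y.1 ≠ 0 → ContDiffAt ℝ ∞ (fun y => (baseMap A l y).1) y ∧
      ContDiffAt ℝ ∞ (fun y => (baseMap A l y).2.1) y ∧
      ContDiffAt ℝ ∞ (fun y => (baseMap A l y).2.2) y := fun hy =>
    ⟨(contDiffAt_baseMap l hy).fst, (contDiffAt_baseMap l hy).snd.fst,
      (contDiffAt_baseMap l hy).snd.snd⟩
  have Xx : ∀ {y : Base}, den A y.1 ≠ 0 →
      pd ex (fun y => (baseMap A l y).2.1) y = 1 / den A y.1 := fun hy => by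
    rw [pd_of_hasDerivAt (sm hy).2.1.diff (hasDerivAt_baseMap_x_line A l ex hy (r' := 0) (x' := 1)
      (y' := 0) (by simp) (by simp) (by simp))]
    ring
  -- At a fixed point the transport operator ∂_t + x ∂_y is the derivative in the single direction
  -- (1, 0, x). Along it ŷ has derivative x̂, whence the value `y' := xHat l b` below.
  have V : ∀ F : Base → ℝ, pd et F b + b.2.1 * pd ey F b = pd (1, 0, b.2.1) F b := fun F => by
    rw [pd_base (1, 0, b.2.1)]; ring
  have hm : DifferentiableAt ℝ (logDerivX A l) b := by
    have h1 := (contDiff_den A).contDiffAt (x := b)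
    have h2 := (contDiff_xHat l).contDiffAt (x := b)
    have h3 := (contDiff_yHat l).contDiffAt (x := b)
    exact ContDiffAt.diff ((((contDiffAt_const.mul h2).div h1 hb).sub
      ((contDiffAt_const.mul h3).div (h1.pow 2) (pow_ne_zero _ hb))).sub
      ((contDiffAt_const.mul contDiffAt_fst).add contDiffAt_const))
  have e : b + (0 : ℝ) • ex = b := by simp
  have hmx : pd ex (logDerivX A l) b = 2 * A 1 0 / den A b.1 := by
    have h1 := hasDerivAt_den_line A b ex
    have h2 := hasDerivAt_xHat_line l b ex
    have h3 := hasDerivAt_yHat_line l b ex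
    have h4 := hasDerivAt_t_line b ex
    have hb' : den A (b + (0 : ℝ) • ex).1 ≠ 0 := by rwa [e]
    have := (((h2.const_mul (2 * A 1 0)).div h1 hb').sub
      ((h3.const_mul (3 * A 1 0 ^ 2)).div (h1.pow 2) (pow_ne_zero _ hb'))).sub
      ((h4.const_mul (3 * l 3)).add_const (l 2))
    rw [pd_of_hasDerivAt hm this]
    rw [e]
    simp
    field_simp
  refine satisfiesAt_transfer (T := fun y => (baseMap A l y).1)
    (X := fun y => (baseMap A l y).2.1) (Y := fun y => (baseMap A l y).2.2)
    (M := multiplier A l σ) (m := logDerivX A l)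
    (near.mono fun y hy => (sm hy).1) (near.mono fun y hy => (sm hy).2.1)
    (near.mono fun y hy => (sm hy).2.2) (near.mono fun y hy => contDiffAt_multiplier l σ hy)
    hu hu' heq ?_ ?_ hm ?_ ?_ (multiplier_ne_zero l hb hσ) ?_ ?_ ?_ ?_ ?_
  · filter_upwards [near] with y hy
    rw [pd_of_hasDerivAt (sm hy).1.diff (hasDerivAt_baseMap_t_line A l ex hy)]
    simp
  · filter_upwards [near] with y hy
    rw [pd_of_hasDerivAt (sm hy).2.2.diff (hasDerivAt_baseMap_y_line A l ex hy (r' := 0)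
      (y' := 0) (by simp) (by simp))]
    simp
  · filter_upwards [near] with y hy
    rw [pd_of_hasDerivAt (contDiffAt_multiplier l σ hy).diff
      (hasDerivAt_multiplier_line A l σ ex hy (hasDerivAt_expA_line A l ex hy (r' := 0) (x' := 1)
      (y' := 0) (by simp) (by simp) (by simp)) (hasDerivAt_expL_line l y ex)), logDerivX]
    simp
    left
    field_simp
    ring
  · rw [Xx hb]; exact one_div_ne_zero hb
  · have : pd ex (fun y => (baseMap A l y).2.1) =ᶠ[𝓝 b] fun y => 1 / den A y.1 :=
      near.mono fun y hy => Xx hy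
    rw [pd_congr this]
    have h1 := (hasDerivAt_const (0 : ℝ) (1 : ℝ)).div (hasDerivAt_den_line A b ex)
      (by rwa [e])
    erw [pd_of_hasDerivAt (contDiffAt_const.div (contDiff_den A).contDiffAt hb).diff h1]
    simp
  · rw [V, Xx hb, pd_of_hasDerivAt (sm hb).1.diff (hasDerivAt_baseMap_t_line A l _ hb)]
    simp
  · rw [V, Xx hb, pd_of_hasDerivAt (sm hb).2.2.diff (hasDerivAt_baseMap_y_line A l _ hb
      (r' := A 1 0) (y' := xHat l b) (by simp) (by simp [xHat]; ring))]
    simp only [baseMap]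
    field_simp
  · rw [V, Xx hb, pd_of_hasDerivAt (sm hb).2.1.diff (hasDerivAt_baseMap_x_line A l _ hb
      (r' := A 1 0) (x' := 6 * l 3 * b.1 + 2 * l 2) (y' := xHat l b) (by simp) (by simp)
      (by simp [xHat]; ring)), logDerivX]
    field_simp
    ring
  · rw [V, hmx, pd_of_hasDerivAt (contDiffAt_multiplier l σ hb).diff
      (hasDerivAt_multiplier_line A l σ _ hb (hasDerivAt_expA_line A l _ hb
      (r' := A 1 0) (x' := 6 * l 3 * b.1 + 2 * l 2) (y' := xHat l b) (by simp) (by simp)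
      (by simp [xHat]; ring)) (hasDerivAt_expL_line l b _)), logDerivX]
    congr 1
    simp only [mul_one, mul_zero, one_mul, add_zero, sub_self]
    field_simp
    ring

end Formula

end Kolmogorov

/-! ### Cubic polynomials as parameters and the elementary composition laws -/

namespace Kolmogorov

section Parameters

/-- The action of `SL(2, ℝ)` on the coefficients of cubic polynomials:
`p(t) ↦ (γ t + δ)³ p((α t + β) / (γ t + δ))`. -/
noncomputable def pull (A : SL2) (l : Fin 4 → ℝ) : Fin 4 → ℝ :=
  ![l 3 * A 0 1 ^ 3 + l 2 * A 0 1 ^ 2 * A 1 1 + l 1 * A 0 1 * A 1 1 ^ 2 + l 0 * A 1 1 ^ 3,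
    3 * l 3 * A 0 0 * A 0 1 ^ 2 + l 2 * (2 * A 0 0 * A 0 1 * A 1 1 + A 0 1 ^ 2 * A 1 0)
      + l 1 * (A 0 0 * A 1 1 ^ 2 + 2 * A 0 1 * A 1 0 * A 1 1) + 3 * l 0 * A 1 0 * A 1 1 ^ 2,
    3 * l 3 * A 0 0 ^ 2 * A 0 1 + l 2 * (A 0 0 ^ 2 * A 1 1 + 2 * A 0 0 * A 0 1 * A 1 0)
      + l 1 * (2 * A 0 0 * A 1 0 * A 1 1 + A 0 1 * A 1 0 ^ 2) + 3 * l 0 * A 1 0 ^ 2 * A 1 1,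
    l 3 * A 0 0 ^ 3 + l 2 * A 0 0 ^ 2 * A 1 0 + l 1 * A 0 0 * A 1 0 ^ 2 + l 0 * A 1 0 ^ 3]

/-- The bilinear form describing the composition of two shifts. -/
noncomputable def pair (l l' : Fin 4 → ℝ) : ℝ := 3 * l 3 * l' 0 - l 2 * l' 1

theorem fin4_ext {l l' : Fin 4 → ℝ} (h0 : l 0 = l' 0) (h1 : l 1 = l' 1) (h2 : l 2 = l' 2)
    (h3 : l 3 = l' 3) : l = l' := by
  funext i; fin_cases i <;> assumption

theorem pull_one (l : Fin 4 → ℝ) : pull 1 l = l := by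
  apply fin4_ext <;> simp [pull]

theorem pull_neg (A : SL2) (l : Fin 4 → ℝ) : pull A (-l) = -pull A l := by
  apply fin4_ext <;> simp [pull] <;> ring

theorem pull_add (A : SL2) (l l' : Fin 4 → ℝ) : pull A (l + l') = pull A l + pull A l' := by
  apply fin4_ext <;> simp [pull] <;> ring

theorem pull_mul (A B : SL2) (l : Fin 4 → ℝ) : pull (A * B) l = pull B (pull A l) := by
  apply fin4_ext <;>
  simp [pull, Matrix.SpecialLinearGroup.coe_mul, Matrix.mul_apply, Fin.sum_univ_two] <;> ring

theorem pull_zero (A : SL2) : pull A 0 = 0 := by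
  apply fin4_ext <;> simp [pull]

theorem pair_neg_left (l l' : Fin 4 → ℝ) : pair (-l) l' = -pair l l' := by simp [pair]; ring

theorem pair_neg_right (l l' : Fin 4 → ℝ) : pair l (-l') = -pair l l' := by simp [pair]; ring

theorem pair_add_left (l l' l'' : Fin 4 → ℝ) : pair (l + l') l'' = pair l l'' + pair l' l'' := by
  simp [pair]; ring

theorem pair_add_right (l l' l'' : Fin 4 → ℝ) : pair l (l' + l'') = pair l l' + pair l l'' := by
  simp [pair]; ring

/-- The antisymmetrization of `pair` is invariant. -/
theorem pair_pull_antisymm (A : SL2) (l l' : Fin 4 → ℝ) :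
    pair (pull A l) (pull A l') - pair (pull A l') (pull A l) = pair l l' - pair l' l := by
  have h := det_eq A
  -- As an invariant pairing of binary cubics, the antisymmetrized form is multiplied by the cube of
  -- the determinant.
  have h3 : (A 0 0 * A 1 1 - A 0 1 * A 1 0) ^ 3 = 1 := by rw [h]; norm_num
  simp only [pair, pull, Matrix.cons_val]
  linear_combination (3 * l 3 * l' 0 - l 2 * l' 1 - 3 * l' 3 * l 0 + l' 2 * l 1) * h3

/-- The shift of the logarithm of `σ` when a shift is moved past an element of `SL(2, ℝ)`. -/
noncomputable def pullShift (A : SL2) (l : Fin 4 → ℝ) : ℝ :=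
  (pair (pull A l) (pull A l) - pair l l) / 2

end Parameters

theorem den_one (t : ℝ) : den 1 t = 1 := by simp [den]

theorem xHat_zero (b : Base) : xHat 0 b = b.2.1 := by simp [xHat]

theorem yHat_zero (b : Base) : yHat 0 b = b.2.2 := by simp [yHat]

theorem baseMap_one (l : Fin 4 → ℝ) (b : Base) : baseMap 1 l b = (b.1, xHat l b, yHat l b) := by
  simp [baseMap, den_one]

theorem baseMap_one_zero (b : Base) : baseMap 1 0 b = b := by
  simp [baseMap_one, xHat_zero, yHat_zero]

theorem expA_one (l : Fin 4 → ℝ) (b : Base) : expA 1 l b = 0 := by simp [expA]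

theorem expL_zero (b : Base) : expL 0 b = 0 := by simp [expL]

theorem multiplier_one (l : Fin 4 → ℝ) (σ : ℝ) (b : Base) :
    multiplier 1 l σ b = σ * Real.exp (expL l b) := by
  simp [multiplier_eq, den_one, expA_one]

theorem multiplier_one_zero (σ : ℝ) (b : Base) : multiplier 1 0 σ b = σ := by
  simp [multiplier_one, expL_zero]

theorem mul_entries (A B : SL2) : (A * B) 0 0 = A 0 0 * B 0 0 + A 0 1 * B 1 0 ∧
    (A * B) 0 1 = A 0 0 * B 0 1 + A 0 1 * B 1 1 ∧ (A * B) 1 0 = A 1 0 * B 0 0 + A 1 1 * B 1 0 ∧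
    (A * B) 1 1 = A 1 0 * B 0 1 + A 1 1 * B 1 1 := by
  simp [Matrix.SpecialLinearGroup.coe_mul, Matrix.mul_apply, Fin.sum_univ_two]

/-- The denominator is the automorphy factor of the Möbius action, hence multiplicative along
compositions. The non-vanishing of denominators for products and inverses follows from this
identity. -/
theorem den_mul (A B : SL2) (l : Fin 4 → ℝ) {b : Base} (hb : den B b.1 ≠ 0) :
    den (A * B) b.1 = den A (baseMap B l b).1 * den B b.1 := by
  obtain ⟨-, -, h1, h2⟩ := mul_entries A B
  have : (baseMap B l b).1 * den B b.1 = B 0 0 * b.1 + B 0 1 := div_mul_cancel₀ _ hb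
  unfold den at this ⊢
  rw [h1, h2]
  linear_combination (-A 1 0) * this

/-- The entries of `A` in terms of numerator and denominator at `t`. -/
theorem entries_eq (A : SL2) {t : ℝ} (ht : den A t ≠ 0) :
    A 0 0 = (1 + A 1 0 * (A 0 0 * t + A 0 1)) / den A t ∧ A 1 1 = den A t - A 1 0 * t := by
  refine ⟨?_, by unfold den; ring⟩
  rw [eq_div_iff ht]
  unfold den
  linear_combination det_eq A

/-- The parameters `l` enter only through x̂ and ŷ, so every base map is a shift followed by an
element of SL(2, ℝ). Composition laws then need to be proved only for the two kinds of factors. -/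
theorem baseMap_eq (A : SL2) (l : Fin 4 → ℝ) (b : Base) :
    baseMap A l b = baseMap A 0 (baseMap 1 l b) := by
  rw [baseMap_one, baseMap, baseMap, xHat_zero, yHat_zero]

theorem expA_eq (A : SL2) (l : Fin 4 → ℝ) (b : Base) :
    expA A l b = expA A 0 (baseMap 1 l b) := by
  rw [baseMap_one, expA, expA, xHat_zero, yHat_zero]

theorem baseMap_shift_shift (l l' : Fin 4 → ℝ) (b : Base) :
    baseMap 1 l (baseMap 1 l' b) = baseMap 1 (l' + l) b := by
  simp only [baseMap_one, xHat, yHat, Pi.add_apply]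
  ext <;> simp <;> ring

/-- Shifts add on the base, but their exponents add only up to a constant. This constant is the
Heisenberg cocycle `pair`. -/
theorem expL_shift (l l' : Fin 4 → ℝ) (b : Base) :
    expL l (baseMap 1 l' b) + expL l' b = expL (l' + l) b + pair l l' := by
  simp only [baseMap_one, xHat, yHat, Pi.add_apply, expL, pair]
  ring

theorem baseMap_linear_linear (A B : SL2) {b : Base} (hB : den B b.1 ≠ 0)
    (hA : den A (baseMap B 0 b).1 ≠ 0) :
    baseMap A 0 (baseMap B 0 b) = baseMap (A * B) 0 b := by
  have hAB := den_mul A B 0 hB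
  obtain ⟨h1, h2, h3, h4⟩ := mul_entries A B
  obtain ⟨e1, e2⟩ := entries_eq B hB
  have hT : (baseMap B 0 b).1 = (B 0 0 * b.1 + B 0 1) / den B b.1 := rfl
  ext
  · simp only [baseMap] at hA hAB ⊢
    rw [hAB, h1, h2]
    field_simp
    unfold den
    ring
  -- The entries are eliminated in favour of numerators and denominators, one of them through the
  -- determinant relation. What remains is an identity of rational functions in independent
  -- variables.
  · have : A 1 1 = den A (baseMap B 0 b).1 - A 1 0 * (baseMap B 0 b).1 := by unfold den; ring
    simp only [baseMap, xHat_zero, yHat_zero] at hA hAB this ⊢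
    generalize hN : B 0 0 * b.1 + B 0 1 = N at *
    rw [hAB, h3, this]
    generalize den A (N / den B b.1) = R at *
    rw [e1]
    generalize den B b.1 = r at *
    field_simp
    ring
  · simp only [baseMap, yHat_zero] at hA hAB ⊢
    rw [hAB]
    field_simp

theorem expA_linear (A B : SL2) {b : Base} (hB : den B b.1 ≠ 0)
    (hA : den A (baseMap B 0 b).1 ≠ 0) :
    expA A 0 (baseMap B 0 b) + expA B 0 b = expA (A * B) 0 b := by
  have hAB := den_mul A B 0 hB
  obtain ⟨h1, h2, h3, h4⟩ := mul_entries A B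
  obtain ⟨e1, e2⟩ := entries_eq B hB
  have : A 1 1 = den A (baseMap B 0 b).1 - A 1 0 * (baseMap B 0 b).1 := by unfold den; ring
  simp only [expA, xHat_zero, yHat_zero]
  simp only [baseMap, xHat_zero, yHat_zero] at hA hAB this ⊢
  generalize hN : B 0 0 * b.1 + B 0 1 = N at *
  rw [hAB, h3, this]
  generalize den A (N / den B b.1) = R at *
  rw [e1]
  generalize den B b.1 = r at *
  field_simp
  ring

/-- Adding p(t̃) to y/(γt+δ)³ is the same as adding (γt+δ)³ p(t̃) to y, and the latter cubic is the
one with coefficients `pull A l`. -/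
theorem yHat_linear (A : SL2) (l : Fin 4 → ℝ) {b : Base} (hb : den A b.1 ≠ 0) :
    yHat l (baseMap A 0 b) = yHat (pull A l) b / den A b.1 ^ 3 := by
  simp only [yHat, pull, baseMap, xHat_zero, Matrix.cons_val, Pi.zero_apply]
  field_simp
  unfold den
  ring

/-- This is the t-derivative of the preceding identity. If q(t) = (γt+δ)³ p(t̃), then p'(t̃) =
q'/(γt+δ) − 3γ q/(γt+δ)², and x̂ contains the derivative of the cubic. -/
theorem xHat_linear (A : SL2) (l : Fin 4 → ℝ) {b : Base} (hb : den A b.1 ≠ 0) :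
    xHat l (baseMap A 0 b) = xHat (pull A l) b / den A b.1
      - 3 * A 1 0 * yHat (pull A l) b / den A b.1 ^ 2 := by
  obtain ⟨e1, e2⟩ := entries_eq A hb
  have e3 : A 0 1 = (A 0 0 * b.1 + A 0 1) - A 0 0 * b.1 := by ring
  simp only [xHat, yHat, pull, baseMap, Matrix.cons_val, Pi.zero_apply]
  generalize A 0 0 * b.1 + A 0 1 = N at *
  generalize den A b.1 = r at *
  rw [e3, e2, e1]
  field_simp
  ring

theorem baseMap_shift_linear (A : SL2) (l : Fin 4 → ℝ) {b : Base} (hb : den A b.1 ≠ 0) :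
    baseMap 1 l (baseMap A 0 b) = baseMap A (pull A l) b := by
  rw [baseMap_one, xHat_linear A l hb, yHat_linear A l hb]
  rfl

/-- Moving a shift past an element of SL(2, ℝ) matches the exponents up to a constant, half the
change of the quadratic form `pair l l` under `pull`. -/
theorem expL_linear (A : SL2) (l : Fin 4 → ℝ) {b : Base} (hb : den A b.1 ≠ 0) :
    expL l (baseMap A 0 b) + expA A 0 b
      = expA A (pull A l) b + expL (pull A l) b + pullShift A l := by
  obtain ⟨e1, e2⟩ := entries_eq A hb
  have e3 : A 0 1 = (A 0 0 * b.1 + A 0 1) - A 0 0 * b.1 := by ring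
  simp only [expL, expA, xHat, yHat, pullShift, pair, pull, baseMap, Matrix.cons_val,
    Pi.zero_apply]
  generalize A 0 0 * b.1 + A 0 1 = N at *
  generalize den A b.1 = r at *
  rw [e3, e2, e1]
  field_simp
  ring

end Kolmogorov

/-! ### Composition and inversion of the transformations -/

namespace Kolmogorov

section Composition

/-- The factor arising in the composition of two transformations. -/
noncomputable def cocycle (A : SL2) (l l' : Fin 4 → ℝ) : ℝ := pullShift A l' + pair (pull A l') l

variable (A B : SL2) (l l' : Fin 4 → ℝ) (σ σ' : ℝ)

theorem baseMap_comp {b : Base} (hB : den B b.1 ≠ 0) (hA : den A (baseMap B l b).1 ≠ 0) :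
    baseMap A l' (baseMap B l b) = baseMap (A * B) (l + pull B l') b := by
  have hb' : den B (baseMap 1 l b).1 ≠ 0 := by rwa [baseMap_one]
  have hA' : den A (baseMap B 0 (baseMap 1 (l + pull B l') b)).1 ≠ 0 := by
    rw [baseMap_one]; exact hA
  have hB' : den B (baseMap 1 (l + pull B l') b).1 ≠ 0 := by rwa [baseMap_one]
  rw [baseMap_eq A, baseMap_eq B l, baseMap_shift_linear B l' hb', baseMap_eq B (pull B l'),
    baseMap_shift_shift, baseMap_linear_linear A B hB' hA', ← baseMap_eq]

theorem multiplier_comp {b : Base} (hB : den B b.1 ≠ 0) (hA : den A (baseMap B l b).1 ≠ 0) :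
    multiplier A l' σ' (baseMap B l b) * multiplier B l σ b
      = multiplier (A * B) (l + pull B l') (σ' * σ * Real.exp (cocycle B l l')) b := by
  have hb' : den B (baseMap 1 l b).1 ≠ 0 := by rwa [baseMap_one]
  have hA' : den A (baseMap B 0 (baseMap 1 (l + pull B l') b)).1 ≠ 0 := by
    rw [baseMap_one]; exact hA
  have hB' : den B (baseMap 1 (l + pull B l') b).1 ≠ 0 := by rwa [baseMap_one]
  have key : expA A l' (baseMap B l b) + expL l' (baseMap B l b) + (expA B l b + expL l b)
      = expA (A * B) (l + pull B l') b + expL (l + pull B l') b + cocycle B l l' := by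
    have h1 := expL_linear B l' hb'
    have h2 := expL_shift (pull B l') l b
    have h3 := expA_linear A B hB' hA'
    have h4 : expA B (pull B l') (baseMap 1 l b) = expA B 0 (baseMap 1 (l + pull B l') b) := by
      rw [expA_eq, baseMap_shift_shift]
    have h5 : expA A l' (baseMap B l b) = expA A 0 (baseMap B 0 (baseMap 1 (l + pull B l') b)) := by
      rw [expA_eq, baseMap_eq B l, baseMap_shift_linear B l' hb', baseMap_eq B (pull B l'),
        baseMap_shift_shift]
    rw [h5, expA_eq B l, expA_eq (A * B), cocycle, baseMap_eq B l]
    -- `h1` moves the outer shift through `B` and produces `pullShift`; `h2` merges the two shifts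
    -- and produces `pair`; `h3` composes the SL(2, ℝ) parts without a constant.
    linear_combination h1 + h2 + h3 + h4
  have e1 : ∀ a b c d : ℝ, σ' * a ^ 2 * Real.exp b * Real.exp c * (σ * d ^ 2 * Real.exp (expA B l
      ‹Base›) * Real.exp (expL l ‹Base›)) = σ' * σ * (a * d) ^ 2 *
      Real.exp (b + c + (expA B l ‹Base› + expL l ‹Base›)) := fun a b c d => by
    rw [Real.exp_add, Real.exp_add, Real.exp_add]; ring
  rw [multiplier_eq, multiplier_eq, multiplier_eq, e1, key, den_mul A B l hB, Real.exp_add,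
    Real.exp_add]
  ring

/-- The shift parameters of the inverse transformation. -/
noncomputable def invShift : Fin 4 → ℝ := -pull A⁻¹ l

/-- The scaling parameter of the inverse transformation. -/
noncomputable def invScale : ℝ :=
  σ⁻¹ * Real.exp ((pair (pull A⁻¹ l) (pull A⁻¹ l) + pair l l) / 2)

theorem add_pull_invShift : l + pull A (invShift A l) = 0 := by
  rw [invShift, pull_neg, ← pull_mul, inv_mul_cancel, pull_one]; simp

theorem invShift_add_pull : invShift A l + pull A⁻¹ l = 0 := by
  rw [invShift]; simp

/-- The cocycles of the two products with the inverse coincide, so the single scale `invScale` works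
on both sides. -/
theorem cocycle_inv_left : cocycle A l (invShift A l)
    = -((pair (pull A⁻¹ l) (pull A⁻¹ l) + pair l l) / 2) := by
  have h : pull A (invShift A l) = -l := by
    rw [invShift, pull_neg, ← pull_mul, inv_mul_cancel, pull_one]
  rw [cocycle, pullShift, h, invShift]
  simp only [pair_neg_left, pair_neg_right]
  ring

theorem cocycle_inv_right : cocycle A⁻¹ (invShift A l) l
    = -((pair (pull A⁻¹ l) (pull A⁻¹ l) + pair l l) / 2) := by
  rw [cocycle, pullShift, invShift]
  simp only [pair_neg_right]
  ring

variable {A σ}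

theorem den_inv_ne {b : Base} (hb : den A b.1 ≠ 0) : den A⁻¹ (baseMap A l b).1 ≠ 0 := by
  have := den_mul A⁻¹ A l hb
  rw [inv_mul_cancel, den_one] at this
  intro h
  rw [h, zero_mul] at this
  exact one_ne_zero this

theorem den_ne_of_inv {b : Base} (hb : den A⁻¹ b.1 ≠ 0) : den A (baseMap A⁻¹ l b).1 ≠ 0 := by
  simpa using den_inv_ne (A := A⁻¹) l hb

theorem baseMap_inv_left {b : Base} (hb : den A b.1 ≠ 0) :
    baseMap A⁻¹ (invShift A l) (baseMap A l b) = b := by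
  rw [baseMap_comp _ _ _ _ hb (den_inv_ne l hb), inv_mul_cancel, add_pull_invShift,
    baseMap_one_zero]

theorem baseMap_inv_right {b : Base} (hb : den A⁻¹ b.1 ≠ 0) :
    baseMap A l (baseMap A⁻¹ (invShift A l) b) = b := by
  rw [baseMap_comp _ _ _ _ hb (den_ne_of_inv _ hb), mul_inv_cancel, invShift_add_pull,
    baseMap_one_zero]

theorem multiplier_inv_left (hσ : σ ≠ 0) {b : Base} (hb : den A b.1 ≠ 0) :
    multiplier A⁻¹ (invShift A l) (invScale A l σ) (baseMap A l b) * multiplier A l σ b = 1 := by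
  rw [multiplier_comp _ _ _ _ _ _ hb (den_inv_ne l hb), inv_mul_cancel, add_pull_invShift,
    multiplier_one_zero, cocycle_inv_left, invScale, Real.exp_neg]
  field_simp

theorem multiplier_inv_right (hσ : σ ≠ 0) {b : Base} (hb : den A⁻¹ b.1 ≠ 0) :
    multiplier A l σ (baseMap A⁻¹ (invShift A l) b)
      * multiplier A⁻¹ (invShift A l) (invScale A l σ) b = 1 := by
  rw [multiplier_comp _ _ _ _ _ _ hb (den_ne_of_inv _ hb), mul_inv_cancel, invShift_add_pull,
    multiplier_one_zero, cocycle_inv_right, invScale, Real.exp_neg]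
  field_simp

theorem invScale_ne_zero (hσ : σ ≠ 0) : invScale A l σ ≠ 0 :=
  mul_ne_zero (inv_ne_zero hσ) (Real.exp_ne_zero _)

end Composition

/-- The inverse of a transformation. -/
noncomputable def formulaInv (A : SL2) (l : Fin 4 → ℝ) (σ : ℝ) (f : Base → ℝ) (q : Total) : Total :=
  (baseMap A⁻¹ (invShift A l) q.1,
    multiplier A⁻¹ (invShift A l) (invScale A l σ) q.1 * q.2
      - f (baseMap A⁻¹ (invShift A l) q.1))

/-! ### The transformations as homeomorphisms of their natural domains -/

section Homeomorph

variable {A : SL2} {l : Fin 4 → ℝ} {σ : ℝ} {f : Base → ℝ} {Ω : Set Base}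

theorem contDiffAt_formula {p : Total} (hp : den A p.1.1 ≠ 0) (hf : ContDiffAt ℝ ∞ f p.1) :
    ContDiffAt ℝ ∞ (formula A l σ f) p := by
  unfold formula
  have h1 : ContDiffAt ℝ ∞ (fun q : Total => baseMap A l q.1) p :=
    ContDiffAt.comp p (contDiffAt_baseMap l hp) contDiffAt_fst
  have h2 : ContDiffAt ℝ ∞ (fun q : Total => multiplier A l σ q.1) p :=
    ContDiffAt.comp p (contDiffAt_multiplier l σ hp) contDiffAt_fst
  have h3 : ContDiffAt ℝ ∞ (fun q : Total => f q.1) p := ContDiffAt.comp p hf contDiffAt_fst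
  exact h1.prodMk (h2.mul (contDiffAt_snd.add h3))

theorem contDiffAt_formulaInv {p : Total} (hp : den A⁻¹ p.1.1 ≠ 0)
    (hf : ContDiffAt ℝ ∞ f (baseMap A⁻¹ (invShift A l) p.1)) :
    ContDiffAt ℝ ∞ (formulaInv A l σ f) p := by
  unfold formulaInv
  have h1 : ContDiffAt ℝ ∞ (fun q : Total => baseMap A⁻¹ (invShift A l) q.1) p :=
    ContDiffAt.comp p (contDiffAt_baseMap (invShift A l) hp) contDiffAt_fst
  have h2 : ContDiffAt ℝ ∞
      (fun q : Total => multiplier A⁻¹ (invShift A l) (invScale A l σ) q.1) p :=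
    ContDiffAt.comp p (contDiffAt_multiplier (invShift A l) (invScale A l σ) hp) contDiffAt_fst
  have h3 : ContDiffAt ℝ ∞ (fun q : Total => f (baseMap A⁻¹ (invShift A l) q.1)) p :=
    ContDiffAt.comp p hf h1
  exact h1.prodMk ((h2.mul contDiffAt_snd).sub h3)

theorem formulaInv_formula (hσ : σ ≠ 0) {p : Total} (hp : den A p.1.1 ≠ 0) :
    formulaInv A l σ f (formula A l σ f p) = p := by
  ext1
  · exact baseMap_inv_left l hp
  · simp only [formulaInv, formula]
    rw [← mul_assoc, multiplier_inv_left l hσ hp, baseMap_inv_left l hp]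
    ring

theorem formula_formulaInv (hσ : σ ≠ 0) {q : Total} (hq : den A⁻¹ q.1.1 ≠ 0) :
    formula A l σ f (formulaInv A l σ f q) = q := by
  ext1
  · exact baseMap_inv_right l hq
  · simp only [formulaInv, formula]
    rw [sub_add_cancel, ← mul_assoc, multiplier_inv_right l hσ hq, one_mul]

theorem isOpen_naturalDomain (hΩ : IsOpen Ω) : IsOpen (naturalDomain A Ω) :=
  (hΩ.preimage continuous_fst).inter ((isOpen_den_ne A).preimage continuous_fst)

theorem isOpen_preimage_baseMap (hΩ : IsOpen Ω) :
    IsOpen {b : Base | den A b.1 ≠ 0 ∧ baseMap A l b ∈ Ω} := by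
  refine isOpen_iff_mem_nhds.2 fun b hb => ?_
  exact Filter.inter_mem (eventually_den_ne A hb.1)
    ((contDiffAt_baseMap l hb.1).continuousAt.preimage_mem_nhds (hΩ.mem_nhds hb.2))

/-- The transformation with the given parameters as a homeomorphism from its natural domain. -/
noncomputable def transformation (A : SL2) (l : Fin 4 → ℝ) {σ : ℝ} (hσ : σ ≠ 0) {f : Base → ℝ}
    {Ω : Set Base} (hΩ : IsOpen Ω) (hf : ContDiffOn ℝ ∞ f Ω) :
    OpenPartialHomeomorph Total Total where
  toFun := formula A l σ f
  invFun := formulaInv A l σ f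
  source := naturalDomain A Ω
  target := {q | den A⁻¹ q.1.1 ≠ 0 ∧ baseMap A⁻¹ (invShift A l) q.1 ∈ Ω}
  map_source' p hp := ⟨den_inv_ne l hp.2, by
    change baseMap A⁻¹ (invShift A l) (baseMap A l p.1) ∈ Ω
    rw [baseMap_inv_left l hp.2]; exact hp.1⟩
  map_target' q hq := ⟨hq.2, den_ne_of_inv _ hq.1⟩
  left_inv' p hp := formulaInv_formula hσ hp.2
  right_inv' q hq := formula_formulaInv hσ hq.1
  open_source := isOpen_naturalDomain hΩ
  open_target := (isOpen_preimage_baseMap hΩ).preimage continuous_fst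
  continuousOn_toFun p hp :=
    (contDiffAt_formula hp.2 (hf.contDiffAt (hΩ.mem_nhds hp.1))).continuousAt.continuousWithinAt
  continuousOn_invFun p hp :=
    (contDiffAt_formulaInv hp.1 (hf.contDiffAt (hΩ.mem_nhds hp.2))).continuousAt.continuousWithinAt

theorem hasForm_transformation (hσ : σ ≠ 0) (hΩ : IsOpen Ω) (hf : ContDiffOn ℝ ∞ f Ω) :
    HasForm A l σ f Ω (transformation A l hσ hΩ hf) :=
  ⟨rfl, fun _ _ => rfl⟩

end Homeomorph

/-! ### The parameters are determined by the germ -/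

section Rigidity

/-- A polynomial of degree at most three vanishing near a point is zero. -/
theorem cubic_eq_zero {a b c d t₀ : ℝ}
    (h : ∀ᶠ t in 𝓝 t₀, a * t ^ 3 + b * t ^ 2 + c * t + d = 0) : a = 0 ∧ b = 0 ∧ c = 0 ∧ d = 0 := by
  obtain ⟨ε, hε, h⟩ := Metric.eventually_nhds_iff.1 h
  -- Sample at k = 0, 1/4, 2/4, 3/4. The third, second and first differences with step ε/4 isolate
  -- the coefficients in turn; for instance the third difference is 6a(ε/4)³, whence the factor
  -- 64/6.
  have e : ∀ k : ℝ, |k| < 1 → a * (t₀ + k * ε) ^ 3 + b * (t₀ + k * ε) ^ 2 + c * (t₀ + k * ε) + d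
      = 0 := fun k hk => h (by
    rw [Real.dist_eq, add_sub_cancel_left, abs_mul, abs_of_pos hε]
    nlinarith)
  have e0 := e 0 (by norm_num)
  have e1 := e (1 / 4) (by rw [abs_of_pos] <;> norm_num)
  have e2 := e (2 / 4) (by rw [abs_of_pos] <;> norm_num)
  have e3 := e (3 / 4) (by rw [abs_of_pos] <;> norm_num)
  have ha : a = 0 := by
    have : a * ε ^ 3 = 0 := by linear_combination 64 / 6 * (e3 - 3 * e2 + 3 * e1 - e0)
    exact (mul_eq_zero.1 this).resolve_right (pow_ne_zero _ hε.ne')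
  subst ha
  have hb : b = 0 := by
    have : b * ε ^ 2 = 0 := by linear_combination 8 * (e2 - 2 * e1 + e0)
    exact (mul_eq_zero.1 this).resolve_right (pow_ne_zero _ hε.ne')
  subst hb
  have hc : c = 0 := by
    have : c * ε = 0 := by linear_combination 4 * (e1 - e0)
    exact (mul_eq_zero.1 this).resolve_right hε.ne'
  subst hc
  exact ⟨rfl, rfl, rfl, by linear_combination e0⟩

variable {A A' : SL2} {l l' : Fin 4 → ℝ} {σ σ' : ℝ} {f f' : Base → ℝ}

/-- The parameters of a transformation are determined by it near any point. -/
theorem params_unique (hσ : σ ≠ 0) {p : Total} (hp : den A p.1.1 ≠ 0) (hp' : den A' p.1.1 ≠ 0)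
    (h : formula A l σ f =ᶠ[𝓝 p] formula A' l' σ' f') :
    A = A' ∧ l = l' ∧ σ = σ' ∧ ∀ᶠ b in 𝓝 p.1, f b = f' b := by
  obtain ⟨⟨t₀, x₀, y₀⟩, v₀⟩ := p
  have H : ∀ᶠ q : Total in 𝓝 ((t₀, x₀, y₀), v₀), den A q.1.1 ≠ 0 ∧ den A' q.1.1 ≠ 0 ∧
      formula A l σ f q = formula A' l' σ' f' q := by
    filter_upwards [continuous_fst.continuousAt.eventually (eventually_den_ne A hp),
      continuous_fst.continuousAt.eventually (eventually_den_ne A' hp'), h] with q h1 h2 h3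
      using ⟨h1, h2, h3⟩
  -- The neighbourhood is refined to a product, so that t, x, y and u can be varied independently.
  obtain ⟨P, hP, Q, hQ, HPQ⟩ := Filter.eventually_prod_iff.1 (nhds_prod_eq (X := Base) (Y := ℝ) ▸ H)
  obtain ⟨Pt, hPt, Pxy, hPxy, HP⟩ :=
    Filter.eventually_prod_iff.1 (nhds_prod_eq (X := ℝ) (Y := ℝ × ℝ) ▸ hP)
  obtain ⟨Px, hPx, Py, hPy, HPxy⟩ :=
    Filter.eventually_prod_iff.1 (nhds_prod_eq (X := ℝ) (Y := ℝ) ▸ hPxy)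
  have v0 := hQ.self_of_nhds
  have y0 := hPy.self_of_nhds
  have x0 := hPx.self_of_nhds
  obtain ⟨x₁, x1, hx1⟩ : ∃ x, Px x ∧ x ≠ x₀ := by
    have h1 : ∃ᶠ x in 𝓝[≠] x₀, x ∈ ({x₀}ᶜ : Set ℝ) :=
      (eventually_mem_nhdsWithin (a := x₀) (s := {x₀}ᶜ)).frequently
    obtain ⟨x, hx, hx'⟩ := ((hPx.filter_mono nhdsWithin_le_nhds).and_frequently h1).exists
    exact ⟨x, hx, hx'⟩
  obtain ⟨v₁, v1, hv1⟩ : ∃ x, Q x ∧ x ≠ v₀ := by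
    have h1 : ∃ᶠ x in 𝓝[≠] v₀, x ∈ ({v₀}ᶜ : Set ℝ) :=
      (eventually_mem_nhdsWithin (a := v₀) (s := {v₀}ᶜ)).frequently
    obtain ⟨x, hx, hx'⟩ := ((hQ.filter_mono nhdsWithin_le_nhds).and_frequently h1).exists
    exact ⟨x, hx, hx'⟩
  -- The x component is affine in x with slope 1/(γt+δ). Subtracting its values at two points x
  -- isolates the denominator.
  have hden : ∀ᶠ t in 𝓝 t₀, den A t = den A' t := by
    filter_upwards [hPt] with t ht
    obtain ⟨d, d', e⟩ := HPQ (HP ht (HPxy x0 y0)) v0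
    obtain ⟨-, -, e'⟩ := HPQ (HP ht (HPxy x1 y0)) v0
    have e := congrArg (fun q : Total => q.1.2.1) e
    have e' := congrArg (fun q : Total => q.1.2.1) e'
    simp only [formula, baseMap, xHat, yHat] at e e' d d'
    have e3 : (x₁ - x₀) / den A t = (x₁ - x₀) / den A' t := by linear_combination e' - e
    have e4 := (div_eq_div_iff d d').1 e3
    exact (mul_left_cancel₀ (sub_ne_zero.2 hx1) e4).symm
  have hγδ : A 1 0 = A' 1 0 ∧ A 1 1 = A' 1 1 := by
    have := cubic_eq_zero (a := 0) (b := 0) (c := A 1 0 - A' 1 0) (d := A 1 1 - A' 1 1) (t₀ := t₀)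
      (hden.mono fun t ht => by unfold den at ht; linear_combination ht)
    exact ⟨sub_eq_zero.1 this.2.2.1, sub_eq_zero.1 this.2.2.2⟩
  have hαβ : A 0 0 = A' 0 0 ∧ A 0 1 = A' 0 1 := by
    have := cubic_eq_zero (a := 0) (b := 0) (c := A 0 0 - A' 0 0) (d := A 0 1 - A' 0 1) (t₀ := t₀)
      (by
        filter_upwards [hPt, hden] with t ht htd
        obtain ⟨d, d', e⟩ := HPQ (HP ht (HPxy x0 y0)) v0
        have e := congrArg (fun q : Total => q.1.1) e
        simp only [formula, baseMap] at e d d'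
        rw [← htd] at e
        have := (div_left_inj' d).1 e
        linear_combination this)
    exact ⟨sub_eq_zero.1 this.2.2.1, sub_eq_zero.1 this.2.2.2⟩
  have hA : A = A' := by
    ext i j
    fin_cases i <;> fin_cases j
    exacts [hαβ.1, hαβ.2, hγδ.1, hγδ.2]
  subst hA
  have hl : l = l' := by
    have := cubic_eq_zero (a := l 3 - l' 3) (b := l 2 - l' 2) (c := l 1 - l' 1) (d := l 0 - l' 0)
      (t₀ := t₀)
      (by
        filter_upwards [hPt] with t ht
        obtain ⟨d, -, e⟩ := HPQ (HP ht (HPxy x0 y0)) v0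
        have e := congrArg (fun q : Total => q.1.2.2) e
        simp only [formula, baseMap] at e d
        have := (div_left_inj' (pow_ne_zero 3 d)).1 e
        simp only [yHat] at this
        linear_combination this)
    exact fin4_ext (sub_eq_zero.1 this.2.2.2) (sub_eq_zero.1 this.2.2.1) (sub_eq_zero.1 this.2.1)
      (sub_eq_zero.1 this.1)
  subst hl
  -- Two values of u separate the multiplier, which is the slope in u, from the summand.
  have hM : ∀ b : Base, P b → multiplier A l σ b = multiplier A l σ' b ∧ f b = f' b := by
    intro b hb
    obtain ⟨d, -, e⟩ := HPQ hb v0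
    obtain ⟨-, -, e'⟩ := HPQ hb v1
    have e := congrArg (fun q : Total => q.2) e
    have e' := congrArg (fun q : Total => q.2) e'
    simp only [formula] at e e' d
    have e3 : (v₁ - v₀) * multiplier A l σ b = (v₁ - v₀) * multiplier A l σ' b := by
      linear_combination e' - e
    have e4 := mul_left_cancel₀ (sub_ne_zero.2 hv1) e3
    rw [← e4] at e
    have e5 := mul_left_cancel₀ (multiplier_ne_zero l d hσ) e
    exact ⟨e4, by linear_combination e5⟩
  refine ⟨rfl, rfl, ?_, hP.mono fun b hb => (hM b hb).2⟩
  have := (hM _ hP.self_of_nhds).1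
  rw [multiplier_eq, multiplier_eq] at this
  have h1 := mul_right_cancel₀ (Real.exp_ne_zero _) this
  have h2 := mul_right_cancel₀ (Real.exp_ne_zero _) h1
  exact mul_right_cancel₀ (pow_ne_zero 2 hp) h2

end Rigidity

end Kolmogorov

/-! ### Transfer of solutions and maps that are locally of the given form -/

namespace Kolmogorov

section Transfer

variable {A : SL2} {l : Fin 4 → ℝ} {σ : ℝ}

theorem eventually_baseMap_inv {b : Base} (hb : den A b.1 ≠ 0) {P : Base → Prop}
    (h : ∀ᶠ y in 𝓝 b, P y) : ∀ᶠ c in 𝓝 (baseMap A l b), den A⁻¹ c.1 ≠ 0 ∧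
      baseMap A l (baseMap A⁻¹ (invShift A l) c) = c ∧ P (baseMap A⁻¹ (invShift A l) c) := by
  have hb' := den_inv_ne l hb
  have hc : ContinuousAt (baseMap A⁻¹ (invShift A l)) (baseMap A l b) :=
    (contDiffAt_baseMap _ hb').continuousAt
  rw [ContinuousAt, baseMap_inv_left l hb] at hc
  filter_upwards [eventually_den_ne A⁻¹ hb', hc.eventually h] with c h1 h2
  exact ⟨h1, baseMap_inv_right l h1, h2⟩

/-- No smoothness of `u'` is assumed. Near the image point `u'` is the product of `multiplier` and
`u` composed with the smooth inverse base map, and the equation then transfers pointwise. -/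
theorem SolAt.baseMap (hσ : σ ≠ 0) {b : Base} (hb : den A b.1 ≠ 0) {u u' : Base → ℝ}
    (heq : ∀ᶠ y in 𝓝 b, u' (baseMap A l y) = multiplier A l σ y * u y) (hu : SolAt u b) :
    SolAt u' (Kolmogorov.baseMap A l b) := by
  have smooth : ∀ᶠ c in 𝓝 (Kolmogorov.baseMap A l b), ContDiffAt ℝ ∞ u' c := by
    have h1 := eventually_baseMap_inv (l := l) hb heq
    filter_upwards [h1.eventually_nhds, eventually_baseMap_inv (l := l) hb hu.smooth] with c hc hc'
    have hi : ContDiffAt ℝ ∞ (Kolmogorov.baseMap A⁻¹ (invShift A l)) c := contDiffAt_baseMap _ hc'.1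
    have hm : ContDiffAt ℝ ∞ (multiplier A l σ) (Kolmogorov.baseMap A⁻¹ (invShift A l) c) :=
      contDiffAt_multiplier l σ (den_ne_of_inv _ hc'.1)
    refine ((ContDiffAt.comp c hm hi).mul (ContDiffAt.comp c hc'.2.2 hi)).congr_of_eventuallyEq ?_
    filter_upwards [hc] with d hd
    rw [hd.2.1] at hd
    exact hd.2.2
  have near := (eventually_den_ne A hb).and
    (heq.eventually_nhds.and (hu.and hu.smooth.eventually_nhds))
  filter_upwards [eventually_baseMap_inv (l := l) hb near, smooth, smooth.eventually_nhds]
    with c hc hs hs'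
  refine ⟨hs, ?_⟩
  have h2 := (satisfiesAt_baseMap_iff A l σ hc.2.2.1 hσ hc.2.2.2.2.2 (u' := u')
    (by rw [hc.2.1]; exact hs') hc.2.2.2.1).1 hc.2.2.2.2.1.2
  rwa [hc.2.1] at h2

/-- Being a solution is preserved by the homogeneous transformations. -/
theorem solAt_baseMap_iff (hσ : σ ≠ 0) {b : Base} (hb : den A b.1 ≠ 0) {u u' : Base → ℝ}
    (heq : ∀ᶠ y in 𝓝 b, u' (baseMap A l y) = multiplier A l σ y * u y) :
    SolAt u b ↔ SolAt u' (baseMap A l b) := by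
  refine ⟨SolAt.baseMap hσ hb heq, fun h => ?_⟩
  -- The converse is the direct statement for the inverse parameters.
  have := SolAt.baseMap (l := invShift A l) (invScale_ne_zero l (A := A) hσ) (den_inv_ne l hb)
    (u := u') (u' := u) ?_ h
  · rwa [baseMap_inv_left l hb] at this
  · filter_upwards [eventually_baseMap_inv (l := l) hb heq] with c hc
    have h2 := hc.2.2
    rw [hc.2.1] at h2
    rw [h2, ← mul_assoc, mul_comm (multiplier A⁻¹ _ _ _), multiplier_inv_right l hσ hc.1, one_mul]

theorem SolAt.neg {u : Base → ℝ} {b : Base} (h : SolAt u b) : SolAt (fun y => -u y) b :=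
  (h.const_mul (-1)).congr (Filter.Eventually.of_forall fun y => neg_one_mul (u y))

theorem solAt_formula_iff (hσ : σ ≠ 0) {b : Base} (hb : den A b.1 ≠ 0) {u u' f : Base → ℝ}
    (hf : SolAt f b)
    (heq : ∀ᶠ y in 𝓝 b, u' (baseMap A l y) = multiplier A l σ y * (u y + f y)) :
    SolAt u b ↔ SolAt u' (baseMap A l b) := by
  rw [← solAt_baseMap_iff hσ hb heq]
  refine ⟨fun h => h.add hf, fun h => (h.add hf.neg).congr ?_⟩
  exact Filter.Eventually.of_forall fun y => by simp

/-- The summand of a composition of two transformations. -/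
noncomputable def compSummand (A : SL2) (l : Fin 4 → ℝ) (σ : ℝ) (f f' : Base → ℝ) (b : Base) : ℝ :=
  f b + (multiplier A l σ b)⁻¹ * f' (baseMap A l b)

/-- The summand of the inverse of a transformation. -/
noncomputable def invSummand (A : SL2) (l : Fin 4 → ℝ) (σ : ℝ) (f : Base → ℝ) (b : Base) : ℝ :=
  -(multiplier A⁻¹ (invShift A l) (invScale A l σ) b)⁻¹ * f (baseMap A⁻¹ (invShift A l) b)

theorem SolAt.compSummand (hσ : σ ≠ 0) {b : Base} (hb : den A b.1 ≠ 0) {f f' : Base → ℝ}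
    (hf : SolAt f b) (hf' : SolAt f' (Kolmogorov.baseMap A l b)) :
    SolAt (compSummand A l σ f f') b := by
  refine hf.add ((solAt_baseMap_iff hσ hb ?_).2 hf')
  filter_upwards [eventually_den_ne A hb] with y hy
  rw [← mul_assoc, mul_inv_cancel₀ (multiplier_ne_zero l hy hσ), one_mul]

theorem SolAt.invSummand (hσ : σ ≠ 0) {b : Base} (hb : den A b.1 ≠ 0) {f : Base → ℝ}
    (hf : SolAt f b) : SolAt (invSummand A l σ f) (Kolmogorov.baseMap A l b) := by
  refine SolAt.baseMap hσ hb (u := fun y => -f y) ?_ hf.neg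
  filter_upwards [eventually_den_ne A hb] with y hy
  rw [Kolmogorov.invSummand, baseMap_inv_left l hy]
  have h := multiplier_inv_left l hσ hy
  have h1 := eq_inv_of_mul_eq_one_right h
  rw [h1]
  ring

theorem formula_comp {A' : SL2} {l' : Fin 4 → ℝ} {σ' : ℝ} {f f' : Base → ℝ} (hσ : σ ≠ 0) {p : Total}
    (hp : den A p.1.1 ≠ 0) (hp' : den A' (baseMap A l p.1).1 ≠ 0) :
    formula A' l' σ' f' (formula A l σ f p) = formula (A' * A) (l + pull A l')
      (σ' * σ * Real.exp (cocycle A l l')) (compSummand A l σ f f') p := by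
  ext1
  · exact baseMap_comp _ _ _ _ hp hp'
  · simp only [formula]
    rw [← multiplier_comp _ _ _ _ _ _ hp hp', compSummand]
    have := multiplier_ne_zero l hp hσ
    field_simp
    ring

theorem formulaInv_eq (hσ : σ ≠ 0) {f : Base → ℝ} {q : Total} (hq : den A⁻¹ q.1.1 ≠ 0) :
    formulaInv A l σ f q
      = formula A⁻¹ (invShift A l) (invScale A l σ) (invSummand A l σ f) q := by
  ext1
  · rfl
  · simp only [formula, formulaInv, invSummand]
    have := multiplier_ne_zero (invShift A l) hq (invScale_ne_zero l (A := A) hσ)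
    field_simp
    ring

end Transfer

/-- Near `p`, the map `Φ` is a transformation of the form under consideration. -/
def FormAt (Φ : Total → Total) (p : Total) : Prop :=
  ∃ (A : SL2) (l : Fin 4 → ℝ) (σ : ℝ) (f : Base → ℝ),
    σ ≠ 0 ∧ den A p.1.1 ≠ 0 ∧ SolAt f p.1 ∧ Φ =ᶠ[𝓝 p] formula A l σ f

theorem formAt_iff {Φ : Total → Total} {p : Total} : FormAt Φ p ↔
    ∃ (A : SL2) (l : Fin 4 → ℝ) (σ : ℝ) (f : Base → ℝ) (Ω : Set Base),
      σ ≠ 0 ∧ IsOpen Ω ∧ IsSolutionOn f Ω ∧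
      ∀ᶠ q in 𝓝 p, q ∈ naturalDomain A Ω ∧ Φ q = formula A l σ f q := by
  constructor
  · rintro ⟨A, l, σ, f, hσ, hp, hf, h⟩
    obtain ⟨Ω, hΩ, ho, hm⟩ := eventually_nhds_iff.1 hf.eventually_nhds
    refine ⟨A, l, σ, f, Ω, hσ, ho, (isSolutionOn_iff ho).2 hΩ, ?_⟩
    filter_upwards [h, (isOpen_naturalDomain ho).mem_nhds ⟨hm, hp⟩] with q h1 h2 using ⟨h2, h1⟩
  · rintro ⟨A, l, σ, f, Ω, hσ, ho, hf, h⟩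
    exact ⟨A, l, σ, f, hσ, h.self_of_nhds.1.2,
      (isSolutionOn_iff ho).1 hf _ h.self_of_nhds.1.1, h.mono fun q hq => hq.2⟩

/-- Unlike for symmetries defined through graphs, closure under composition is a computation with
parameters here. This is why the pseudogroup property is derived after the local classification. -/
theorem FormAt.trans {Φ Ψ : Total → Total} {p : Total} (h : FormAt Φ p) (h' : FormAt Ψ (Φ p)) :
    FormAt (Ψ ∘ Φ) p := by
  obtain ⟨A, l, σ, f, hσ, hp, hf, h⟩ := h
  obtain ⟨A', l', σ', f', hσ', hp', hf', h'⟩ := h'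
  have h0 : Φ p = formula A l σ f p := h.self_of_nhds
  have hd : den A' (baseMap A l p.1).1 ≠ 0 := by rw [h0] at hp'; exact hp'
  have hf0 : SolAt f' (baseMap A l p.1) := by rw [h0] at hf'; exact hf'
  refine ⟨A' * A, l + pull A l', σ' * σ * Real.exp (cocycle A l l'), compSummand A l σ f f',
    mul_ne_zero (mul_ne_zero hσ' hσ) (Real.exp_ne_zero _), ?_, hf.compSummand hσ hp hf0, ?_⟩
  · rw [den_mul A' A l hp]; exact mul_ne_zero hd hp
  · have hc : ContinuousAt Φ p :=
      (contDiffAt_formula hp hf.self_of_nhds.1).continuousAt.congr h.symm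
    have hc' : ContinuousAt (fun q : Total => baseMap A l q.1) p :=
      ContinuousAt.comp (f := Prod.fst) (contDiffAt_baseMap l hp).continuousAt continuousAt_fst
    filter_upwards [h, hc.eventually h', continuousAt_fst.eventually (eventually_den_ne A hp),
      hc'.eventually (eventually_den_ne A' hd)] with q h1 h2 h3 h4
    rw [← formula_comp hσ h3 h4, Function.comp_apply, h2, h1]

theorem FormAt.symm {Φ : OpenPartialHomeomorph Total Total} {p : Total} (hp : p ∈ Φ.source)
    (h : FormAt Φ p) : FormAt Φ.symm (Φ p) := by
  obtain ⟨A, l, σ, f, hσ, hd, hf, h⟩ := h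
  have h0 : Φ p = formula A l σ f p := h.self_of_nhds
  refine ⟨A⁻¹, invShift A l, invScale A l σ, invSummand A l σ f, invScale_ne_zero l hσ, ?_, ?_, ?_⟩
  · rw [h0]; exact den_inv_ne l hd
  · rw [h0]; exact hf.invSummand hσ hd
  · have hc := Φ.continuousAt_symm (Φ.map_source hp)
    rw [ContinuousAt, Φ.left_inv hp] at hc
    have hd' : den A⁻¹ (Φ p).1.1 ≠ 0 := by rw [h0]; exact den_inv_ne l hd
    filter_upwards [hc.eventually h, hc.eventually (continuousAt_fst.eventually
      (eventually_den_ne A hd)), Φ.open_target.mem_nhds (Φ.map_source hp),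
      continuousAt_fst.eventually (eventually_den_ne A⁻¹ hd')] with q h1 h2 h3 h4
    rw [Φ.right_inv h3] at h1
    rw [← formulaInv_eq hσ h4]
    conv_rhs => rw [h1]
    rw [formulaInv_formula hσ h2]

theorem FormAt.congr {Φ Ψ : Total → Total} {p : Total} (h : FormAt Φ p) (hΨ : Ψ =ᶠ[𝓝 p] Φ) :
    FormAt Ψ p := by
  obtain ⟨A, l, σ, f, hσ, hp, hf, h⟩ := h
  exact ⟨A, l, σ, f, hσ, hp, hf, hΨ.trans h⟩

theorem formAt_id (p : Total) : FormAt id p :=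
  ⟨1, 0, 1, fun _ => 0, one_ne_zero, by simp [den_one], solAt_zero _,
    Filter.Eventually.of_forall fun q => by simp [formula, baseMap_one_zero, multiplier_one_zero]⟩

theorem FormAt.contDiffAt {Φ : Total → Total} {p : Total} (h : FormAt Φ p) :
    ContDiffAt ℝ ∞ Φ p := by
  obtain ⟨A, l, σ, f, hσ, hp, hf, h⟩ := h
  exact (contDiffAt_formula hp hf.self_of_nhds.1).congr_of_eventuallyEq h

theorem mem_graph_image {Φ : OpenPartialHomeomorph Total Total} {Ω Ω' : Set Base} {u u' : Base → ℝ}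
    (h : Φ '' graphOver u Ω = graphOver u' Ω') :
    (∀ b ∈ Ω, (Φ (b, u b)).1 ∈ Ω' ∧ u' (Φ (b, u b)).1 = (Φ (b, u b)).2) ∧
      ∀ b' ∈ Ω', ∃ b ∈ Ω, (Φ (b, u b)).1 = b' := by
  constructor
  · intro b hb
    have : Φ (b, u b) ∈ graphOver u' Ω' := h ▸ ⟨_, ⟨b, hb, rfl⟩, rfl⟩
    obtain ⟨c, hc, e⟩ := this
    rw [← e]
    exact ⟨hc, rfl⟩
  · intro b' hb'
    have : (b', u' b') ∈ Φ '' graphOver u Ω := h ▸ ⟨b', hb', rfl⟩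
    obtain ⟨_, ⟨b, hb, rfl⟩, e⟩ := this
    exact ⟨b, hb, by rw [e]⟩

/-- Local homeomorphisms which are locally of the form under consideration are symmetries. -/
theorem isPointSymmetry_of_formAt {Φ : OpenPartialHomeomorph Total Total}
    (h : ∀ p ∈ Φ.source, FormAt Φ p) : IsPointSymmetry Φ := by
  refine ⟨fun p hp => (h p hp).contDiffAt.contDiffWithinAt, fun q hq => ?_, ?_⟩
  · have := (h _ (Φ.map_target hq)).symm (Φ.map_target hq)
    rw [Φ.right_inv hq] at this
    exact this.contDiffAt.contDiffWithinAt
  · intro Ω Ω' u u' hΩ hΩ' hu hu' hs him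
    obtain ⟨m1, m2⟩ := mem_graph_image him
    have key : ∀ b ∈ Ω, SolAt u b ↔ SolAt u' (Φ (b, u b)).1 := by
      intro b hb
      have hbs : (b, u b) ∈ Φ.source := hs ⟨b, hb, rfl⟩
      obtain ⟨A, l, σ, f, hσ, hp, hf, hΦ⟩ := h _ hbs
      rw [hΦ.self_of_nhds]
      refine solAt_formula_iff hσ hp hf ?_
      have hc : ContinuousAt (fun y => (y, u y)) b :=
        continuousAt_id.prodMk (hu.contDiffAt (hΩ.mem_nhds hb)).continuousAt
      filter_upwards [hc.eventually hΦ, hΩ.mem_nhds hb] with y h1 h2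
      have := (m1 y h2).2
      rw [h1] at this
      exact this
    rw [isSolutionOn_iff hΩ, isSolutionOn_iff hΩ']
    constructor
    · intro hsol b' hb'
      obtain ⟨b, hb, rfl⟩ := m2 b' hb'
      exact (key b hb).1 (hsol b hb)
    · intro hsol b hb
      exact (key b hb).2 (hsol _ (m1 b hb).1)

theorem HasForm.formAt {A : SL2} {l : Fin 4 → ℝ} {σ : ℝ} {f : Base → ℝ} {Ω : Set Base}
    {Φ : OpenPartialHomeomorph Total Total} (hσ : σ ≠ 0) (hΩ : IsOpen Ω) (hf : IsSolutionOn f Ω)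
    (h : HasForm A l σ f Ω Φ) : ∀ p ∈ Φ.source, FormAt Φ p := by
  intro p hp
  have hp' := h.1 ▸ hp
  exact ⟨A, l, σ, f, hσ, hp'.2, (isSolutionOn_iff hΩ).1 hf _ hp'.1,
    h.2.eventuallyEq_of_mem (Φ.open_source.mem_nhds hp)⟩

/-- The composition of a point symmetry with a homogeneous transformation. -/
theorem IsPointSymmetry.trans_homogeneous {Φ Θ : OpenPartialHomeomorph Total Total}
    (hΦ : IsPointSymmetry Φ) {A : SL2} {l : Fin 4 → ℝ} {σ : ℝ} (hσ : σ ≠ 0)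
    (hΘ : HasForm A l σ 0 Set.univ Θ) : IsPointSymmetry (Φ.trans Θ) := by
  have hsol0 : IsSolutionOn 0 Set.univ := (isSolutionOn_iff isOpen_univ).2 fun b _ => solAt_zero b
  have hΘs := isPointSymmetry_of_formAt (hΘ.formAt hσ isOpen_univ hsol0)
  refine ⟨?_, ?_, ?_⟩
  · refine hΘs.1.comp (hΦ.1.mono fun p hp => ?_) fun p hp => ?_
    · rw [Φ.trans_source] at hp; exact hp.1
    · rw [Φ.trans_source] at hp; exact hp.2
  · refine hΦ.2.1.comp (hΘs.2.1.mono fun p hp => ?_) fun p hp => ?_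
    · rw [Φ.trans_target] at hp; exact hp.1
    · rw [Φ.trans_target] at hp; exact hp.2
  · intro Ω Ω' u u' hΩ hΩ' hu hu' hs him
    obtain ⟨m1, m2⟩ := mem_graph_image him
    have hs' : ∀ b ∈ Ω, (b, u b) ∈ Φ.source ∧ den A (Φ (b, u b)).1.1 ≠ 0 ∧
        Θ (Φ (b, u b)) = formula A l σ 0 (Φ (b, u b)) := by
      intro b hb
      have h1 : (b, u b) ∈ (Φ.trans Θ).source := hs ⟨b, hb, rfl⟩
      rw [Φ.trans_source] at h1
      exact ⟨h1.1, (hΘ.1 ▸ h1.2 : Φ (b, u b) ∈ naturalDomain A Set.univ).2, hΘ.2 h1.2⟩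
    have hval : ∀ b ∈ Ω, baseMap A l (Φ (b, u b)).1 ∈ Ω' ∧ u' (baseMap A l (Φ (b, u b)).1)
        = multiplier A l σ (Φ (b, u b)).1 * (Φ (b, u b)).2 := by
      intro b hb
      have h1 := m1 b hb
      rw [show (Φ.trans Θ) (b, u b) = Θ (Φ (b, u b)) from rfl, (hs' b hb).2.2] at h1
      simpa [formula] using h1
    -- For two general symmetries the intermediate image of a graph need not be a graph. Here the
    -- second map sends vertical fibres to vertical fibres, so the intermediate set is the graph of
    -- `v` over `Ω₁`.
    set Ω₁ : Set Base := {c | den A c.1 ≠ 0 ∧ baseMap A l c ∈ Ω'} with hΩ₁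
    set v : Base → ℝ := fun c => (multiplier A l σ c)⁻¹ * u' (baseMap A l c) with hv
    have ho : IsOpen Ω₁ := isOpen_preimage_baseMap hΩ'
    have hvs : ContDiffOn ℝ ∞ v Ω₁ := fun c hc => ContDiffAt.contDiffWithinAt
      (((contDiffAt_multiplier l σ hc.1).inv (multiplier_ne_zero l hc.1 hσ)).mul
      (ContDiffAt.comp c (hu'.contDiffAt (hΩ'.mem_nhds hc.2)) (contDiffAt_baseMap l hc.1)))
    have hg : ∀ b ∈ Ω, Φ (b, u b) = ((Φ (b, u b)).1, v (Φ (b, u b)).1) := by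
      intro b hb
      ext1
      · rfl
      · simp only [hv]
        rw [(hval b hb).2, ← mul_assoc,
          inv_mul_cancel₀ (multiplier_ne_zero l (hs' b hb).2.1 hσ), one_mul]
    have him' : Φ '' graphOver u Ω = graphOver v Ω₁ := by
      apply Set.Subset.antisymm
      · rintro _ ⟨_, ⟨b, hb, rfl⟩, rfl⟩
        exact ⟨_, ⟨(hs' b hb).2.1, (hval b hb).1⟩, (hg b hb).symm⟩
      · rintro _ ⟨c, hc, rfl⟩
        obtain ⟨b, hb, e⟩ := m2 _ hc.2
        rw [show (Φ.trans Θ) (b, u b) = Θ (Φ (b, u b)) from rfl, (hs' b hb).2.2] at e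
        have h2 : (Φ (b, u b)).1 = c := by
          rw [← baseMap_inv_left l (hs' b hb).2.1, ← baseMap_inv_left l hc.1]
          exact congrArg _ e
        exact ⟨_, ⟨b, hb, rfl⟩, by rw [hg b hb, h2]⟩
    rw [hΦ.2.2 Ω Ω₁ u v hΩ ho hu hvs (fun q hq => by
      obtain ⟨b, hb, rfl⟩ := hq; exact (hs' b hb).1) him', isSolutionOn_iff ho,
      isSolutionOn_iff hΩ']
    have key : ∀ c ∈ Ω₁, SolAt v c ↔ SolAt u' (baseMap A l c) := fun c hc => by
      refine solAt_baseMap_iff hσ hc.1 ?_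
      filter_upwards [eventually_den_ne A hc.1] with y hy
      rw [hv, ← mul_assoc, mul_inv_cancel₀ (multiplier_ne_zero l hy hσ), one_mul]
    constructor
    · intro h b' hb'
      obtain ⟨b, hb, e⟩ := m2 b' hb'
      rw [show (Φ.trans Θ) (b, u b) = Θ (Φ (b, u b)) from rfl, (hs' b hb).2.2] at e
      have e' : baseMap A l (Φ (b, u b)).1 = b' := e
      have hc : (Φ (b, u b)).1 ∈ Ω₁ := ⟨(hs' b hb).2.1, (hval b hb).1⟩
      rw [← e']
      exact (key _ hc).1 (h _ hc)
    · intro h c hc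
      exact (key c hc).2 (h _ hc.2)

end Kolmogorov

/-! ### Images of solutions with transversal graphs -/

namespace Kolmogorov

section GraphDerivative

variable {F : Type*} [NormedAddCommGroup F] [NormedSpace ℝ F]

theorem hasFDerivAt_graph {G : Total → F} {u : Base → ℝ} {b : Base} (hu : DifferentiableAt ℝ u b)
    (hG : DifferentiableAt ℝ G (b, u b)) :
    HasFDerivAt (fun y => G (y, u y))
      ((fderiv ℝ G (b, u b)).comp ((ContinuousLinearMap.id ℝ Base).prod (fderiv ℝ u b))) b :=
  HasFDerivAt.comp (f := fun y => (y, u y)) b hG.hasFDerivAt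
    ((hasFDerivAt_id b).prodMk hu.hasFDerivAt)

/-- The derivative along a graph depends on the 1-jet alone. This carries transversality and first
derivatives from a solution to its perturbation. -/
theorem fderiv_graph_congr {G : Total → F} {u v : Base → ℝ} {b : Base}
    (hu : DifferentiableAt ℝ u b) (hv : DifferentiableAt ℝ v b)
    (hG : DifferentiableAt ℝ G (b, u b)) (h0 : v b = u b) (h1 : fderiv ℝ v b = fderiv ℝ u b) :
    fderiv ℝ (fun y => G (y, v y)) b = fderiv ℝ (fun y => G (y, u y)) b := by
  rw [(hasFDerivAt_graph hu hG).fderiv, (hasFDerivAt_graph hv (by rwa [h0])).fderiv, h0, h1]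

end GraphDerivative

variable {Φ : OpenPartialHomeomorph Total Total}

theorem IsPointSymmetry.contDiffAt (hΦ : IsPointSymmetry Φ) {p : Total} (hp : p ∈ Φ.source) :
    ContDiffAt ℝ ∞ Φ p := hΦ.1.contDiffAt (Φ.open_source.mem_nhds hp)

theorem IsPointSymmetry.symm (hΦ : IsPointSymmetry Φ) : IsPointSymmetry Φ.symm := by
  refine ⟨hΦ.2.1, hΦ.1, fun Ω Ω' u u' hΩ hΩ' hu hu' hs him => ?_⟩
  refine (hΦ.2.2 Ω' Ω u' u hΩ' hΩ hu' hu ?_ ?_).symm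
  · rw [← him]
    rintro _ ⟨q, hq, rfl⟩
    exact Φ.map_target (hs hq)
  · rw [← him, ← Set.image_comp]
    refine (Set.image_congr fun q hq => ?_).trans (Set.image_id _)
    exact Φ.right_inv (hs hq)

theorem IsPointSymmetry.fderiv_symm_comp (hΦ : IsPointSymmetry Φ) {p : Total} (hp : p ∈ Φ.source) :
    (fderiv ℝ Φ.symm (Φ p)).comp (fderiv ℝ Φ p) = ContinuousLinearMap.id ℝ Total := by
  have h1 := ((hΦ.symm.contDiffAt (Φ.map_source hp)).differentiableAt (by simp)).hasFDerivAt.comp p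
    ((hΦ.contDiffAt hp).differentiableAt (by simp)).hasFDerivAt
  have h2 : (Φ.symm ∘ Φ) =ᶠ[𝓝 p] id := by
    filter_upwards [Φ.open_source.mem_nhds hp] with q hq using Φ.left_inv hq
  exact (h1.congr_of_eventuallyEq h2.symm).unique (hasFDerivAt_id p)

theorem IsPointSymmetry.fderiv_bijective (hΦ : IsPointSymmetry Φ) {p : Total}
    (hp : p ∈ Φ.source) : Function.Bijective (fderiv ℝ Φ p) := by
  have h1 := hΦ.fderiv_symm_comp hp
  have h2 := hΦ.symm.fderiv_symm_comp (Φ.map_source hp)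
  rw [Φ.symm_symm] at h2
  change (fderiv ℝ Φ (Φ.symm (Φ p))).comp (fderiv ℝ Φ.symm (Φ p)) = _ at h2
  rw [Φ.left_inv hp] at h2
  exact ⟨Function.LeftInverse.injective fun v => DFunLike.congr_fun h1 v,
    Function.RightInverse.surjective fun v => DFunLike.congr_fun h2 v⟩

/-- A point symmetry maps a solution to a solution wherever its graph is transversal. -/
theorem IsPointSymmetry.push (hΦ : IsPointSymmetry Φ) {b : Base} {u : Base → ℝ}
    (hs : (b, u b) ∈ Φ.source) (hu : SolAt u b)
    (hinj : Function.Injective (fderiv ℝ (fun y => (Φ (y, u y)).1) b)) :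
    ∃ u' : Base → ℝ, SolAt u' (Φ (b, u b)).1 ∧
      (∀ᶠ y in 𝓝 b, u' (Φ (y, u y)).1 = (Φ (y, u y)).2) ∧
      (∀ᶠ c in 𝓝 (Φ (b, u b)).1, u (Φ.symm (c, u' c)).1 = (Φ.symm (c, u' c)).2) ∧
      Function.Injective (fderiv ℝ (fun c => (Φ.symm (c, u' c)).1) (Φ (b, u b)).1) := by
  set S : Base → Base := fun y => (Φ (y, u y)).1 with hS
  have hgc : ContinuousAt (fun y => (y, u y)) b :=
    continuousAt_id.prodMk hu.self_of_nhds.1.continuousAt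
  have hsrc : ∀ᶠ y in 𝓝 b, (y, u y) ∈ Φ.source := hgc.eventually (Φ.open_source.mem_nhds hs)
  have hSs : ∀ᶠ y in 𝓝 b, ContDiffAt ℝ ∞ S y := by
    filter_upwards [hsrc, hu.smooth] with y h1 h2
    exact (ContDiffAt.comp (f := fun y => (y, u y)) y (hΦ.contDiffAt h1)
      (contDiffAt_id.prodMk h2)).fst
  -- An injective endomorphism of a finite-dimensional space is invertible, so the inverse function
  -- theorem applies to the projected graph `S`. The image is then the graph of the u component
  -- composed with the local inverse of `S`.
  let L : Base ≃L[ℝ] Base :=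
    (LinearEquiv.ofInjectiveEndo (fderiv ℝ S b : Base →ₗ[ℝ] Base) hinj).toContinuousLinearEquiv
  have hL : (L : Base →L[ℝ] Base) = fderiv ℝ S b := by ext <;> rfl
  have hSb := hSs.self_of_nhds
  have hSL : HasFDerivAt S (L : Base →L[ℝ] Base) b := by
    rw [hL]; exact (hSb.differentiableAt (by simp)).hasFDerivAt
  let e := hSb.toOpenPartialHomeomorph S hSL (by simp)
  have he : ∀ y, e y = S y := fun y => rfl
  have hbe : b ∈ e.source := hSb.mem_toOpenPartialHomeomorph_source hSL (by simp)
  -- Invertibility at `b` alone would give smoothness of the inverse at one point only. Invertible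
  -- maps form an open set, so it persists on a neighbourhood and `u'` is smooth on an open set, as
  -- the definition of a symmetry requires.
  have hinv : ∀ᶠ y in 𝓝 b, fderiv ℝ S y ∈
      Set.range ((↑) : (Base ≃L[ℝ] Base) → Base →L[ℝ] Base) := by
    have hc : ContinuousAt (fderiv ℝ S) b :=
      (hSb.fderiv_right (m := ∞) (by simp)).continuousAt
    have := ContinuousLinearEquiv.nhds L
    rw [hL] at this
    exact hc.eventually this
  obtain ⟨Ω, hΩ, ho, hbΩ⟩ := eventually_nhds_iff.1
    ((hsrc.and (hu.and (hSs.and hinv))).and (e.open_source.mem_nhds hbe))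
  set Ω' : Set Base := e '' Ω with hΩ'
  have ho' : IsOpen Ω' := e.isOpen_image_of_subset_source ho fun y hy => (hΩ y hy).2
  set u' : Base → ℝ := fun c => (Φ (e.symm c, u (e.symm c))).2 with hu'
  have hleft : ∀ y ∈ Ω, e.symm (S y) = y := fun y hy => e.left_inv (hΩ y hy).2
  have hval : ∀ y ∈ Ω, u' (S y) = (Φ (y, u y)).2 := fun y hy => by
    rw [hu']; simp only; rw [hleft y hy]
  have hesm : ∀ y ∈ Ω, ContDiffAt ℝ ∞ e.symm (S y) := fun y hy => by
    obtain ⟨M, hM⟩ := (hΩ y hy).1.2.2.2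
    have hy' : e.symm (S y) = y := hleft y hy
    refine e.contDiffAt_symm (f₀' := M) (e.map_source (hΩ y hy).2) ?_ ?_
    · rw [hy', hM]; exact ((hΩ y hy).1.2.2.1.differentiableAt (by simp)).hasFDerivAt
    · rw [hy']; exact (hΩ y hy).1.2.2.1
  have hsm : ContDiffOn ℝ ∞ u' Ω' := by
    rintro _ ⟨y, hy, rfl⟩
    have h1 := hesm y hy
    have h2 : ContDiffAt ℝ ∞ u (e.symm (S y)) := by rw [hleft y hy]; exact (hΩ y hy).1.2.1.1
    have h3 : ContDiffAt ℝ ∞ Φ (e.symm (S y), u (e.symm (S y))) := by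
      rw [hleft y hy]; exact hΦ.contDiffAt (hΩ y hy).1.1
    exact (ContDiffAt.comp (f := fun c => (e.symm c, u (e.symm c))) (S y) h3
      (h1.prodMk (ContDiffAt.comp (S y) h2 h1))).snd.contDiffWithinAt
  have him : Φ '' graphOver u Ω = graphOver u' Ω' := by
    apply Set.Subset.antisymm
    · rintro _ ⟨_, ⟨y, hy, rfl⟩, rfl⟩
      exact ⟨S y, ⟨y, hy, rfl⟩, by ext1; exacts [rfl, hval y hy]⟩
    · rintro _ ⟨_, ⟨y, hy, rfl⟩, rfl⟩
      refine ⟨_, ⟨y, hy, rfl⟩, ?_⟩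
      ext1
      exacts [rfl, (hval y hy).symm]
  have hsol : IsSolutionOn u Ω := (isSolutionOn_iff ho).2 fun y hy => by
    filter_upwards [ho.mem_nhds hy] with z hz using (hΩ z hz).1.2.1
  have hsol' := (hΦ.2.2 Ω Ω' u u' ho ho' hsol.1 hsm (by
    rintro _ ⟨y, hy, rfl⟩; exact (hΩ y hy).1.1) him).1 hsol
  have hback : ∀ y ∈ Ω, Φ.symm (S y, u' (S y)) = (y, u y) := fun y hy => by
    rw [hval y hy]
    exact Φ.left_inv (hΩ y hy).1.1
  have hSb' : S b ∈ Ω' := ⟨b, hbΩ, rfl⟩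
  refine ⟨u', (isSolutionOn_iff ho').1 hsol' _ hSb', ?_, ?_, ?_⟩
  · filter_upwards [ho.mem_nhds hbΩ] with y hy using hval y hy
  · filter_upwards [ho'.mem_nhds hSb'] with c hc
    obtain ⟨y, hy, rfl⟩ := hc
    rw [he, hback y hy]
  · have h1 : (fun c => (Φ.symm (c, u' c)).1) =ᶠ[𝓝 (S b)] e.symm := by
      filter_upwards [ho'.mem_nhds hSb'] with c hc
      obtain ⟨y, hy, rfl⟩ := hc
      rw [he, hback y hy, hleft y hy]
    change Function.Injective (fderiv ℝ (fun c => (Φ.symm (c, u' c)).1) (S b))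
    rw [h1.fderiv_eq]
    have h2 : HasFDerivAt e.symm (L.symm : Base →L[ℝ] Base) (S b) :=
      e.hasFDerivAt_symm (e.map_source hbe) (by rw [hleft b hbΩ]; exact hSL)
    rw [h2.fderiv]
    exact L.symm.injective

/-! ### Polynomial solutions with prescribed jets -/

/-- Polynomial solutions, in coordinates centred at `b₀`. -/
noncomputable def polySol (b₀ : Base) (u₀ p r c k₁ k₂ : ℝ) (b : Base) : ℝ :=
  u₀ + p * (b.2.1 - b₀.2.1) + r * ((b.1 - b₀.1) + (b.2.1 - b₀.2.1) ^ 2 / 2)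
    + c * ((b.2.2 - b₀.2.2 - b₀.2.1 * (b.1 - b₀.1)) + (b.2.1 - b₀.2.1) ^ 3 / 6)
    + k₁ * ((b.1 - b₀.1) ^ 2 + (b.1 - b₀.1) * (b.2.1 - b₀.2.1) ^ 2 + (b.2.1 - b₀.2.1) ^ 4 / 12)
    + k₂ * ((b.2.2 - b₀.2.2 - b₀.2.1 * (b.1 - b₀.1)) ^ 2
      + (b.2.1 - b₀.2.1) ^ 3 * (b.2.2 - b₀.2.2 - b₀.2.1 * (b.1 - b₀.1)) / 3
      + (b.2.1 - b₀.2.1) ^ 6 / 90)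

section PolySol

variable (b₀ : Base) (u₀ p r c k₁ k₂ : ℝ) (b : Base)

theorem contDiff_polySol : ContDiff ℝ ∞ (polySol b₀ u₀ p r c k₁ k₂) := by
  unfold polySol; fun_prop

theorem pd_polySol (v : Base) : pd v (polySol b₀ u₀ p r c k₁ k₂) b =
    p * v.2.1 + r * (v.1 + (b.2.1 - b₀.2.1) * v.2.1)
    + c * (v.2.2 - b₀.2.1 * v.1 + (b.2.1 - b₀.2.1) ^ 2 / 2 * v.2.1)
    + k₁ * (2 * (b.1 - b₀.1) * v.1 + v.1 * (b.2.1 - b₀.2.1) ^ 2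
      + (b.1 - b₀.1) * (2 * (b.2.1 - b₀.2.1) * v.2.1) + (b.2.1 - b₀.2.1) ^ 3 / 3 * v.2.1)
    + k₂ * (2 * (b.2.2 - b₀.2.2 - b₀.2.1 * (b.1 - b₀.1)) * (v.2.2 - b₀.2.1 * v.1)
      + (b.2.1 - b₀.2.1) ^ 2 * v.2.1 * (b.2.2 - b₀.2.2 - b₀.2.1 * (b.1 - b₀.1))
      + (b.2.1 - b₀.2.1) ^ 3 * (v.2.2 - b₀.2.1 * v.1) / 3
      + (b.2.1 - b₀.2.1) ^ 5 / 15 * v.2.1) := by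
  have h1 := (hasDerivAt_t_line b v).sub_const b₀.1
  have h2 := (hasDerivAt_x_line b v).sub_const b₀.2.1
  have h3 := ((hasDerivAt_y_line b v).sub_const b₀.2.2).sub (h1.const_mul b₀.2.1)
  have := (((((h2.const_mul p).const_add u₀).add ((h1.add ((h2.pow 2).div_const 2)).const_mul r)).add
    ((h3.add ((h2.pow 3).div_const 6)).const_mul c)).add
    ((((h1.pow 2).add (h1.mul (h2.pow 2))).add ((h2.pow 4).div_const 12)).const_mul k₁)).add
    ((((h3.pow 2).add (((h2.pow 3).mul h3).div_const 3)).add ((h2.pow 6).div_const 90)).const_mul k₂)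
  have e : b + (0 : ℝ) • v = b := by simp
  refine pd_of_hasDerivAt (contDiff_polySol b₀ u₀ p r c k₁ k₂).contDiffAt.diff
    (this.congr_deriv ?_)
  simp only [Pi.pow_apply, Pi.sub_apply, e, Nat.cast_ofNat]
  ring

/-- Put s = t − t₀, ξ = x − x₀, η = y − y₀ − x₀s. The equation becomes ∂_s + ξ∂_η = ∂_ξ², and each
summand solves it. The parameters `p`, `r`, `c` realise every first-order jet at the centre, with
second x-derivative `r`. The terms with `k₁` and `k₂` have zero 1-jet there and quadratic parts s²
and η². -/
theorem solAt_polySol : SolAt (polySol b₀ u₀ p r c k₁ k₂) b := by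
  refine solAt_iff.2 (Filter.Eventually.of_forall fun y =>
    ⟨(contDiff_polySol ..).contDiffAt, ?_⟩)
  have h : pd ex (polySol b₀ u₀ p r c k₁ k₂) = fun b => p + r * (b.2.1 - b₀.2.1)
      + c * ((b.2.1 - b₀.2.1) ^ 2 / 2)
      + k₁ * ((b.1 - b₀.1) * (2 * (b.2.1 - b₀.2.1)) + (b.2.1 - b₀.2.1) ^ 3 / 3)
      + k₂ * ((b.2.1 - b₀.2.1) ^ 2 * (b.2.2 - b₀.2.2 - b₀.2.1 * (b.1 - b₀.1))
      + (b.2.1 - b₀.2.1) ^ 5 / 15) := by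
    funext b
    rw [pd_polySol]; ring
  have h1 := (hasDerivAt_t_line y ex).sub_const b₀.1
  have h2 := (hasDerivAt_x_line y ex).sub_const b₀.2.1
  have h3 := ((hasDerivAt_y_line y ex).sub_const b₀.2.2).sub (h1.const_mul b₀.2.1)
  have := ((((h2.const_mul r).const_add p).add (((h2.pow 2).div_const 2).const_mul c)).add
    (((h1.mul (h2.const_mul 2)).add ((h2.pow 3).div_const 3)).const_mul k₁)).add
    ((((h2.pow 2).mul h3).add ((h2.pow 5).div_const 15)).const_mul k₂)
  have e : y + (0 : ℝ) • ex = y := by simp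
  have hd : DifferentiableAt ℝ (pd ex (polySol b₀ u₀ p r c k₁ k₂)) y :=
    ((contDiff_polySol b₀ u₀ p r c k₁ k₂).contDiffAt.pd ex).diff
  rw [pd_polySol, pd_polySol]
  rw [h] at hd ⊢
  rw [pd_of_hasDerivAt hd this]
  simp only [Pi.pow_apply, Pi.sub_apply, e, Nat.cast_ofNat]
  ring

end PolySol

end Kolmogorov

/-! ### The perturbation argument -/

namespace Kolmogorov

section Product

variable {E : Type*} [NormedAddCommGroup E] [NormedSpace ℝ E] {v : E} {f g : E → ℝ} {x : E}

theorem pd_pd_mul_of_zero (hf : ∀ᶠ y in 𝓝 x, ContDiffAt ℝ ∞ f y)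
    (hg : ∀ᶠ y in 𝓝 x, ContDiffAt ℝ ∞ g y) (f0 : f x = 0) (g0 : g x = 0) :
    pd v (pd v (fun y => f y * g y)) x = 2 * (pd v f x * pd v g x) := by
  rw [pd_pd_mul hf hg, f0, g0]; ring

theorem pd_mul_of_zero (hf : DifferentiableAt ℝ f x) (hg : DifferentiableAt ℝ g x) (f0 : f x = 0)
    (g0 : g x = 0) : pd v (fun y => f y * g y) x = 0 := by
  rw [pd_mul hf hg, f0, g0]; ring

end Product

variable {Φ : OpenPartialHomeomorph Total Total}

/-- Adding to the image of a solution a solution with vanishing first derivatives does not affect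
the second derivative along `∂_x` of its composition with the transformed solution. -/
theorem IsPointSymmetry.perturb (hΦ : IsPointSymmetry Φ) {b : Base} {u : Base → ℝ}
    (hs : (b, u b) ∈ Φ.source) (hu : SolAt u b)
    (hinj : Function.Injective (fderiv ℝ (fun y => (Φ (y, u y)).1) b)) {w : Base → ℝ}
    (hw : SolAt w (Φ (b, u b)).1) (hw0 : w (Φ (b, u b)).1 = 0)
    (hw1 : fderiv ℝ w (Φ (b, u b)).1 = 0) :
    ∃ v : Base → ℝ, SolAt v b ∧ v b = u b ∧ fderiv ℝ v b = fderiv ℝ u b ∧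
      pd ex (pd ex (fun y => w (Φ (y, v y)).1)) b = 0 := by
  obtain ⟨u', hu', hpush, hpull, hinj'⟩ := hΦ.push hs hu hinj
  set p : Total := (b, u b) with hp
  have hval : u' (Φ p).1 = (Φ p).2 := hpush.self_of_nhds
  set u₂' : Base → ℝ := fun y => u' y + w y with hu₂'
  have hsol₂ : SolAt u₂' (Φ p).1 := hu'.add hw
  have d' := hu'.self_of_nhds.1.diff
  have dw := hw.self_of_nhds.1.diff
  have h0 : u₂' (Φ p).1 = u' (Φ p).1 := by simp [hu₂', hw0]
  have h1 : fderiv ℝ u₂' (Φ p).1 = fderiv ℝ u' (Φ p).1 := by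
    rw [hu₂', fderiv_fun_add d' dw, hw1, add_zero]
  have hpt : ((Φ p).1, u' (Φ p).1) = Φ p := by rw [hval]
  have htgt : ((Φ p).1, u' (Φ p).1) ∈ Φ.target := by rw [hpt]; exact Φ.map_source hs
  have hsymd : DifferentiableAt ℝ Φ.symm ((Φ p).1, u' (Φ p).1) :=
    (hΦ.symm.contDiffAt htgt).differentiableAt (by simp)
  have hinj₂ : Function.Injective (fderiv ℝ (fun y => (Φ.symm (y, u₂' y)).1) (Φ p).1) := by
    rw [fderiv_graph_congr (G := fun q => (Φ.symm q).1) d' hsol₂.self_of_nhds.1.diff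
      hsymd.fst h0 h1]
    exact hinj'
  have hpt₂ : ((Φ p).1, u₂' (Φ p).1) = Φ p := by rw [h0, hpt]
  obtain ⟨v, hv, hpush₂, hpull₂, -⟩ := hΦ.symm.push (b := (Φ p).1) (u := u₂')
    (by rw [hpt₂]; exact Φ.map_source hs) hsol₂ hinj₂
  rw [hpt₂, Φ.left_inv hs] at hv hpull₂
  rw [Φ.symm_symm] at hpull₂
  have hv0 : v b = u b := by
    have := hpush₂.self_of_nhds
    rw [hpt₂, Φ.left_inv hs] at this
    exact this
  have du := hu.self_of_nhds.1.diff
  have dv := hv.self_of_nhds.1.diff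
  -- The pulled-back graphs are parametrised by `R` and `R₂`, which have the same derivative at the
  -- image point, as do their u components. Since that derivative is surjective, the differentials
  -- of `u` and `v` at `b` coincide.
  have hv1 : fderiv ℝ v b = fderiv ℝ u b := by
    set R : Base → Base := fun c => (Φ.symm (c, u' c)).1 with hR
    set R₂ : Base → Base := fun c => (Φ.symm (c, u₂' c)).1 with hR₂
    have hRb : R (Φ p).1 = b := by rw [hR]; simp only; rw [hpt, Φ.left_inv hs]
    have hR₂b : R₂ (Φ p).1 = b := by rw [hR₂]; simp only; rw [hpt₂, Φ.left_inv hs]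
    have hRd : DifferentiableAt ℝ R (Φ p).1 :=
      (hasFDerivAt_graph (G := fun q => (Φ.symm q).1) d' hsymd.fst).differentiableAt
    have hR₂d : DifferentiableAt ℝ R₂ (Φ p).1 :=
      (hasFDerivAt_graph (G := fun q => (Φ.symm q).1) hsol₂.self_of_nhds.1.diff
        (by rw [h0]; exact hsymd.fst)).differentiableAt
    have hRR : fderiv ℝ R₂ (Φ p).1 = fderiv ℝ R (Φ p).1 :=
      fderiv_graph_congr (G := fun q => (Φ.symm q).1) d' hsol₂.self_of_nhds.1.diff hsymd.fst h0 h1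
    have e1 : (fderiv ℝ u b).comp (fderiv ℝ R (Φ p).1)
        = fderiv ℝ (fun c => (Φ.symm (c, u' c)).2) (Φ p).1 := by
      have hc := HasFDerivAt.comp (f := R) (Φ p).1 (g := u) (g' := fderiv ℝ u b)
        (by rw [hRb]; exact du.hasFDerivAt) hRd.hasFDerivAt
      rw [← hc.fderiv]
      exact Filter.EventuallyEq.fderiv_eq hpull
    have e2 : (fderiv ℝ v b).comp (fderiv ℝ R₂ (Φ p).1)
        = fderiv ℝ (fun c => (Φ.symm (c, u₂' c)).2) (Φ p).1 := by
      have hc := HasFDerivAt.comp (f := R₂) (Φ p).1 (g := v) (g' := fderiv ℝ v b)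
        (by rw [hR₂b]; exact dv.hasFDerivAt) hR₂d.hasFDerivAt
      rw [← hc.fderiv]
      exact Filter.EventuallyEq.fderiv_eq hpush₂
    rw [hRR, fderiv_graph_congr (G := fun q => (Φ.symm q).2) d' hsol₂.self_of_nhds.1.diff
      hsymd.snd h0 h1, ← e1] at e2
    have hsurj : Function.Surjective (fderiv ℝ R (Φ p).1) :=
      LinearMap.surjective_of_injective (f := (fderiv ℝ R (Φ p).1 : Base →ₗ[ℝ] Base)) hinj'
    refine ContinuousLinearMap.ext fun z => ?_
    obtain ⟨y, rfl⟩ := hsurj z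
    exact DFunLike.congr_fun e2 y
  refine ⟨v, hv, hv0, hv1, ?_⟩
  have hpd : ∀ z, pd z v b = pd z u b := fun z => by rw [pd, pd, hv1]
  -- The equation enters here: it expresses the second x-derivative by the 1-jet, which `u` and `v`
  -- share.
  have hxx : pd ex (pd ex v) b = pd ex (pd ex u) b := by
    rw [← hv.eq, ← hu.eq, hpd, hpd]
  -- `H` measures the deviation from the image graph: it vanishes on the graph of `u` and equals `w`
  -- of the projected image on the graph of `v`. Its second x-derivatives along the two graphs agree
  -- because they see only the 1-jet and u_xx.
  set H : Total → ℝ := fun q => (Φ q).2 - u' (Φ q).1 with hH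
  have hHs : ∀ᶠ q in 𝓝 p, ContDiffAt ℝ ∞ H q := by
    have hc : ContinuousAt (fun q => (Φ q).1) p := (hΦ.contDiffAt hs).continuousAt.fst
    filter_upwards [Φ.open_source.mem_nhds hs, hc.eventually hu'.smooth] with q h2 h3
    exact (hΦ.contDiffAt h2).snd.sub (ContDiffAt.comp q h3 (hΦ.contDiffAt h2).fst)
  have k1 := pd_pd_comp_graph (v := ex) hu.smooth hHs
  have k2 := pd_pd_comp_graph (v := ex) (F := H) hv.smooth (by rw [hv0]; exact hHs)
  have z1 : (fun y => H (y, u y)) =ᶠ[𝓝 b] fun _ => 0 := by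
    filter_upwards [hpush] with y hy
    rw [hH]; simp only; rw [hy, sub_self]
  have z2 : (fun y => H (y, v y)) =ᶠ[𝓝 b] fun y => w (Φ (y, v y)).1 := by
    filter_upwards [hpull₂] with y hy
    have hy' : u' (Φ (y, v y)).1 + w (Φ (y, v y)).1 = (Φ (y, v y)).2 := hy
    rw [hH]; simp only; rw [← hy']; ring
  rw [← pd_congr (pd_eventuallyEq z2), k2, hxx, hpd, hv0, ← k1, pd_congr (pd_eventuallyEq z1)]
  have : pd ex (fun _ : Base => (0 : ℝ)) = fun _ => 0 := funext fun x => pd_const _ _ _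
  rw [this, pd_const]

/-- The contact condition satisfied by the `t` and `y` components of a point symmetry. -/
theorem IsPointSymmetry.pd_ex_t_y (hΦ : IsPointSymmetry Φ) {b : Base} {u : Base → ℝ}
    (hs : (b, u b) ∈ Φ.source) (hu : SolAt u b)
    (hinj : Function.Injective (fderiv ℝ (fun y => (Φ (y, u y)).1) b)) :
    pd ex (fun y => (Φ (y, u y)).1.1) b = 0 ∧ pd ex (fun y => (Φ (y, u y)).1.2.2) b = 0 := by
  set b' := (Φ (b, u b)).1 with hb'
  have hfd : ∀ k₁ k₂ : ℝ, fderiv ℝ (polySol b' 0 0 0 0 k₁ k₂) b' = 0 := fun k₁ k₂ => by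
    refine ContinuousLinearMap.ext fun z => ?_
    have := pd_polySol b' 0 0 0 0 k₁ k₂ b' z
    rw [pd] at this
    rw [this]
    simp
  have hz : ∀ k₁ k₂ : ℝ, polySol b' 0 0 0 0 k₁ k₂ b' = 0 := fun k₁ k₂ => by simp [polySol]
  have sm : ∀ {v : Base → ℝ}, SolAt v b → v b = u b →
      ∀ᶠ y in 𝓝 b, ContDiffAt ℝ ∞ (fun y => (Φ (y, v y)).1) y := fun {v} hv hv0 => by
    have hc : ContinuousAt (fun y => (y, v y)) b :=
      continuousAt_id.prodMk hv.self_of_nhds.1.continuousAt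
    have hsrc : ∀ᶠ y in 𝓝 b, (y, v y) ∈ Φ.source :=
      hc.eventually (Φ.open_source.mem_nhds (by simpa only [hv0] using hs))
    filter_upwards [hsrc, hv.smooth] with y h1 h2
    exact (ContDiffAt.comp (f := fun y => (y, v y)) y (hΦ.contDiffAt h1)
      (contDiffAt_id.prodMk h2)).fst
  have hcong : ∀ {v : Base → ℝ}, SolAt v b → v b = u b → fderiv ℝ v b = fderiv ℝ u b →
      ∀ G : Base →L[ℝ] ℝ, pd ex (fun y => G (Φ (y, v y)).1) b
        = pd ex (fun y => G (Φ (y, u y)).1) b := fun {v} hv hv0 hv1 G => by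
    have hd : DifferentiableAt ℝ (fun q => G (Φ q).1) (b, u b) :=
      (G.differentiableAt).comp (b, u b) ((hΦ.contDiffAt hs).differentiableAt (by simp)).fst
    rw [pd, pd, fderiv_graph_congr (G := fun q => G (Φ q).1) hu.self_of_nhds.1.diff
      hv.self_of_nhds.1.diff hd hv0 hv1]
  have ht : pd ex (fun y => (Φ (y, u y)).1.1) b = 0 := by
    -- This perturbation is the square of the increment of t plus terms of order at least three. Its
    -- second x-derivative is therefore twice the square of the x-derivative of the t component.
    obtain ⟨v, hv, hv0, hv1, hzero⟩ := hΦ.perturb hs hu hinj (solAt_polySol b' 0 0 0 0 1 0 b')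
      (hz 1 0) (hfd 1 0)
    have hS := sm hv hv0
    have hS0 : (Φ (b, v b)).1 = b' := by rw [hv0]
    set f : Base → ℝ := fun y => (Φ (y, v y)).1.1 - b'.1 with hf
    set g : Base → ℝ := fun y => (Φ (y, v y)).1.2.1 - b'.2.1 with hg
    have f0 : f b = 0 := by simp [hf, hS0]
    have g0 : g b = 0 := by simp [hg, hS0]
    have fs : ∀ᶠ y in 𝓝 b, ContDiffAt ℝ ∞ f y :=
      hS.mono fun y hy => hy.fst.sub contDiffAt_const
    have gs : ∀ᶠ y in 𝓝 b, ContDiffAt ℝ ∞ g y :=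
      hS.mono fun y hy => hy.snd.fst.sub contDiffAt_const
    have hggs : ∀ᶠ y in 𝓝 b, ContDiffAt ℝ ∞ (fun y => g y * g y) y := gs.mono fun y h => h.mul h
    have hfggs : ∀ᶠ y in 𝓝 b, ContDiffAt ℝ ∞ (fun y => f y + g y * g y) y :=
      (fs.and hggs).mono fun y h => h.1.add h.2
    have hk : ∀ᶠ y in 𝓝 b, ContDiffAt ℝ ∞ (fun y => g y * g y * (1 / 12)) y :=
      hggs.mono fun y h => h.mul contDiffAt_const
    -- Writing the polynomial as a sum of products of functions vanishing at `b` leaves only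
    -- products of first derivatives, and those of `g * g` vanish.
    have e : (fun y => polySol b' 0 0 0 0 1 0 (Φ (y, v y)).1) =
        fun y => f y * (f y + g y * g y) + (g y * g y) * (g y * g y * (1 / 12)) := by
      funext y; simp only [polySol, hf, hg]; ring
    have hgg0 := pd_mul_of_zero (v := ex) gs.self_of_nhds.diff gs.self_of_nhds.diff g0 g0
    rw [e, pd_pd_add (f := fun y => f y * (f y + g y * g y))
      ((fs.and hfggs).mono fun y h => h.1.mul h.2) ((hggs.and hk).mono fun y h => h.1.mul h.2),
      pd_pd_mul_of_zero fs hfggs f0 (by simp [f0, g0]),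
      pd_pd_mul_of_zero hggs hk (by simp [g0]) (by simp [g0]), hgg0,
      pd_add fs.self_of_nhds.diff hggs.self_of_nhds.diff, hgg0] at hzero
    have hfx : pd ex f b = 0 := by
      have : pd ex f b ^ 2 = 0 := by linarith
      exact pow_eq_zero_iff two_ne_zero |>.1 this
    rw [hf, pd_sub hS.self_of_nhds.fst.diff (differentiableAt_const _), pd_const, sub_zero] at hfx
    rw [← hfx]
    exact (hcong hv hv0 hv1 (ContinuousLinearMap.fst ℝ ℝ (ℝ × ℝ))).symm
  refine ⟨ht, ?_⟩
  -- The quadratic part is now the square of y − y' − x'(t − t'), with primes at the image point.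
  -- The x-derivative of this expression vanishes, and that of t is already known to be zero.
  · obtain ⟨v, hv, hv0, hv1, hzero⟩ := hΦ.perturb hs hu hinj (solAt_polySol b' 0 0 0 0 0 1 b')
      (hz 0 1) (hfd 0 1)
    have hS := sm hv hv0
    have hS0 : (Φ (b, v b)).1 = b' := by rw [hv0]
    set f : Base → ℝ := fun y => (Φ (y, v y)).1.2.2 - b'.2.2 - b'.2.1 * ((Φ (y, v y)).1.1 - b'.1)
      with hf
    set g : Base → ℝ := fun y => (Φ (y, v y)).1.2.1 - b'.2.1 with hg
    have f0 : f b = 0 := by simp [hf, hS0]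
    have g0 : g b = 0 := by simp [hg, hS0]
    have fs : ∀ᶠ y in 𝓝 b, ContDiffAt ℝ ∞ f y :=
      hS.mono fun y hy => (hy.snd.snd.sub contDiffAt_const).sub
        (contDiffAt_const.mul (hy.fst.sub contDiffAt_const))
    have gs : ∀ᶠ y in 𝓝 b, ContDiffAt ℝ ∞ g y :=
      hS.mono fun y hy => hy.snd.fst.sub contDiffAt_const
    have hggs : ∀ᶠ y in 𝓝 b, ContDiffAt ℝ ∞ (fun y => g y * g y) y := gs.mono fun y h => h.mul h
    have hk : ∀ᶠ y in 𝓝 b, ContDiffAt ℝ ∞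
        (fun y => g y * (f y * (1 / 3)) + g y * g y * (g y * g y * (1 / 90))) y :=
      (gs.and (fs.and hggs)).mono fun y h => (h.1.mul (h.2.1.mul contDiffAt_const)).add
        (h.2.2.mul (h.2.2.mul contDiffAt_const))
    have e : (fun y => polySol b' 0 0 0 0 0 1 (Φ (y, v y)).1) =
        fun y => f y * f y + (g y * g y) *
          (g y * (f y * (1 / 3)) + g y * g y * (g y * g y * (1 / 90))) := by
      funext y; simp only [polySol, hf, hg]; ring
    have hgg0 := pd_mul_of_zero (v := ex) gs.self_of_nhds.diff gs.self_of_nhds.diff g0 g0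
    rw [e, pd_pd_add (f := fun y => f y * f y) (fs.mono fun y h => h.mul h)
      ((hggs.and hk).mono fun y h => h.1.mul h.2), pd_pd_mul_of_zero fs fs f0 f0,
      pd_pd_mul_of_zero hggs hk (by simp [g0]) (by simp [g0]), hgg0] at hzero
    have hfx : pd ex f b = 0 := by
      have : pd ex f b ^ 2 = 0 := by linarith
      exact pow_eq_zero_iff two_ne_zero |>.1 this
    have h1 := hcong hv hv0 hv1 (ContinuousLinearMap.fst ℝ ℝ (ℝ × ℝ))
    have h2 := hcong hv hv0 hv1
      ((ContinuousLinearMap.snd ℝ ℝ ℝ).comp (ContinuousLinearMap.snd ℝ ℝ (ℝ × ℝ)))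
    have h3 : pd ex (fun y => (Φ (y, v y)).1.1) b = 0 := h1.trans ht
    have h4 : pd ex (fun y => (Φ (y, v y)).1.2.2) b = pd ex (fun y => (Φ (y, u y)).1.2.2) b := h2
    have s0 := hS.self_of_nhds
    rw [hf, pd_sub (s0.snd.snd.sub contDiffAt_const).diff
      (contDiffAt_const.mul (s0.fst.sub contDiffAt_const)).diff,
      pd_sub s0.snd.snd.diff (differentiableAt_const _),
      pd_mul (differentiableAt_const _) (s0.fst.sub contDiffAt_const).diff,
      pd_sub s0.fst.diff (differentiableAt_const _), h3, h4] at hfx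
    simpa [pd_const] using hfx

end Kolmogorov

/-! ### First-order structure of a point symmetry -/

namespace Kolmogorov

/-- The component for `t`. -/
abbrev tComp (Φ : OpenPartialHomeomorph Total Total) (q : Total) : ℝ := (Φ q).1.1
/-- The component for `x`. -/
abbrev xComp (Φ : OpenPartialHomeomorph Total Total) (q : Total) : ℝ := (Φ q).1.2.1
/-- The component for `y`. -/
abbrev yComp (Φ : OpenPartialHomeomorph Total Total) (q : Total) : ℝ := (Φ q).1.2.2
/-- The component for `u`. -/
abbrev uComp (Φ : OpenPartialHomeomorph Total Total) (q : Total) : ℝ := (Φ q).2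

variable {Φ : OpenPartialHomeomorph Total Total}

theorem fderiv_eq_pd {p : Total} (h : DifferentiableAt ℝ Φ p) (v : Total) :
    fderiv ℝ Φ p v = ((pd v (tComp Φ) p, pd v (xComp Φ) p, pd v (yComp Φ) p),
      pd v (uComp Φ) p) := by
  have h0 := h.hasFDerivAt
  ext
  · exact (DFunLike.congr_fun h0.fst.fst.fderiv v).symm
  · exact (DFunLike.congr_fun h0.fst.snd.fst.fderiv v).symm
  · exact (DFunLike.congr_fun h0.fst.snd.snd.fderiv v).symm
  · exact (DFunLike.congr_fun h0.snd.fderiv v).symm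

theorem pd_total_coord (v : Total) (f : Total → ℝ) (p : Total) :
    pd v f p = v.1.1 * pd (et, 0) f p + v.1.2.1 * pd (ex, 0) f p + v.1.2.2 * pd (ey, 0) f p
      + v.2 * pd (0, 1) f p := by
  rw [← pd_total_base, ← pd_total]

theorem IsPointSymmetry.comp_contDiffAt (hΦ : IsPointSymmetry Φ) {p : Total} (hp : p ∈ Φ.source) :
    ContDiffAt ℝ ∞ (tComp Φ) p ∧ ContDiffAt ℝ ∞ (xComp Φ) p ∧ ContDiffAt ℝ ∞ (yComp Φ) p ∧
      ContDiffAt ℝ ∞ (uComp Φ) p :=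
  ⟨(hΦ.contDiffAt hp).fst.fst, (hΦ.contDiffAt hp).fst.snd.fst, (hΦ.contDiffAt hp).fst.snd.snd,
    (hΦ.contDiffAt hp).snd⟩

theorem IsPointSymmetry.fderiv_graph (hΦ : IsPointSymmetry Φ) {b : Base} {u : Base → ℝ}
    (hs : (b, u b) ∈ Φ.source) (hu : DifferentiableAt ℝ u b) (z : Base) :
    fderiv ℝ (fun y => (Φ (y, u y)).1) b z = (fderiv ℝ Φ (b, u b) (z, pd z u b)).1 := by
  have hd := (hΦ.contDiffAt hs).differentiableAt (by simp)
  rw [(hasFDerivAt_graph (G := fun q => (Φ q).1) hu hd.fst).fderiv, hd.hasFDerivAt.fst.fderiv]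
  rfl

/-- Two distinct generic slopes suffice. -/
theorem slope_algebra {k₁ k₂ k₃ k₄ α β : ℝ} (hk : ¬(k₁ = 0 ∧ k₂ = 0 ∧ k₃ = 0 ∧ k₄ = 0))
    (h : ∀ a p c : ℝ, a * k₁ + p * k₂ + c * k₃ ≠ k₄ → α + p * β = 0) : α = 0 ∧ β = 0 := by
  suffices ∃ p q : ℝ, p ≠ q ∧ α + p * β = 0 ∧ α + q * β = 0 by
    obtain ⟨p, q, hpq, h1, h2⟩ := this
    have hβ : β = 0 := by
      have : (p - q) * β = 0 := by linear_combination h1 - h2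
      exact (mul_eq_zero.1 this).resolve_left (sub_ne_zero.2 hpq)
    subst hβ
    exact ⟨by linarith, rfl⟩
  by_cases h1 : k₁ = 0
  · by_cases h3 : k₃ = 0
    · by_cases h2 : k₂ = 0
      · have h4 : k₄ ≠ 0 := fun h4 => hk ⟨h1, h2, h3, h4⟩
        exact ⟨0, 1, by norm_num, h 0 0 0 (by simpa using h4.symm),
          h 0 1 0 (by simpa [h2] using h4.symm)⟩
      · refine ⟨(k₄ + 1) / k₂, (k₄ + 2) / k₂, ?_, h 0 _ 0 ?_, h 0 _ 0 ?_⟩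
        · intro e
          have := (div_left_inj' h2).1 e
          linarith
        · rw [div_mul_cancel₀ _ h2]; intro e; linarith
        · rw [div_mul_cancel₀ _ h2]; intro e; linarith
    · refine ⟨0, 1, by norm_num, h 0 0 ((k₄ + 1) / k₃) ?_, h 0 1 ((k₄ + 1 - k₂) / k₃) ?_⟩
      · rw [div_mul_cancel₀ _ h3]; intro e; linarith
      · rw [div_mul_cancel₀ _ h3]; intro e; linarith
  · refine ⟨0, 1, by norm_num, h ((k₄ + 1) / k₁) 0 0 ?_, h ((k₄ + 1 - k₂) / k₁) 1 0 ?_⟩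
    · rw [div_mul_cancel₀ _ h1]; intro e; linarith
    · rw [div_mul_cancel₀ _ h1]; intro e; linarith

theorem polySol_self (b : Base) (u₀ p r c : ℝ) : polySol b u₀ p r c 0 0 b = u₀ := by
  simp [polySol]

theorem pd_polySol_self (b : Base) (u₀ p r c : ℝ) (v : Base) :
    pd v (polySol b u₀ p r c 0 0) b = p * v.2.1 + r * v.1 + c * (v.2.2 - b.2.1 * v.1) := by
  rw [pd_polySol]; simp

/-- The `t` and `y` components of a point symmetry depend on `t` and `y` only. -/
theorem IsPointSymmetry.t_y_indep (hΦ : IsPointSymmetry Φ) {p : Total} (hp : p ∈ Φ.source) :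
    pd (ex, 0) (tComp Φ) p = 0 ∧ pd (0, 1) (tComp Φ) p = 0 ∧
      pd (ex, 0) (yComp Φ) p = 0 ∧ pd (0, 1) (yComp Φ) p = 0 := by
  obtain ⟨b, u₀⟩ := p
  obtain ⟨hinjΦ, hsurjΦ⟩ := hΦ.fderiv_bijective hp
  -- `k` is the direction sent to the vertical. The image of a graph is transversal exactly when `k`
  -- is not tangent to the graph, an inequality on the slopes that leaves enough freedom for
  -- `slope_algebra`.
  obtain ⟨k, hk⟩ := hsurjΦ ((0, 0, 0), 1)
  have hcd := hΦ.comp_contDiffAt hp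
  have hk0 : ¬(k.1.1 = 0 ∧ k.1.2.1 = 0 ∧ k.1.2.2 = 0 ∧ k.2 = 0) := by
    rintro ⟨h1, h2, h3, h4⟩
    have : k = 0 := by ext <;> assumption
    rw [this, map_zero] at hk
    simpa using congrArg Prod.snd hk
  have main : ∀ a q c : ℝ, a * k.1.1 + q * k.1.2.1 + c * k.1.2.2 ≠ k.2 →
      pd (ex, 0) (tComp Φ) (b, u₀) + q * pd (0, 1) (tComp Φ) (b, u₀) = 0 ∧
      pd (ex, 0) (yComp Φ) (b, u₀) + q * pd (0, 1) (yComp Φ) (b, u₀) = 0 := by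
    intro a q c hne
    -- The coefficient `a + x c` makes the t-derivative at `b` equal to `a`.
    set u := polySol b u₀ q (a + b.2.1 * c) c 0 0 with hu
    have hu0 : u b = u₀ := polySol_self ..
    have hsol : SolAt u b := solAt_polySol ..
    have hs : (b, u b) ∈ Φ.source := by rwa [hu0]
    have hpdu : ∀ z : Base, pd z u b = a * z.1 + q * z.2.1 + c * z.2.2 := fun z => by
      rw [hu, pd_polySol_self]; ring
    have hinj : Function.Injective (fderiv ℝ (fun y => (Φ (y, u y)).1) b) := by
      rw [injective_iff_map_eq_zero]
      intro z hz
      rw [hΦ.fderiv_graph hs hsol.self_of_nhds.1.diff, hu0] at hz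
      set m := (fderiv ℝ Φ (b, u₀) (z, pd z u b)).2 with hm
      have h1 : fderiv ℝ Φ (b, u₀) (z, pd z u b) = fderiv ℝ Φ (b, u₀) (m • k) := by
        rw [map_smul, hk]
        ext1
        · rw [hz]; ext <;> simp
        · simp [hm]
      have h2 := hinjΦ h1
      have h3 : z = m • k.1 := congrArg Prod.fst h2
      have h4 : pd z u b = m * k.2 := congrArg Prod.snd h2
      rw [hpdu, h3] at h4
      have h5 : m * (a * k.1.1 + q * k.1.2.1 + c * k.1.2.2 - k.2) = 0 := by
        simp only [Prod.smul_fst, Prod.smul_snd, smul_eq_mul] at h4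
        linear_combination h4
      have h6 : m = 0 := (mul_eq_zero.1 h5).resolve_right (sub_ne_zero.2 hne)
      rw [h3, h6, zero_smul]
    have hT := hΦ.pd_ex_t_y hs hsol hinj
    have hq : pd ex u b = q := by rw [hpdu]; simp
    have g : ∀ F : Total → ℝ, ContDiffAt ℝ ∞ F (b, u₀) → pd ex (fun y => F (y, u y)) b =
        pd (ex, 0) F (b, u₀) + q * pd (0, 1) F (b, u₀) := fun F hF => by
      rw [pd_comp_graph hsol.self_of_nhds.1.diff (by rw [hu0]; exact hF.diff), hq, hu0]
    exact ⟨(g (tComp Φ) hcd.1).symm.trans hT.1, (g (yComp Φ) hcd.2.2.1).symm.trans hT.2⟩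
  have h1 := slope_algebra hk0 fun a q c h => (main a q c h).1
  have h2 := slope_algebra hk0 fun a q c h => (main a q c h).2
  exact ⟨h1.1, h1.2, h2.1, h2.2⟩

/-- Because the t and y components depend on t and y alone, the differential is block triangular
with respect to the pairs (t, y) and (x, u). It is surjective, so both diagonal blocks are
invertible. -/
theorem IsPointSymmetry.det_ne_zero (hΦ : IsPointSymmetry Φ) {p : Total} (hp : p ∈ Φ.source) :
    pd (et, 0) (tComp Φ) p * pd (ey, 0) (yComp Φ) p
      - pd (ey, 0) (tComp Φ) p * pd (et, 0) (yComp Φ) p ≠ 0 ∧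
    pd (ex, 0) (xComp Φ) p * pd (0, 1) (uComp Φ) p
      - pd (0, 1) (xComp Φ) p * pd (ex, 0) (uComp Φ) p ≠ 0 := by
  obtain ⟨tx, tu, yx, yu⟩ := hΦ.t_y_indep hp
  have hd := (hΦ.contDiffAt hp).differentiableAt (by simp)
  have hsurj := (hΦ.fderiv_bijective hp).2
  have comp : ∀ v w : Total, fderiv ℝ Φ p v = w →
      v.1.1 * pd (et, 0) (tComp Φ) p + v.1.2.2 * pd (ey, 0) (tComp Φ) p = w.1.1 ∧
      v.1.1 * pd (et, 0) (yComp Φ) p + v.1.2.2 * pd (ey, 0) (yComp Φ) p = w.1.2.2 ∧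
      v.1.1 * pd (et, 0) (xComp Φ) p + v.1.2.1 * pd (ex, 0) (xComp Φ) p
        + v.1.2.2 * pd (ey, 0) (xComp Φ) p + v.2 * pd (0, 1) (xComp Φ) p = w.1.2.1 ∧
      v.1.1 * pd (et, 0) (uComp Φ) p + v.1.2.1 * pd (ex, 0) (uComp Φ) p
        + v.1.2.2 * pd (ey, 0) (uComp Φ) p + v.2 * pd (0, 1) (uComp Φ) p = w.2 := by
    rintro v _ rfl
    rw [fderiv_eq_pd hd]
    simp only [pd_total_coord v, tx, tu, yx, yu]
    refine ⟨?_, ?_, trivial, trivial⟩ <;> ring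
  obtain ⟨v, hv⟩ := hsurj ((1, 0, 0), 0)
  obtain ⟨w, hw⟩ := hsurj ((0, 0, 1), 0)
  obtain ⟨v', hv'⟩ := hsurj ((0, 1, 0), 0)
  obtain ⟨w', hw'⟩ := hsurj ((0, 0, 0), 1)
  obtain ⟨v1, v2, -, -⟩ := comp _ _ hv
  obtain ⟨w1, w2, -, -⟩ := comp _ _ hw
  obtain ⟨v1', v2', v3', v4'⟩ := comp _ _ hv'
  obtain ⟨w1', w2', w3', w4'⟩ := comp _ _ hw'
  have hJ : pd (et, 0) (tComp Φ) p * pd (ey, 0) (yComp Φ) p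
      - pd (ey, 0) (tComp Φ) p * pd (et, 0) (yComp Φ) p ≠ 0 := by
    intro h
    have : (v.1.1 * w.1.2.2 - v.1.2.2 * w.1.1) * (pd (et, 0) (tComp Φ) p * pd (ey, 0) (yComp Φ) p
      - pd (ey, 0) (tComp Φ) p * pd (et, 0) (yComp Φ) p) = 1 := by
      linear_combination (w.1.1 * pd (et, 0) (yComp Φ) p + w.1.2.2 * pd (ey, 0) (yComp Φ) p) * v1
        + w2 - (v.1.1 * pd (et, 0) (yComp Φ) p + v.1.2.2 * pd (ey, 0) (yComp Φ) p) * w1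
    rw [h, mul_zero] at this
    exact zero_ne_one this
  refine ⟨hJ, fun h => ?_⟩
  have zero : ∀ a c : ℝ, a * pd (et, 0) (tComp Φ) p + c * pd (ey, 0) (tComp Φ) p = 0 →
      a * pd (et, 0) (yComp Φ) p + c * pd (ey, 0) (yComp Φ) p = 0 → a = 0 ∧ c = 0 := by
    intro a c h1 h2
    constructor
    · refine (mul_eq_zero.1 ?_).resolve_right hJ
      linear_combination pd (ey, 0) (yComp Φ) p * h1 - pd (ey, 0) (tComp Φ) p * h2
    · refine (mul_eq_zero.1 ?_).resolve_right hJ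
      linear_combination pd (et, 0) (tComp Φ) p * h2 - pd (et, 0) (yComp Φ) p * h1
  obtain ⟨z1, z2⟩ := zero _ _ v1' v2'
  obtain ⟨z3, z4⟩ := zero _ _ w1' w2'
  simp only [z1, z2, z3, z4, zero_mul, zero_add, add_zero] at v3' v4' w3' w4'
  have : (v'.1.2.1 * w'.2 - v'.2 * w'.1.2.1) * (pd (ex, 0) (xComp Φ) p * pd (0, 1) (uComp Φ) p
      - pd (0, 1) (xComp Φ) p * pd (ex, 0) (uComp Φ) p) = 1 := by
    linear_combination v3' + (v'.1.2.1 * pd (ex, 0) (xComp Φ) p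
      + v'.2 * pd (0, 1) (xComp Φ) p) * w4' - (v'.1.2.1 * pd (ex, 0) (uComp Φ) p
      + v'.2 * pd (0, 1) (uComp Φ) p) * w3'
  rw [h, mul_zero] at this
  exact zero_ne_one this

/-- The relations between the jets of a solution and of its image. -/
theorem IsPointSymmetry.jet_relations (hΦ : IsPointSymmetry Φ) {p : Total} (hp : p ∈ Φ.source)
    (q r c : ℝ) {D : ℝ} (hD : D = pd (ex, 0) (xComp Φ) p + q * pd (0, 1) (xComp Φ) p)
    (hD0 : D ≠ 0) : ∃ α π χ : ℝ,
      π * D = pd (ex, 0) (uComp Φ) p + q * pd (0, 1) (uComp Φ) p ∧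
      α * pd (et, 0) (tComp Φ) p + χ * pd (et, 0) (yComp Φ) p
        + π * (pd (et, 0) (xComp Φ) p + (r - p.1.2.1 * c) * pd (0, 1) (xComp Φ) p)
        = pd (et, 0) (uComp Φ) p + (r - p.1.2.1 * c) * pd (0, 1) (uComp Φ) p ∧
      α * pd (ey, 0) (tComp Φ) p + χ * pd (ey, 0) (yComp Φ) p
        + π * (pd (ey, 0) (xComp Φ) p + c * pd (0, 1) (xComp Φ) p)
        = pd (ey, 0) (uComp Φ) p + c * pd (0, 1) (uComp Φ) p ∧
      α * (pd (et, 0) (tComp Φ) p + p.1.2.1 * pd (ey, 0) (tComp Φ) p - D ^ 2)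
        + χ * (pd (et, 0) (yComp Φ) p + p.1.2.1 * pd (ey, 0) (yComp Φ) p - xComp Φ p * D ^ 2)
        + π * (pd (et, 0) (xComp Φ) p + p.1.2.1 * pd (ey, 0) (xComp Φ) p
          - pd (ex, 0) (pd (ex, 0) (xComp Φ)) p - 2 * q * pd (ex, 0) (pd (0, 1) (xComp Φ)) p
          - q ^ 2 * pd (0, 1) (pd (0, 1) (xComp Φ)) p)
        = pd (et, 0) (uComp Φ) p + p.1.2.1 * pd (ey, 0) (uComp Φ) p
          - pd (ex, 0) (pd (ex, 0) (uComp Φ)) p - 2 * q * pd (ex, 0) (pd (0, 1) (uComp Φ)) p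
          - q ^ 2 * pd (0, 1) (pd (0, 1) (uComp Φ)) p := by
  obtain ⟨b, u₀⟩ := p
  obtain ⟨hcT, hcX, hcY, hcU⟩ := hΦ.comp_contDiffAt hp
  obtain ⟨tx, tu, yx, yu⟩ := hΦ.t_y_indep hp
  obtain ⟨hJ, -⟩ := hΦ.det_ne_zero hp
  set u := polySol b u₀ q r c 0 0 with hu
  have hu0 : u b = u₀ := polySol_self ..
  have hsol : SolAt u b := solAt_polySol ..
  have hs : (b, u b) ∈ Φ.source := by rwa [hu0]
  have hpdu : ∀ z : Base, pd z u b = q * z.2.1 + r * z.1 + c * (z.2.2 - b.2.1 * z.1) :=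
    fun z => by rw [hu, pd_polySol_self]
  have du := hsol.self_of_nhds.1.diff
  have g1 : ∀ (F : Total → ℝ), ContDiffAt ℝ ∞ F (b, u₀) → ∀ v : Base,
      pd v (fun y => F (y, u y)) b = pd (v, 0) F (b, u₀) + pd v u b * pd (0, 1) F (b, u₀) :=
    fun F hF v => by
      rw [pd_comp_graph du (by rw [hu0]; exact hF.diff), hu0]
  have hinj : Function.Injective (fderiv ℝ (fun y => (Φ (y, u y)).1) b) := by
    rw [injective_iff_map_eq_zero]
    intro z hz
    rw [hΦ.fderiv_graph hs du, hu0, fderiv_eq_pd ((hΦ.contDiffAt hp).differentiableAt (by simp))]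
      at hz
    have z1 := congrArg (fun s : Base => s.1) hz
    have z2 := congrArg (fun s : Base => s.2.1) hz
    have z3 := congrArg (fun s : Base => s.2.2) hz
    simp only [pd_total_coord (z, _), tx, tu, yx, yu, Prod.fst_zero, Prod.snd_zero] at z1 z2 z3
    have h1 : z.1 = 0 := by
      refine (mul_eq_zero.1 ?_).resolve_right hJ
      linear_combination pd (ey, 0) (yComp Φ) (b, u₀) * z1 - pd (ey, 0) (tComp Φ) (b, u₀) * z3
    have h3 : z.2.2 = 0 := by
      refine (mul_eq_zero.1 ?_).resolve_right hJ
      linear_combination pd (et, 0) (tComp Φ) (b, u₀) * z3 - pd (et, 0) (yComp Φ) (b, u₀) * z1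
    have h2 : z.2.1 = 0 := by
      refine (mul_eq_zero.1 ?_).resolve_right hD0
      rw [hpdu, h1, h3] at z2
      rw [hD]
      linear_combination z2
    ext <;> assumption
  obtain ⟨u', hu', hpush, -, -⟩ := hΦ.push hs hsol hinj
  have hc : ContinuousAt (fun y => (y, u y)) b :=
    continuousAt_id.prodMk hsol.self_of_nhds.1.continuousAt
  have hsrc : ∀ᶠ y in 𝓝 b, (y, u y) ∈ Φ.source := hc.eventually (Φ.open_source.mem_nhds hs)
  have g2 : ∀ᶠ y in 𝓝 b, ContDiffAt ℝ ∞ (fun y => Φ (y, u y)) y := by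
    filter_upwards [hsrc, hsol.smooth] with y h1 h2
    exact ContDiffAt.comp (f := fun y => (y, u y)) y (hΦ.contDiffAt h1) (contDiffAt_id.prodMk h2)
  have sT : ∀ᶠ y in 𝓝 b, ContDiffAt ℝ ∞ (fun y => tComp Φ (y, u y)) y :=
    g2.mono fun y h => h.fst.fst
  have sX : ∀ᶠ y in 𝓝 b, ContDiffAt ℝ ∞ (fun y => xComp Φ (y, u y)) y :=
    g2.mono fun y h => h.fst.snd.fst
  have sY : ∀ᶠ y in 𝓝 b, ContDiffAt ℝ ∞ (fun y => yComp Φ (y, u y)) y :=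
    g2.mono fun y h => h.fst.snd.snd
  have hzero : ∀ᶠ y in 𝓝 b, pd ex (fun y => tComp Φ (y, u y)) y = 0 ∧
      pd ex (fun y => yComp Φ (y, u y)) y = 0 := by
    filter_upwards [hsrc, hsol.smooth] with y h1 h2
    obtain ⟨t1, t2, t3, t4⟩ := hΦ.t_y_indep h1
    obtain ⟨c1, -, c3, -⟩ := hΦ.comp_contDiffAt h1
    rw [pd_comp_graph h2.diff c1.diff, pd_comp_graph h2.diff c3.diff, t1, t2, t3, t4]
    simp
  have hbb : (b, u b) = (b, u₀) := by rw [hu0]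
  have first : ∀ v : Base, pd (v, 0) (uComp Φ) (b, u₀) + pd v u b * pd (0, 1) (uComp Φ) (b, u₀) =
      (pd (v, 0) (tComp Φ) (b, u₀) + pd v u b * pd (0, 1) (tComp Φ) (b, u₀)) *
        pd et u' (Φ (b, u b)).1 +
      (pd (v, 0) (xComp Φ) (b, u₀) + pd v u b * pd (0, 1) (xComp Φ) (b, u₀)) *
        pd ex u' (Φ (b, u b)).1 +
      (pd (v, 0) (yComp Φ) (b, u₀) + pd v u b * pd (0, 1) (yComp Φ) (b, u₀)) *
        pd ey u' (Φ (b, u b)).1 := by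
    intro v
    rw [← g1 _ hcU, ← g1 _ hcT, ← g1 _ hcX, ← g1 _ hcY,
      ← pd_congr (v := v) (hpush : _ =ᶠ[𝓝 b] fun y => uComp Φ (y, u y))]
    exact pd_comp3 sT.self_of_nhds.diff sX.self_of_nhds.diff sY.self_of_nhds.diff
      hu'.self_of_nhds.1.diff
  have near : ∀ {F : Total → ℝ}, (∀ q ∈ Φ.source, ContDiffAt ℝ ∞ F q) →
      ∀ᶠ q in 𝓝 (b, u b), ContDiffAt ℝ ∞ F q := fun {F} hF => by
    filter_upwards [Φ.open_source.mem_nhds hs] with q hq using hF q hq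
  have second := pd_pd_comp3 sT sX sY (w := u') hu'.smooth (hzero.mono fun _ h => h.1)
    (hzero.mono fun _ h => h.2)
  rw [pd_congr (pd_eventuallyEq (v := ex) (hpush : _ =ᶠ[𝓝 b] fun y => uComp Φ (y, u y))),
    pd_pd_comp_graph hsol.smooth (near fun q hq => (hΦ.comp_contDiffAt hq).2.2.2),
    pd_pd_comp_graph hsol.smooth (near fun q hq => (hΦ.comp_contDiffAt hq).2.1), hu0,
    g1 _ hcX] at second
  have heq := hu'.eq
  have hx := first ex
  have ht := first et
  have hy := first ey
  have hxx : pd ex (pd ex u) b = r := by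
    rw [← hsol.eq, hpdu, hpdu]; simp; ring
  rw [hxx] at second
  have ux : pd ex u b = q := by rw [hpdu]; simp
  have ut : pd et u b = r - b.2.1 * c := by rw [hpdu]; simp; ring
  have uy : pd ey u b = c := by rw [hpdu]; simp
  rw [ux, tx, tu, yx, yu] at hx
  rw [ut, tu, yu] at ht
  rw [uy, tu, yu] at hy
  rw [ux] at second
  have hΦp : ((Φ (b, u b)).1 : Base) = (Φ (b, u₀)).1 := by rw [hu0]
  have second' : pd (ex, 0) (pd (ex, 0) (uComp Φ)) (b, u₀) + 2 * q * pd (ex, 0) (pd (0, 1)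
      (uComp Φ)) (b, u₀) + q ^ 2 * pd (0, 1) (pd (0, 1) (uComp Φ)) (b, u₀)
      + r * pd (0, 1) (uComp Φ) (b, u₀) =
      (pd (ex, 0) (xComp Φ) (b, u₀) + q * pd (0, 1) (xComp Φ) (b, u₀)) ^ 2 *
        pd ex (pd ex u') (Φ (b, u₀)).1 + (pd (ex, 0) (pd (ex, 0) (xComp Φ)) (b, u₀)
      + 2 * q * pd (ex, 0) (pd (0, 1) (xComp Φ)) (b, u₀)
      + q ^ 2 * pd (0, 1) (pd (0, 1) (xComp Φ)) (b, u₀)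
      + r * pd (0, 1) (xComp Φ) (b, u₀)) * pd ex u' (Φ (b, u₀)).1 := second
  rw [hΦp] at hx ht hy heq
  -- The three numbers are the first derivatives of the image solution. The last relation comes from
  -- the chain rule of second order, its second x-derivative being eliminated by the equation.
  refine ⟨pd et u' (Φ (b, u₀)).1, pd ex u' (Φ (b, u₀)).1, pd ey u' (Φ (b, u₀)).1, ?_, ?_, ?_, ?_⟩
  · rw [hD]; linear_combination -hx
  · linear_combination -ht
  · linear_combination -hy
  · rw [hD]
    have heq' : pd et u' (Φ (b, u₀)).1 + xComp Φ (b, u₀) * pd ey u' (Φ (b, u₀)).1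
      = pd ex (pd ex u') (Φ (b, u₀)).1 := heq
    linear_combination -ht - b.2.1 * hy + second' -
      (pd (ex, 0) (xComp Φ) (b, u₀) + q * pd (0, 1) (xComp Φ) (b, u₀)) ^ 2 * heq'

end Kolmogorov

/-! ### The determining equations -/

namespace Kolmogorov

theorem pd_congr_on {E : Type*} [NormedAddCommGroup E] [NormedSpace ℝ E] {O : Set E}
    (hO : IsOpen O) {F G : E → ℝ} (h : ∀ q ∈ O, F q = G q) (v : E) {p : E} (hp : p ∈ O) :
    pd v F p = pd v G p :=
  pd_congr (Filter.eventuallyEq_of_mem (hO.mem_nhds hp) h)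

theorem pd_zero_on {E : Type*} [NormedAddCommGroup E] [NormedSpace ℝ E] {O : Set E}
    (hO : IsOpen O) {F : E → ℝ} (h : ∀ q ∈ O, F q = 0) (v : E) {p : E} (hp : p ∈ O) :
    pd v F p = 0 := by
  rw [pd_congr_on hO (G := fun _ => 0) h v hp, pd_const]

variable {Φ : OpenPartialHomeomorph Total Total}

/-- For fixed `q` the x-derivative of the image solution is fixed, while its t- and y-derivatives
vary with the t- and y-slopes of the source. Differences of the last jet relation are then a
homogeneous linear system for the two defects `m` and `n`, with non-zero determinant since `κ ≠ 0`.
-/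
theorem IsPointSymmetry.t_y_relations (hΦ : IsPointSymmetry Φ) {p : Total} (hp : p ∈ Φ.source)
    (q : ℝ) {D : ℝ} (hD : D = pd (ex, 0) (xComp Φ) p + q * pd (0, 1) (xComp Φ) p) (hD0 : D ≠ 0) :
    pd (et, 0) (tComp Φ) p + p.1.2.1 * pd (ey, 0) (tComp Φ) p = D ^ 2 ∧
      pd (et, 0) (yComp Φ) p + p.1.2.1 * pd (ey, 0) (yComp Φ) p = xComp Φ p * D ^ 2 := by
  obtain ⟨-, hΔ⟩ := hΦ.det_ne_zero hp
  -- The three choices give the pairs (u_t, u_y) = (0, 0), (1, 0) and (0, 1).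
  obtain ⟨α₀, π₀, χ₀, a0, b0, c0, d0⟩ := hΦ.jet_relations hp q 0 0 hD hD0
  obtain ⟨α₁, π₁, χ₁, a1, b1, c1, d1⟩ := hΦ.jet_relations hp q 1 0 hD hD0
  obtain ⟨α₂, π₂, χ₂, a2, b2, c2, d2⟩ := hΦ.jet_relations hp q p.1.2.1 1 hD hD0
  have e1 : π₁ = π₀ := mul_right_cancel₀ hD0 (a1.trans a0.symm)
  have e2 : π₂ = π₀ := mul_right_cancel₀ hD0 (a2.trans a0.symm)
  subst e1 e2
  set κ := pd (0, 1) (uComp Φ) p - π₂ * pd (0, 1) (xComp Φ) p with hκ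
  have hκ0 : κ ≠ 0 := by
    intro h
    apply hΔ
    have : D * κ = 0 := by rw [h, mul_zero]
    rw [hκ] at this
    rw [hD] at this a0
    linear_combination this + pd (0, 1) (xComp Φ) p * a0
  set m := pd (et, 0) (tComp Φ) p + p.1.2.1 * pd (ey, 0) (tComp Φ) p - D ^ 2 with hm
  set n := pd (et, 0) (yComp Φ) p + p.1.2.1 * pd (ey, 0) (yComp Φ) p - xComp Φ p * D ^ 2 with hn
  have f1 : (α₁ - α₀) * pd (et, 0) (tComp Φ) p + (χ₁ - χ₀) * pd (et, 0) (yComp Φ) p = κ := by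
    rw [hκ]; linear_combination b1 - b0
  have f2 : (α₁ - α₀) * pd (ey, 0) (tComp Φ) p + (χ₁ - χ₀) * pd (ey, 0) (yComp Φ) p = 0 := by
    linear_combination c1 - c0
  have f3 : (α₂ - α₀) * pd (et, 0) (tComp Φ) p + (χ₂ - χ₀) * pd (et, 0) (yComp Φ) p = 0 := by
    linear_combination b2 - b0
  have f4 : (α₂ - α₀) * pd (ey, 0) (tComp Φ) p + (χ₂ - χ₀) * pd (ey, 0) (yComp Φ) p = κ := by
    rw [hκ]; linear_combination c2 - c0
  have f5 : (α₁ - α₀) * m + (χ₁ - χ₀) * n = 0 := by linear_combination d1 - d0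
  have f6 : (α₂ - α₀) * m + (χ₂ - χ₀) * n = 0 := by linear_combination d2 - d0
  have hdet : (α₁ - α₀) * (χ₂ - χ₀) - (α₂ - α₀) * (χ₁ - χ₀) ≠ 0 := by
    intro h
    have : κ ^ 2 = 0 := by
      linear_combination (-κ) * f1 - ((α₁ - α₀) * pd (et, 0) (tComp Φ) p
        + (χ₁ - χ₀) * pd (et, 0) (yComp Φ) p) * f4 + ((α₂ - α₀) * pd (et, 0) (tComp Φ) p
        + (χ₂ - χ₀) * pd (et, 0) (yComp Φ) p) * f2 +
        (pd (et, 0) (tComp Φ) p * pd (ey, 0) (yComp Φ) p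
          - pd (ey, 0) (tComp Φ) p * pd (et, 0) (yComp Φ) p) * h
    exact hκ0 (pow_eq_zero_iff two_ne_zero |>.1 this)
  have hm0 : m = 0 := by
    refine (mul_eq_zero.1 (?_ : _ * m = 0)).resolve_left hdet
    linear_combination (χ₂ - χ₀) * f5 - (χ₁ - χ₀) * f6
  have hn0 : n = 0 := by
    refine (mul_eq_zero.1 (?_ : _ * n = 0)).resolve_left hdet
    linear_combination (α₁ - α₀) * f6 - (α₂ - α₀) * f5
  exact ⟨sub_eq_zero.1 hm0, sub_eq_zero.1 hn0⟩

/-- The `x` component of a point symmetry does not depend on `u`. -/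
theorem IsPointSymmetry.x_indep (hΦ : IsPointSymmetry Φ) {p : Total} (hp : p ∈ Φ.source) :
    pd (0, 1) (xComp Φ) p = 0 := by
  by_contra h
  -- If X depended on u, the slope could be tuned to make the total x-derivative equal to 1 or to 2.
  -- Its square, however, does not depend on the slope.
  have h1 := (hΦ.t_y_relations hp ((1 - pd (ex, 0) (xComp Φ) p) / pd (0, 1) (xComp Φ) p) (D := 1)
    (by rw [div_mul_cancel₀ _ h]; ring) one_ne_zero).1
  have h2 := (hΦ.t_y_relations hp ((2 - pd (ex, 0) (xComp Φ) p) / pd (0, 1) (xComp Φ) p) (D := 2)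
    (by rw [div_mul_cancel₀ _ h]; ring) two_ne_zero).1
  rw [h1] at h2
  norm_num at h2

/-- The determining equations for point symmetries. -/
structure DeterminingEquations (Φ : OpenPartialHomeomorph Total Total) (p : Total) : Prop where
  t_x : pd (ex, 0) (tComp Φ) p = 0
  t_u : pd (0, 1) (tComp Φ) p = 0
  y_x : pd (ex, 0) (yComp Φ) p = 0
  y_u : pd (0, 1) (yComp Φ) p = 0
  x_u : pd (0, 1) (xComp Φ) p = 0
  x_x_ne : pd (ex, 0) (xComp Φ) p ≠ 0
  u_u_ne : pd (0, 1) (uComp Φ) p ≠ 0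
  t_eq : pd (et, 0) (tComp Φ) p + p.1.2.1 * pd (ey, 0) (tComp Φ) p = pd (ex, 0) (xComp Φ) p ^ 2
  y_eq : pd (et, 0) (yComp Φ) p + p.1.2.1 * pd (ey, 0) (yComp Φ) p
    = xComp Φ p * pd (ex, 0) (xComp Φ) p ^ 2
  u_uu : pd (0, 1) (pd (0, 1) (uComp Φ)) p = 0
  u_xu : pd (0, 1) (uComp Φ) p * (pd (et, 0) (xComp Φ) p + p.1.2.1 * pd (ey, 0) (xComp Φ) p
      - pd (ex, 0) (pd (ex, 0) (xComp Φ)) p)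
    = -2 * pd (ex, 0) (pd (0, 1) (uComp Φ)) p * pd (ex, 0) (xComp Φ) p
  u_x : pd (ex, 0) (uComp Φ) p * (pd (et, 0) (xComp Φ) p + p.1.2.1 * pd (ey, 0) (xComp Φ) p
      - pd (ex, 0) (pd (ex, 0) (xComp Φ)) p)
    = pd (ex, 0) (xComp Φ) p * (pd (et, 0) (uComp Φ) p + p.1.2.1 * pd (ey, 0) (uComp Φ) p
      - pd (ex, 0) (pd (ex, 0) (uComp Φ)) p)

/-- Once X is independent of u, the remaining relation is polynomial of degree two in the slope `q`.
Its values at 0, 1 and −1 separate the coefficients. -/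
theorem IsPointSymmetry.determiningEquations (hΦ : IsPointSymmetry Φ) {p : Total}
    (hp : p ∈ Φ.source) : DeterminingEquations Φ p := by
  obtain ⟨tx, tu, yx, yu⟩ := hΦ.t_y_indep hp
  have xu := hΦ.x_indep hp
  obtain ⟨-, hΔ⟩ := hΦ.det_ne_zero hp
  rw [xu, zero_mul, sub_zero] at hΔ
  have hx : pd (ex, 0) (xComp Φ) p ≠ 0 := left_ne_zero_of_mul hΔ
  have hD : ∀ q : ℝ, pd (ex, 0) (xComp Φ) p
      = pd (ex, 0) (xComp Φ) p + q * pd (0, 1) (xComp Φ) p := fun q => by rw [xu]; ring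
  obtain ⟨t_eq, y_eq⟩ := hΦ.t_y_relations hp 0 (hD 0) hx
  have xxu : ∀ v, pd v (pd (0, 1) (xComp Φ)) p = 0 := fun v =>
    pd_zero_on Φ.open_source (fun q hq => hΦ.x_indep hq) v hp
  have key : ∀ q : ℝ, (pd (ex, 0) (uComp Φ) p + q * pd (0, 1) (uComp Φ) p) *
      (pd (et, 0) (xComp Φ) p + p.1.2.1 * pd (ey, 0) (xComp Φ) p
      - pd (ex, 0) (pd (ex, 0) (xComp Φ)) p) = pd (ex, 0) (xComp Φ) p *
      (pd (et, 0) (uComp Φ) p + p.1.2.1 * pd (ey, 0) (uComp Φ) p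
          - pd (ex, 0) (pd (ex, 0) (uComp Φ)) p - 2 * q * pd (ex, 0) (pd (0, 1) (uComp Φ)) p
          - q ^ 2 * pd (0, 1) (pd (0, 1) (uComp Φ)) p) := by
    intro q
    obtain ⟨α, π, χ, h1, -, -, h4⟩ := hΦ.jet_relations hp q 0 0 (hD q) hx
    rw [t_eq, y_eq, xxu, xxu] at h4
    linear_combination (-(pd (et, 0) (xComp Φ) p + p.1.2.1 * pd (ey, 0) (xComp Φ) p
      - pd (ex, 0) (pd (ex, 0) (xComp Φ)) p)) * h1 + pd (ex, 0) (xComp Φ) p * h4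
  have k0 := key 0
  have k1 := key 1
  have k2 := key (-1)
  refine ⟨tx, tu, yx, yu, xu, hx, right_ne_zero_of_mul hΔ, t_eq, y_eq, ?_, ?_, ?_⟩
  · refine (mul_eq_zero.1 (?_ : pd (ex, 0) (xComp Φ) p * _ = 0)).resolve_left hx
    linear_combination k1 / 2 + k2 / 2 - k0
  · linear_combination k1 / 2 - k2 / 2
  · linear_combination k0

theorem pd_t_coord (v p : Total) : pd v (fun q : Total => q.1.1) p = v.1.1 :=
  pd_clm v ((ContinuousLinearMap.fst ℝ ℝ (ℝ × ℝ)).comp (ContinuousLinearMap.fst ℝ Base ℝ)) p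

theorem pd_x_coord (v p : Total) : pd v (fun q : Total => q.1.2.1) p = v.1.2.1 :=
  pd_clm v (((ContinuousLinearMap.fst ℝ ℝ ℝ).comp (ContinuousLinearMap.snd ℝ ℝ (ℝ × ℝ))).comp
    (ContinuousLinearMap.fst ℝ Base ℝ)) p

theorem differentiableAt_x_coord (p : Total) : DifferentiableAt ℝ (fun q : Total => q.1.2.1) p := by
  fun_prop

/-- The derivative of `∂_t F + x ∂_y G`. -/
theorem pd_transport {F G : Total → ℝ} {p : Total} (hF : DifferentiableAt ℝ F p)
    (hG : DifferentiableAt ℝ G p) (v : Total) :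
    pd v (fun q => F q + q.1.2.1 * G q) p = pd v F p + (v.1.2.1 * G p + p.1.2.1 * pd v G p) := by
  rw [pd_add hF ((differentiableAt_x_coord p).fun_mul hG), pd_mul (differentiableAt_x_coord p) hG,
    pd_x_coord]

theorem pd_pow2 {F : Total → ℝ} {p : Total} (hF : DifferentiableAt ℝ F p) (v : Total) :
    pd v (fun q => F q ^ 2) p = 2 * F p * pd v F p := by
  rw [pd_comp_deriv (g := fun s => s ^ 2) (hasDerivAt_pow 2 (F p)) hF]; simp

theorem pd_pow3 {F : Total → ℝ} {p : Total} (hF : DifferentiableAt ℝ F p) (v : Total) :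
    pd v (fun q => F q ^ 3) p = 3 * F p ^ 2 * pd v F p := by
  rw [pd_comp_deriv (g := fun s => s ^ 3) (hasDerivAt_pow 3 (F p)) hF]; simp

end Kolmogorov

/-! ### Integrability conditions for the x and u scales -/

namespace Kolmogorov

/-- The derivative of the `x` component with respect to `x`. -/
noncomputable abbrev xScale (Φ : OpenPartialHomeomorph Total Total) : Total → ℝ :=
  pd (ex, 0) (xComp Φ)

/-- The derivative of the `u` component with respect to `u`. -/
noncomputable abbrev uScale (Φ : OpenPartialHomeomorph Total Total) : Total → ℝ :=
  pd (0, 1) (uComp Φ)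

/-- The derivative of the `x` component along `∂_t + x ∂_y`. -/
noncomputable def xDrift (Φ : OpenPartialHomeomorph Total Total) (q : Total) : ℝ :=
  pd (et, 0) (xComp Φ) q + q.1.2.1 * pd (ey, 0) (xComp Φ) q

/-- Minus the logarithmic derivative of the `u` scale with respect to `x`. -/
noncomputable def uDrift (Φ : OpenPartialHomeomorph Total Total) (q : Total) : ℝ :=
  xDrift Φ q / (2 * xScale Φ q)

variable {Φ : OpenPartialHomeomorph Total Total}

theorem pd_comm_zero {F : Total → ℝ} {O : Set Total} (hO : IsOpen O)
    (hF : ∀ q ∈ O, ContDiffAt ℝ ∞ F q) {w : Total} (h : ∀ q ∈ O, pd w F q = 0) (v : Total)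
    {p : Total} (hp : p ∈ O) : pd w (pd v F) p = 0 := by
  rw [pd_comm (hF p hp), pd_zero_on hO h v hp]

/-- With D = X_x, differentiating the equations for T and Y in x gives T_y = 2 D D_x and Y_y = D³ +
X T_y. Another x-derivative of the latter gives 0 = 3D² D_x + D T_y = 5D² D_x. -/
theorem IsPointSymmetry.scale_x (hΦ : IsPointSymmetry Φ) {p : Total}
    (hp : p ∈ Φ.source) :
    pd (ex, 0) (xScale Φ) p = 0 ∧ pd (ey, 0) (tComp Φ) p = 0 ∧
      pd (ey, 0) (yComp Φ) p = xScale Φ p ^ 3 ∧ pd (et, 0) (tComp Φ) p = xScale Φ p ^ 2 := by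
  have hO := Φ.open_source
  have det := fun q hq => hΦ.determiningEquations (p := q) hq
  have cT := fun q hq => (hΦ.comp_contDiffAt (p := q) hq).1
  have cX := fun q hq => (hΦ.comp_contDiffAt (p := q) hq).2.1
  have cY := fun q hq => (hΦ.comp_contDiffAt (p := q) hq).2.2.1
  have cD : ∀ q ∈ Φ.source, ContDiffAt ℝ ∞ (xScale Φ) q := fun q hq => (cX q hq).pd _
  have h1 : ∀ q ∈ Φ.source, pd (ey, 0) (tComp Φ) q = 2 * xScale Φ q * pd (ex, 0) (xScale Φ) q := by
    intro q hq
    have := pd_congr_on hO (fun q hq => (det q hq).t_eq) (ex, 0) hq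
    rw [pd_transport ((cT q hq).pd _).diff ((cT q hq).pd _).diff, pd_pow2 (cD q hq).diff,
      pd_comm_zero hO cT (fun q hq => (det q hq).t_x) _ hq,
      pd_comm_zero hO cT (fun q hq => (det q hq).t_x) _ hq] at this
    linear_combination this
  have h2 : ∀ q ∈ Φ.source, pd (ey, 0) (yComp Φ) q
      = xScale Φ q ^ 3 + xComp Φ q * pd (ey, 0) (tComp Φ) q := by
    intro q hq
    have := pd_congr_on hO (fun q hq => (det q hq).y_eq) (ex, 0) hq
    rw [pd_transport ((cY q hq).pd _).diff ((cY q hq).pd _).diff,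
      pd_mul (cX q hq).diff ((cD q hq).pow 2).diff, pd_pow2 (cD q hq).diff,
      pd_comm_zero hO cY (fun q hq => (det q hq).y_x) _ hq,
      pd_comm_zero hO cY (fun q hq => (det q hq).y_x) _ hq] at this
    linear_combination this - xComp Φ q * h1 q hq
  have h3 : 0 = 3 * xScale Φ p ^ 2 * pd (ex, 0) (xScale Φ) p
      + xScale Φ p * pd (ey, 0) (tComp Φ) p := by
    have := pd_congr_on hO h2 (ex, 0) hp
    rw [pd_comm_zero hO cY (fun q hq => (det q hq).y_x) _ hp,
      pd_add ((cD p hp).pow 3).diff ((cX p hp).mul ((cT p hp).pd _)).diff, pd_pow3 (cD p hp).diff,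
      pd_mul (cX p hp).diff ((cT p hp).pd _).diff,
      pd_comm_zero hO cT (fun q hq => (det q hq).t_x) _ hp] at this
    linear_combination this
  have hD0 : xScale Φ p ≠ 0 := (det p hp).x_x_ne
  have hDx : pd (ex, 0) (xScale Φ) p = 0 := by
    refine (mul_eq_zero.1 (?_ : xScale Φ p ^ 2 * _ = 0)).resolve_left (pow_ne_zero 2 hD0)
    rw [h1 p hp] at h3
    linear_combination (-1 / 5 : ℝ) * h3
  have hTy : pd (ey, 0) (tComp Φ) p = 0 := by rw [h1 p hp, hDx, mul_zero]
  refine ⟨hDx, hTy, ?_, ?_⟩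
  · rw [h2 p hp, hTy]; ring
  · have := (det p hp).t_eq
    rw [hTy] at this
    linear_combination this

/-- The scale of `x` depends on `t` only. -/
theorem IsPointSymmetry.scale_y_u (hΦ : IsPointSymmetry Φ) {p : Total}
    (hp : p ∈ Φ.source) :
    pd (ey, 0) (xScale Φ) p = 0 ∧ pd (0, 1) (xScale Φ) p = 0 := by
  have hO := Φ.open_source
  have det := fun q hq => hΦ.determiningEquations (p := q) hq
  have cT := fun q hq => (hΦ.comp_contDiffAt (p := q) hq).1
  have cX := fun q hq => (hΦ.comp_contDiffAt (p := q) hq).2.1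
  constructor
  · have := pd_congr_on hO (fun q hq => (hΦ.scale_x (p := q) hq).2.2.2) (ey, 0) hp
    rw [pd_pow2 ((cX p hp).pd _).diff,
      pd_comm_zero hO cT (fun q hq => (hΦ.scale_x (p := q) hq).2.1) _ hp] at this
    exact (mul_eq_zero.1 this.symm).resolve_left (mul_ne_zero two_ne_zero (det p hp).x_x_ne)
  · exact pd_comm_zero hO cX (fun q hq => (det q hq).x_u) _ hp

/-- The second relation is the equality of the mixed derivatives Y_ty and Y_yt, divided by D². -/
theorem IsPointSymmetry.x_y_eq (hΦ : IsPointSymmetry Φ) {p : Total}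
    (hp : p ∈ Φ.source) :
    pd (et, 0) (yComp Φ) p = (xComp Φ p - p.1.2.1 * xScale Φ p) * xScale Φ p ^ 2 ∧
      pd (ey, 0) (xComp Φ) p = 3 * pd (et, 0) (xScale Φ) p := by
  have hO := Φ.open_source
  have det := fun q hq => hΦ.determiningEquations (p := q) hq
  have cX := fun q hq => (hΦ.comp_contDiffAt (p := q) hq).2.1
  have cY := fun q hq => (hΦ.comp_contDiffAt (p := q) hq).2.2.1
  have h1 : ∀ q ∈ Φ.source, pd (et, 0) (yComp Φ) q
      = (xComp Φ q - q.1.2.1 * xScale Φ q) * xScale Φ q ^ 2 := by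
    intro q hq
    have := (det q hq).y_eq
    rw [(hΦ.scale_x hq).2.2.1] at this
    linear_combination this
  refine ⟨h1 p hp, ?_⟩
  have hD0 : xScale Φ p ≠ 0 := (det p hp).x_x_ne
  have cD : ContDiffAt ℝ ∞ (xScale Φ) p := (cX p hp).pd _
  have := pd_congr_on hO h1 (ey, 0) hp
  rw [pd_comm (cY p hp), pd_congr_on hO (fun q hq => (hΦ.scale_x (p := q) hq).2.2.1) (et, 0) hp,
    pd_pow3 cD.diff, pd_mul ((cX p hp).diff.fun_sub ((differentiableAt_x_coord p).fun_mul cD.diff))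
      (cD.pow 2).diff, pd_sub (cX p hp).diff ((differentiableAt_x_coord p).fun_mul cD.diff),
    pd_mul (differentiableAt_x_coord p) cD.diff, pd_x_coord, pd_pow2 cD.diff,
    (hΦ.scale_y_u hp).1] at this
  refine mul_left_cancel₀ (pow_ne_zero 2 hD0) ?_
  dsimp only at this
  linear_combination -this

theorem IsPointSymmetry.contDiffAt_xDrift (hΦ : IsPointSymmetry Φ) {p : Total}
    (hp : p ∈ Φ.source) :
    ContDiffAt ℝ ∞ (xDrift Φ) p := by
  have cX := (hΦ.comp_contDiffAt hp).2.1
  have : ContDiffAt ℝ ∞ (fun q : Total => q.1.2.1) p := by fun_prop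
  exact (cX.pd _).add (this.mul (cX.pd _))

theorem IsPointSymmetry.contDiffAt_uDrift (hΦ : IsPointSymmetry Φ) {p : Total}
    (hp : p ∈ Φ.source) :
    ContDiffAt ℝ ∞ (uDrift Φ) p :=
  (hΦ.contDiffAt_xDrift hp).div (contDiffAt_const.mul ((hΦ.comp_contDiffAt hp).2.1.pd _))
    (mul_ne_zero two_ne_zero (hΦ.determiningEquations hp).x_x_ne)

/-- Differentiate 2 D m = X_t + x X_y for the drift m, using X_x = D, X_y = 3 D_t and the
independence of D from x, y, u. In x the right side gives D_t + 3D_t. -/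
theorem IsPointSymmetry.uDrift_derivatives (hΦ : IsPointSymmetry Φ) {p : Total}
    (hp : p ∈ Φ.source) :
    xScale Φ p * pd (ex, 0) (uDrift Φ) p = 2 * pd (et, 0) (xScale Φ) p ∧
    2 * xScale Φ p * pd (ey, 0) (uDrift Φ) p = 3 * pd (et, 0) (pd (et, 0) (xScale Φ)) p ∧
    pd (0, 1) (uDrift Φ) p = 0 := by
  have hO := Φ.open_source
  have det := fun q hq => hΦ.determiningEquations (p := q) hq
  have cX := fun q hq => (hΦ.comp_contDiffAt (p := q) hq).2.1
  have cD : ∀ q ∈ Φ.source, ContDiffAt ℝ ∞ (xScale Φ) q := fun q hq => (cX q hq).pd _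
  have cm := hΦ.contDiffAt_uDrift hp
  have rel : ∀ q ∈ Φ.source, 2 * (xScale Φ q * uDrift Φ q)
      = pd (et, 0) (xComp Φ) q + q.1.2.1 * pd (ey, 0) (xComp Φ) q := by
    intro q hq
    have := (det q hq).x_x_ne
    rw [uDrift, xDrift]
    field_simp
  have hd : ∀ v, pd v (xScale Φ) p = 0 → 2 * (xScale Φ p * pd v (uDrift Φ) p)
      = pd v (pd (et, 0) (xComp Φ)) p + (v.1.2.1 * pd (ey, 0) (xComp Φ) p
        + p.1.2.1 * pd v (pd (ey, 0) (xComp Φ)) p) := by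
    intro v hv
    have := pd_congr_on hO rel v hp
    rw [pd_transport ((cX p hp).pd _).diff ((cX p hp).pd _).diff,
      pd_mul (differentiableAt_const _) ((cD p hp).mul cm).diff, pd_const,
      pd_mul (cD p hp).diff cm.diff, hv] at this
    rw [← this]; ring
  have hD0 := (det p hp).x_x_ne
  obtain ⟨Dx, -, -, -⟩ := hΦ.scale_x hp
  obtain ⟨Dy, Du⟩ := hΦ.scale_y_u hp
  refine ⟨?_, ?_, ?_⟩
  · have := hd (ex, 0) Dx
    rw [pd_comm (cX p hp) (ex, 0) (et, 0), pd_comm (cX p hp) (ex, 0) (ey, 0), Dy,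
      (hΦ.x_y_eq hp).2] at this
    linear_combination this / 2
  · have := hd (ey, 0) Dy
    have h2 : ∀ v, pd v (pd (ey, 0) (xComp Φ)) p = 3 * pd v (pd (et, 0) (xScale Φ)) p :=
      fun v => by
        rw [pd_congr_on hO (fun q hq => (hΦ.x_y_eq (p := q) hq).2) v hp,
          pd_mul (differentiableAt_const _) ((cD p hp).pd _).diff, pd_const]
        ring
    rw [pd_comm (cX p hp) (ey, 0) (et, 0), h2, h2,
      pd_comm_zero hO cD (fun q hq => (hΦ.scale_y_u (p := q) hq).1) _ hp] at this
    linear_combination this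
  · have := hd (0, 1) Du
    rw [pd_comm_zero hO cX (fun q hq => (det q hq).x_u) _ hp,
      pd_comm_zero hO cX (fun q hq => (det q hq).x_u) _ hp] at this
    refine (mul_eq_zero.1 (?_ : xScale Φ p * _ = 0)).resolve_left hD0
    simp only [Prod.fst_zero, Prod.snd_zero] at this
    linear_combination this / 2

/-- The equations for the scale of `u`. -/
theorem IsPointSymmetry.uScale_equations (hΦ : IsPointSymmetry Φ) {p : Total}
    (hp : p ∈ Φ.source) :
    pd (ex, 0) (uScale Φ) p = -(uDrift Φ p * uScale Φ p) ∧
    pd (et, 0) (uScale Φ) p + p.1.2.1 * pd (ey, 0) (uScale Φ) p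
      = -((pd (ex, 0) (uDrift Φ) p + uDrift Φ p ^ 2) * uScale Φ p) := by
  have hO := Φ.open_source
  have det := fun q hq => hΦ.determiningEquations (p := q) hq
  have cX := fun q hq => (hΦ.comp_contDiffAt (p := q) hq).2.1
  have cU := fun q hq => (hΦ.comp_contDiffAt (p := q) hq).2.2.2
  have cA : ContDiffAt ℝ ∞ (uScale Φ) p := (cU p hp).pd _
  have cm := hΦ.contDiffAt_uDrift hp
  have hD0 : xScale Φ p ≠ 0 := (det p hp).x_x_ne
  have cD : ContDiffAt ℝ ∞ (xScale Φ) p := (cX p hp).pd _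
  have rel : ∀ q ∈ Φ.source, pd (et, 0) (xComp Φ) q + q.1.2.1 * pd (ey, 0) (xComp Φ) q
      - pd (ex, 0) (pd (ex, 0) (xComp Φ)) q = 2 * (xScale Φ q * uDrift Φ q) := by
    intro q hq
    have := (det q hq).x_x_ne
    rw [(hΦ.scale_x hq).1, uDrift, xDrift]
    field_simp
    ring
  have h1 : ∀ q ∈ Φ.source, pd (ex, 0) (uScale Φ) q = -(uDrift Φ q * uScale Φ q) := by
    intro q hq
    have := (det q hq).u_xu
    rw [rel q hq] at this
    refine mul_left_cancel₀ (det q hq).x_x_ne ?_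
    linear_combination this / 2
  refine ⟨h1 p hp, ?_⟩
  have h2 : ∀ q ∈ Φ.source, pd (ex, 0) (uComp Φ) q * (2 * (xScale Φ q * uDrift Φ q))
      = xScale Φ q * ((pd (et, 0) (uComp Φ) q + q.1.2.1 * pd (ey, 0) (uComp Φ) q)
      - pd (ex, 0) (pd (ex, 0) (uComp Φ)) q) := by
    intro q hq
    rw [← rel q hq]; exact (det q hq).u_x
  -- Differentiation in u turns the relation for U into one for its u-derivative, the scale.
  have h3 := pd_congr_on hO h2 (0, 1) hp
  have hx : ContDiffAt ℝ ∞ (fun q : Total => q.1.2.1) p := by fun_prop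
  have c1 : ContDiffAt ℝ ∞
      (fun q => pd (et, 0) (uComp Φ) q + q.1.2.1 * pd (ey, 0) (uComp Φ) q) p :=
    ((cU p hp).pd _).add (hx.mul ((cU p hp).pd _))
  rw [pd_mul ((cU p hp).pd _).diff (contDiffAt_const.mul (cD.mul cm)).diff,
    pd_mul (differentiableAt_const _) (cD.mul cm).diff, pd_mul cD.diff cm.diff,
    pd_mul cD.diff (c1.sub (((cU p hp).pd _).pd _)).diff,
    pd_sub c1.diff (((cU p hp).pd _).pd _).diff,
    pd_transport ((cU p hp).pd _).diff ((cU p hp).pd _).diff, pd_const,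
    (hΦ.scale_y_u hp).2, (hΦ.uDrift_derivatives hp).2.2, pd_comm (cU p hp) (0, 1) (et, 0),
    pd_comm (cU p hp) (0, 1) (ey, 0), pd_comm (cU p hp) (0, 1) (ex, 0),
    pd_comm ((cU p hp).pd (ex, 0)) (0, 1) (ex, 0),
    pd_congr_on hO (fun q hq => pd_comm (cU q hq) (0, 1) (ex, 0)) (ex, 0) hp, h1 p hp] at h3
  have h4 := pd_congr_on hO h1 (ex, 0) hp
  rw [show (fun q => -(uDrift Φ q * uScale Φ q)) = fun q => (-1) * (uDrift Φ q * uScale Φ q) from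
    funext fun q => by ring, pd_mul (differentiableAt_const _) (cm.mul cA).diff, pd_const,
    pd_mul cm.diff cA.diff, h1 p hp] at h4
  refine mul_left_cancel₀ hD0 ?_
  rw [h4] at h3
  simp only [Prod.fst_zero, Prod.snd_zero] at h3
  linear_combination -h3

end Kolmogorov

/-! ### The scale equation and the Möbius form of the t component -/

namespace Kolmogorov

variable {Φ : OpenPartialHomeomorph Total Total}

/-- The logarithmic derivative of the `u` scale with respect to `y`. -/
noncomputable def uSlope (Φ : OpenPartialHomeomorph Total Total) (q : Total) : ℝ :=
  pd (et, 0) (uDrift Φ) q + q.1.2.1 * pd (ey, 0) (uDrift Φ) q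
    - 2 * (uDrift Φ q * pd (ex, 0) (uDrift Φ) q)

theorem IsPointSymmetry.uDrift_xx (hΦ : IsPointSymmetry Φ) {p : Total}
    (hp : p ∈ Φ.source) :
    pd (ex, 0) (pd (ex, 0) (uDrift Φ)) p = 0 ∧ pd (ex, 0) (pd (ey, 0) (uDrift Φ)) p = 0 := by
  have hO := Φ.open_source
  have cD : ∀ q ∈ Φ.source, ContDiffAt ℝ ∞ (xScale Φ) q := fun q hq =>
    (hΦ.comp_contDiffAt hq).2.1.pd _
  have cm := hΦ.contDiffAt_uDrift hp
  have hD0 : xScale Φ p ≠ 0 := (hΦ.determiningEquations hp).x_x_ne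
  have Dtx : ∀ q ∈ Φ.source, pd (ex, 0) (pd (et, 0) (xScale Φ)) q = 0 := fun q hq =>
    pd_comm_zero hO cD (fun q hq => (hΦ.scale_x (p := q) hq).1) _ hq
  have Dttx : pd (ex, 0) (pd (et, 0) (pd (et, 0) (xScale Φ))) p = 0 :=
    pd_comm_zero hO (fun q hq => (cD q hq).pd _) Dtx _ hp
  constructor
  · have := pd_congr_on hO (fun q hq => (hΦ.uDrift_derivatives (p := q) hq).1) (ex, 0) hp
    rw [pd_mul (cD p hp).diff (cm.pd _).diff, (hΦ.scale_x hp).1, zero_mul, zero_add,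
      pd_mul (differentiableAt_const _) ((cD p hp).pd _).diff, pd_const, Dtx p hp, mul_zero,
      zero_mul, zero_add] at this
    exact (mul_eq_zero.1 this).resolve_left hD0
  · have := pd_congr_on hO (fun q hq => (hΦ.uDrift_derivatives (p := q) hq).2.1) (ex, 0) hp
    rw [pd_mul (contDiffAt_const.mul (cD p hp)).diff (cm.pd _).diff,
      pd_mul (differentiableAt_const _) (cD p hp).diff, pd_const, (hΦ.scale_x hp).1,
      pd_mul (differentiableAt_const _) (((cD p hp).pd _).pd _).diff, pd_const, Dttx] at this
    refine (mul_eq_zero.1 (?_ : xScale Φ p * _ = 0)).resolve_left hD0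
    linear_combination this / 2

/-- The y-derivative is obtained from the commutator of ∂_x with ∂_t + x ∂_y, which is ∂_y, applied
to the scale. -/
theorem IsPointSymmetry.uScale_y (hΦ : IsPointSymmetry Φ) {p : Total}
    (hp : p ∈ Φ.source) :
    pd (ey, 0) (uScale Φ) p = uSlope Φ p * uScale Φ p := by
  have hO := Φ.open_source
  have cA : ContDiffAt ℝ ∞ (uScale Φ) p := (hΦ.comp_contDiffAt hp).2.2.2.pd _
  have cm := hΦ.contDiffAt_uDrift hp
  have h1 := fun q hq => hΦ.uScale_equations (p := q) hq
  have h2 : ∀ v, pd v (pd (ex, 0) (uScale Φ)) p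
      = -(pd v (uDrift Φ) p * uScale Φ p + uDrift Φ p * pd v (uScale Φ) p) := by
    intro v
    rw [pd_congr_on hO (fun q hq => (h1 q hq).1) v hp,
      show (fun q => -(uDrift Φ q * uScale Φ q)) = fun q => (-1) * (uDrift Φ q * uScale Φ q) from
      funext fun q => by ring, pd_mul (differentiableAt_const _) (cm.mul cA).diff, pd_const,
      pd_mul cm.diff cA.diff]
    ring
  have h3 := pd_congr_on hO (fun q hq => (h1 q hq).2) (ex, 0) hp
  rw [pd_transport (cA.pd _).diff (cA.pd _).diff, pd_comm cA (ex, 0) (et, 0),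
    pd_comm cA (ex, 0) (ey, 0), h2, h2,
    show (fun q => -((pd (ex, 0) (uDrift Φ) q + uDrift Φ q ^ 2) * uScale Φ q)) = fun q =>
      (-1) * ((pd (ex, 0) (uDrift Φ) q + uDrift Φ q ^ 2) * uScale Φ q) from
      funext fun q => by ring,
    pd_mul (differentiableAt_const _) (((cm.pd _).add (cm.pow 2)).mul cA).diff, pd_const,
    pd_mul ((cm.pd _).add (cm.pow 2)).diff cA.diff, pd_add (cm.pd _).diff (cm.pow 2).diff,
    pd_pow2 cm.diff, (hΦ.uDrift_xx hp).1, (h1 p hp).1] at h3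
  rw [uSlope]
  dsimp only at h3
  linear_combination h3 + uDrift Φ p * (h1 p hp).2

/-- The reciprocal of the scale of `x` is an affine function of `t`. -/
theorem IsPointSymmetry.scale_ode (hΦ : IsPointSymmetry Φ) {p : Total}
    (hp : p ∈ Φ.source) :
    xScale Φ p * pd (et, 0) (pd (et, 0) (xScale Φ)) p = 2 * pd (et, 0) (xScale Φ) p ^ 2 := by
  have hO := Φ.open_source
  have cA : ContDiffAt ℝ ∞ (uScale Φ) p := (hΦ.comp_contDiffAt hp).2.2.2.pd _
  have cD : ContDiffAt ℝ ∞ (xScale Φ) p := (hΦ.comp_contDiffAt hp).2.1.pd _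
  have cm := hΦ.contDiffAt_uDrift hp
  have hx : ContDiffAt ℝ ∞ (fun q : Total => q.1.2.1) p := by fun_prop
  have c1 : ContDiffAt ℝ ∞
      (fun q => pd (et, 0) (uDrift Φ) q + q.1.2.1 * pd (ey, 0) (uDrift Φ) q) p :=
    (cm.pd _).add (hx.mul (cm.pd _))
  have c2 : ContDiffAt ℝ ∞ (fun q => 2 * (uDrift Φ q * pd (ex, 0) (uDrift Φ) q)) p :=
    contDiffAt_const.mul (cm.mul (cm.pd _))
  have cn : ContDiffAt ℝ ∞ (uSlope Φ) p := c1.sub c2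
  have hA0 : uScale Φ p ≠ 0 := (hΦ.determiningEquations hp).u_u_ne
  have hD0 : xScale Φ p ≠ 0 := (hΦ.determiningEquations hp).x_x_ne
  -- All logarithmic derivatives of the scale are now known. Equality of its mixed xy-derivatives
  -- gives n_x = −m_y for the slope n and drift m, that is m_tx + 2m_y = 2m_x². Inserting D m_x =
  -- 2D_t and 2D m_y = 3D_tt yields the equation for D.
  have e1 : pd (ey, 0) (pd (ex, 0) (uScale Φ)) p
      = -(pd (ey, 0) (uDrift Φ) p * uScale Φ p + uDrift Φ p * pd (ey, 0) (uScale Φ) p) := by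
    rw [pd_congr_on hO (fun q hq => (hΦ.uScale_equations (p := q) hq).1) _ hp,
      show (fun q => -(uDrift Φ q * uScale Φ q)) = fun q => (-1) * (uDrift Φ q * uScale Φ q) from
      funext fun q => by ring, pd_mul (differentiableAt_const _) (cm.mul cA).diff, pd_const,
      pd_mul cm.diff cA.diff]
    ring
  have e2 : pd (ex, 0) (pd (ey, 0) (uScale Φ)) p
      = pd (ex, 0) (uSlope Φ) p * uScale Φ p + uSlope Φ p * pd (ex, 0) (uScale Φ) p := by
    rw [pd_congr_on hO (fun q hq => hΦ.uScale_y (p := q) hq) _ hp, pd_mul cn.diff cA.diff]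
  rw [pd_comm cA, e2, hΦ.uScale_y hp, (hΦ.uScale_equations hp).1] at e1
  have hn : pd (ex, 0) (uSlope Φ) p = -pd (ey, 0) (uDrift Φ) p := by
    refine mul_right_cancel₀ hA0 ?_
    linear_combination e1
  have hn' : pd (ex, 0) (uSlope Φ) p = pd (et, 0) (pd (ex, 0) (uDrift Φ)) p
      + pd (ey, 0) (uDrift Φ) p - 2 * pd (ex, 0) (uDrift Φ) p ^ 2 := by
    change pd (ex, 0) (fun q => pd (et, 0) (uDrift Φ) q + q.1.2.1 * pd (ey, 0) (uDrift Φ) q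
      - 2 * (uDrift Φ q * pd (ex, 0) (uDrift Φ) q)) p = _
    rw [pd_sub c1.diff c2.diff, pd_transport (cm.pd _).diff (cm.pd _).diff,
      pd_mul (differentiableAt_const _) (cm.mul (cm.pd _)).diff, pd_const,
      pd_mul cm.diff (cm.pd _).diff, (hΦ.uDrift_xx hp).1, (hΦ.uDrift_xx hp).2,
      pd_comm cm (ex, 0) (et, 0)]
    ring
  have e3 := pd_congr_on hO (fun q hq => (hΦ.uDrift_derivatives (p := q) hq).1) (et, 0) hp
  rw [pd_mul cD.diff (cm.pd _).diff, pd_mul (differentiableAt_const _) (cD.pd _).diff,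
    pd_const] at e3
  obtain ⟨d1, d2, -⟩ := hΦ.uDrift_derivatives hp
  rw [hn] at hn'
  linear_combination (-1 / 5 : ℝ) * xScale Φ p ^ 2 * hn' - xScale Φ p / 5 * e3
    - xScale Φ p / 5 * d2 + (pd (et, 0) (xScale Φ) p / 5 + 2 / 5 * (xScale Φ p *
      pd (ex, 0) (uDrift Φ) p + 2 * pd (et, 0) (xScale Φ) p)) * d1

theorem eq_of_pd_eq_zero {p₀ : Total} {ε : ℝ} {F : Total → ℝ}
    (hF : ∀ q ∈ Metric.ball p₀ ε, DifferentiableAt ℝ F q)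
    (ht : ∀ q ∈ Metric.ball p₀ ε, pd (et, 0) F q = 0)
    (hx : ∀ q ∈ Metric.ball p₀ ε, pd (ex, 0) F q = 0)
    (hy : ∀ q ∈ Metric.ball p₀ ε, pd (ey, 0) F q = 0)
    (hu : ∀ q ∈ Metric.ball p₀ ε, pd (0, 1) F q = 0) {q : Total} (hq : q ∈ Metric.ball p₀ ε) :
    F q = F p₀ := by
  refine Metric.isOpen_ball.is_const_of_fderiv_eq_zero (convex_ball p₀ ε).isPreconnected
    (fun q hq => (hF q hq).differentiableWithinAt) (fun q hq => ?_) hq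
    (Metric.mem_ball_self (dist_nonneg.trans_lt hq))
  refine ContinuousLinearMap.ext fun v => ?_
  have := pd_total_coord v F q
  rw [ht q hq, hx q hq, hy q hq, hu q hq] at this
  rw [show fderiv ℝ F q v = pd v F q from rfl, this]
  simp

/-- The `t` component of a point symmetry is locally a Möbius transformation. -/
theorem IsPointSymmetry.exists_moebius (hΦ : IsPointSymmetry Φ) {p₀ : Total} {ε : ℝ}
    (hε : 0 < ε)
    (hball : Metric.ball p₀ ε ⊆ Φ.source) : ∃ A : SL2, ∀ q ∈ Metric.ball p₀ ε,
      den A q.1.1 ≠ 0 ∧ xScale Φ q * den A q.1.1 = 1 ∧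
      tComp Φ q = (A 0 0 * q.1.1 + A 0 1) / den A q.1.1 := by
  have hp₀ : p₀ ∈ Metric.ball p₀ ε := Metric.mem_ball_self hε
  have cT := fun q hq => (hΦ.comp_contDiffAt (p := q) (hball hq)).1
  have cD : ∀ q ∈ Metric.ball p₀ ε, ContDiffAt ℝ ∞ (xScale Φ) q := fun q hq =>
    (hΦ.comp_contDiffAt (hball hq)).2.1.pd _
  have hD0 : ∀ q ∈ Metric.ball p₀ ε, xScale Φ q ≠ 0 := fun q hq =>
    (hΦ.determiningEquations (hball hq)).x_x_ne
  have Dx := fun q hq => (hΦ.scale_x (p := q) (hball hq)).1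
  have Dy := fun q hq => (hΦ.scale_y_u (p := q) (hball hq)).1
  have Du := fun q hq => (hΦ.scale_y_u (p := q) (hball hq)).2
  have hO : IsOpen (Metric.ball p₀ ε) := Metric.isOpen_ball
  have Dtx := fun q hq => pd_comm_zero hO cD Dx (et, 0) (p := q) hq
  have Dty := fun q hq => pd_comm_zero hO cD Dy (et, 0) (p := q) hq
  have Dtu := fun q hq => pd_comm_zero hO cD Du (et, 0) (p := q) hq
  -- The differential equation for the scale says precisely that its reciprocal has zero second
  -- t-derivative.
  set R : Total → ℝ := fun q => (xScale Φ q)⁻¹ with hR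
  have cR : ∀ q ∈ Metric.ball p₀ ε, ContDiffAt ℝ ∞ R q := fun q hq => (cD q hq).inv (hD0 q hq)
  have hRv : ∀ v, ∀ q ∈ Metric.ball p₀ ε, pd v R q = -pd v (xScale Φ) q * R q ^ 2 := by
    intro v q hq
    rw [hR, pd_comp_deriv (g := fun s => s⁻¹) (hasDerivAt_inv (hD0 q hq)) (cD q hq).diff]
    simp only [inv_pow]
    ring
  have hRt : ∀ v, ∀ q ∈ Metric.ball p₀ ε, pd v (pd (et, 0) R) q =
      -(pd v (pd (et, 0) (xScale Φ)) q * R q ^ 2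
        - 2 * pd (et, 0) (xScale Φ) q * R q ^ 3 * pd v (xScale Φ) q) := by
    intro v q hq
    rw [pd_congr_on hO (hRv (et, 0)) v hq,
      show (fun q => -pd (et, 0) (xScale Φ) q * R q ^ 2) = fun q => (-1) *
        (pd (et, 0) (xScale Φ) q * R q ^ 2) from funext fun q => by ring,
      pd_mul (differentiableAt_const _) (((cD q hq).pd _).mul ((cR q hq).pow 2)).diff, pd_const,
      pd_mul ((cD q hq).pd _).diff ((cR q hq).pow 2).diff, pd_pow2 (cR q hq).diff, hRv v q hq]
    ring
  have hRD : ∀ q ∈ Metric.ball p₀ ε, R q * xScale Φ q = 1 := fun q hq => inv_mul_cancel₀ (hD0 q hq)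
  set γ := pd (et, 0) R p₀ with hγ
  have hγc : ∀ q ∈ Metric.ball p₀ ε, pd (et, 0) R q = γ := fun q hq => by
    refine eq_of_pd_eq_zero (fun q hq => ((cR q hq).pd _).diff) (fun q hq => ?_) (fun q hq => ?_)
      (fun q hq => ?_) (fun q hq => ?_) hq
    · rw [hRt _ q hq]
      have h1 := hΦ.scale_ode (hball hq)
      have h2 := hRD q hq
      linear_combination (-R q ^ 3) * h1 + R q ^ 2 *
        pd (et, 0) (pd (et, 0) (xScale Φ)) q * h2
    · rw [hRt _ q hq, Dtx q hq, Dx q hq]; ring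
    · rw [hRt _ q hq, Dty q hq, Dy q hq]; ring
    · rw [hRt _ q hq, Dtu q hq, Du q hq]; ring
  have dt : ∀ q, DifferentiableAt ℝ (fun q : Total => q.1.1) q := fun q => by fun_prop
  set δ := R p₀ - γ * p₀.1.1 with hδ
  have hRlin : ∀ q ∈ Metric.ball p₀ ε, R q = γ * q.1.1 + δ := by
    intro q hq
    have hder : ∀ v, ∀ q ∈ Metric.ball p₀ ε, pd v (fun q => R q - γ * q.1.1) q
        = pd v R q - γ * v.1.1 := fun v q hq => by
      rw [pd_sub (cR q hq).diff ((differentiableAt_const _).fun_mul (dt q)),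
        pd_mul (differentiableAt_const _) (dt q), pd_const, pd_t_coord]
      ring
    have := eq_of_pd_eq_zero (F := fun q => R q - γ * q.1.1)
      (fun q hq => (cR q hq).diff.fun_sub ((differentiableAt_const _).fun_mul (dt q)))
      (fun q hq => by rw [hder _ q hq, hγc q hq]; ring)
      (fun q hq => by rw [hder _ q hq, hRv _ q hq, Dx q hq]; ring)
      (fun q hq => by rw [hder _ q hq, hRv _ q hq, Dy q hq]; ring)
      (fun q hq => by rw [hder _ q hq, hRv _ q hq, Du q hq]; simp) hq
    rw [hδ]
    linear_combination this
  have hR0 : R p₀ ≠ 0 := inv_ne_zero (hD0 p₀ hp₀)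
  -- `K` is the required value of αt + β at `p₀`. Then α is forced by determinant one and β by `K`.
  -- The difference of T and the Möbius map has zero derivatives, as T_t = D², and vanishes at `p₀`.
  set K := tComp Φ p₀ * R p₀ with hK
  set α := (1 + γ * K) / R p₀ with hα
  set β := K - α * p₀.1.1 with hβ
  have hαR : α * R p₀ = 1 + γ * K := div_mul_cancel₀ _ hR0
  have hdet : α * δ - β * γ = 1 := by
    rw [hβ, hδ]
    linear_combination hαR
  refine ⟨⟨!![α, β; γ, δ], by rw [Matrix.det_fin_two_of]; exact hdet⟩, fun q hq => ?_⟩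
  have hden : den ⟨!![α, β; γ, δ], by rw [Matrix.det_fin_two_of]; exact hdet⟩ q.1.1 = R q := by
    rw [hRlin q hq]; simp [den]
  rw [hden]
  refine ⟨inv_ne_zero (hD0 q hq), mul_inv_cancel₀ (hD0 q hq), ?_⟩
  have da : ∀ q : Total, DifferentiableAt ℝ (fun q : Total => α * q.1.1 + β) q := fun q => by
    fun_prop
  have hpda : ∀ v q, pd v (fun q : Total => α * q.1.1 + β) q = α * v.1.1 := fun v q => by
    rw [pd_add ((differentiableAt_const _).fun_mul (dt q)) (differentiableAt_const _),
      pd_mul (differentiableAt_const _) (dt q), pd_const, pd_const, pd_t_coord]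
    ring
  have hder : ∀ v, ∀ q ∈ Metric.ball p₀ ε,
      pd v (fun q => tComp Φ q - (α * q.1.1 + β) * xScale Φ q) q
        = pd v (tComp Φ) q - (α * v.1.1 * xScale Φ q
          + (α * q.1.1 + β) * pd v (xScale Φ) q) := fun v q hq => by
    rw [pd_sub (cT q hq).diff ((da q).fun_mul (cD q hq).diff), pd_mul (da q) (cD q hq).diff, hpda]
  have := eq_of_pd_eq_zero (F := fun q => tComp Φ q - (α * q.1.1 + β) * xScale Φ q)
    (fun q hq => (cT q hq).diff.fun_sub ((da q).fun_mul (cD q hq).diff))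
    (fun q hq => by
      have h1 : pd (et, 0) (xScale Φ) q = -γ * xScale Φ q ^ 2 := by
        have := hRv (et, 0) q hq
        rw [hγc q hq] at this
        have h2 := hRD q hq
        rw [this]
        linear_combination (-pd (et, 0) (xScale Φ) q) * (R q * xScale Φ q + 1) * h2
      have h2 : (γ * q.1.1 + δ) * xScale Φ q = 1 := by rw [← hRlin q hq]; exact hRD q hq
      rw [hder _ q hq, (hΦ.scale_x (hball hq)).2.2.2, h1]
      linear_combination (-xScale Φ q ^ 2) * hdet + α * xScale Φ q * h2)
    (fun q hq => by
      rw [hder _ q hq, Dx q hq, (hΦ.determiningEquations (hball hq)).t_x]; ring)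
    (fun q hq => by rw [hder _ q hq, Dy q hq, (hΦ.scale_x (hball hq)).2.1]; ring)
    (fun q hq => by
      rw [hder _ q hq, Du q hq, (hΦ.determiningEquations (hball hq)).t_u]; simp) hq
  have e0 : tComp Φ p₀ - (α * p₀.1.1 + β) * xScale Φ p₀ = 0 := by
    rw [hβ, hK]
    linear_combination (-tComp Φ p₀) * hRD p₀ hp₀
  have e1 : tComp Φ q = (α * q.1.1 + β) * xScale Φ q := by linear_combination this + e0
  rw [e1, hR]
  simp

end Kolmogorov

/-! ### Symmetries with normalised t component -/

namespace Kolmogorov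

theorem pd_comp_fst {g : Base → ℝ} {q : Total} (hg : DifferentiableAt ℝ g q.1) (v : Total) :
    pd v (fun q : Total => g q.1) q = pd v.1 g q.1 := by
  have := (hg.hasFDerivAt.comp q (hasFDerivAt_fst (p := q) (𝕜 := ℝ))).fderiv
  simp only [Function.comp_def] at this
  simp [pd, this]

theorem eq_of_pd_eq {p₀ : Total} {ε : ℝ} {F G : Total → ℝ}
    (hF : ∀ q ∈ Metric.ball p₀ ε, DifferentiableAt ℝ F q)
    (hG : ∀ q ∈ Metric.ball p₀ ε, DifferentiableAt ℝ G q) (h₀ : F p₀ = G p₀)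
    (h : ∀ q ∈ Metric.ball p₀ ε, pd (et, 0) F q = pd (et, 0) G q ∧ pd (ex, 0) F q = pd (ex, 0) G q ∧
      pd (ey, 0) F q = pd (ey, 0) G q ∧ pd (0, 1) F q = pd (0, 1) G q)
    {q : Total} (hq : q ∈ Metric.ball p₀ ε) : F q = G q := by
  have := eq_of_pd_eq_zero (F := fun q => F q - G q) (fun q hq => (hF q hq).fun_sub (hG q hq))
    (fun q hq => by rw [pd_sub (hF q hq) (hG q hq), (h q hq).1, sub_self])
    (fun q hq => by rw [pd_sub (hF q hq) (hG q hq), (h q hq).2.1, sub_self])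
    (fun q hq => by rw [pd_sub (hF q hq) (hG q hq), (h q hq).2.2.1, sub_self])
    (fun q hq => by rw [pd_sub (hF q hq) (hG q hq), (h q hq).2.2.2, sub_self]) hq
  rw [h₀, sub_self] at this
  exact sub_eq_zero.1 this

theorem solAt_const (c : ℝ) (b : Base) : SolAt (fun _ => c) b :=
  Filter.Eventually.of_forall fun y => ⟨contDiffAt_const, by simp [SatisfiesAt, iteratedDeriv_succ]⟩

theorem fderiv_baseMap_injective {A : SL2} {b : Base} (l : Fin 4 → ℝ) (hb : den A b.1 ≠ 0) :
    Function.Injective (fderiv ℝ (baseMap A l) b) := by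
  have h1 := ((contDiffAt_baseMap l hb).differentiableAt (by simp)).hasFDerivAt
  have h2 := ((contDiffAt_baseMap (invShift A l) (den_inv_ne l hb)).differentiableAt
    (by simp)).hasFDerivAt
  have h3 := (h2.comp b h1).congr_of_eventuallyEq (f₁ := id) (by
    filter_upwards [eventually_den_ne A hb] with y hy
    exact (baseMap_inv_left l hy).symm)
  have h4 := h3.unique (hasFDerivAt_id b)
  exact Function.LeftInverse.injective fun v => DFunLike.congr_fun h4 v

variable {Φ : OpenPartialHomeomorph Total Total} {p₀ : Total} {ε : ℝ}

/-- The derivatives of the scale of `u` when the `t` and `x` components are normalised. -/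
theorem IsPointSymmetry.normalised_equations (hΦ : IsPointSymmetry Φ)
    (hball : Metric.ball p₀ ε ⊆ Φ.source) (hD : ∀ q ∈ Metric.ball p₀ ε, xScale Φ q = 1)
    {q : Total} (hq : q ∈ Metric.ball p₀ ε) :
    (pd (ex, 0) (uDrift Φ) q = 0 ∧ pd (ey, 0) (uDrift Φ) q = 0 ∧ pd (0, 1) (uDrift Φ) q = 0) ∧
    pd (ex, 0) (uScale Φ) q = -(uDrift Φ q * uScale Φ q) ∧
    pd (ey, 0) (uScale Φ) q = pd (et, 0) (uDrift Φ) q * uScale Φ q ∧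
    pd (et, 0) (uScale Φ) q + q.1.2.1 * pd (ey, 0) (uScale Φ) q
      = -(uDrift Φ q ^ 2 * uScale Φ q) := by
  have hO : IsOpen (Metric.ball p₀ ε) := Metric.isOpen_ball
  have hDv : ∀ v, ∀ q ∈ Metric.ball p₀ ε, pd v (xScale Φ) q = 0 := fun v q hq => by
    rw [pd_congr_on hO (G := fun _ => 1) hD v hq, pd_const]
  obtain ⟨a1, a2, a3⟩ := hΦ.uDrift_derivatives (hball hq)
  rw [hD q hq, hDv _ q hq] at a1
  rw [hD q hq, pd_zero_on hO (hDv _) _ hq] at a2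
  have m1 : pd (ex, 0) (uDrift Φ) q = 0 := by linear_combination a1
  have m2 : pd (ey, 0) (uDrift Φ) q = 0 := by linear_combination a2 / 2
  obtain ⟨b1, b2⟩ := hΦ.uScale_equations (hball hq)
  have b3 := hΦ.uScale_y (hball hq)
  rw [m1] at b2
  rw [uSlope, m1, m2] at b3
  refine ⟨⟨m1, m2, a3⟩, b1, ?_, ?_⟩
  · rw [b3]; ring
  · rw [b2]; ring

/-- Here the drift m depends on t only and the scale M satisfies M_y = m_t M and (∂_t + x∂_y)M =
−m²M. Commuting ∂_y with the transport operator leaves m_tt M = 0. -/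
theorem IsPointSymmetry.normalised_drift (hΦ : IsPointSymmetry Φ)
    (hball : Metric.ball p₀ ε ⊆ Φ.source) (hD : ∀ q ∈ Metric.ball p₀ ε, xScale Φ q = 1) :
    ∃ κ μ : ℝ, ∀ q ∈ Metric.ball p₀ ε, uDrift Φ q = κ * q.1.1 + μ ∧
      pd (et, 0) (uDrift Φ) q = κ := by
  have hO : IsOpen (Metric.ball p₀ ε) := Metric.isOpen_ball
  have cm := fun q hq => hΦ.contDiffAt_uDrift (p := q) (hball hq)
  have cA : ∀ q ∈ Metric.ball p₀ ε, ContDiffAt ℝ ∞ (uScale Φ) q := fun q hq =>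
    (hΦ.comp_contDiffAt (hball hq)).2.2.2.pd _
  have hn := fun q hq => hΦ.normalised_equations (q := q) hball hD hq
  have hmt : ∀ q ∈ Metric.ball p₀ ε, pd (ex, 0) (pd (et, 0) (uDrift Φ)) q = 0 ∧
      pd (ey, 0) (pd (et, 0) (uDrift Φ)) q = 0 ∧ pd (0, 1) (pd (et, 0) (uDrift Φ)) q = 0 :=
    fun q hq => ⟨pd_comm_zero hO cm (fun q hq => (hn q hq).1.1) _ hq,
      pd_comm_zero hO cm (fun q hq => (hn q hq).1.2.1) _ hq,
      pd_comm_zero hO cm (fun q hq => (hn q hq).1.2.2) _ hq⟩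
  have hmtt : ∀ q ∈ Metric.ball p₀ ε, pd (et, 0) (pd (et, 0) (uDrift Φ)) q = 0 := by
    intro q hq
    have e1 := pd_congr_on hO (fun q hq => (hn q hq).2.2.2) (ey, 0) hq
    rw [pd_transport ((cA q hq).pd _).diff ((cA q hq).pd _).diff, pd_comm (cA q hq)] at e1
    have e2 := pd_congr_on hO (fun q hq => (hn q hq).2.2.1) (et, 0) hq
    have e3 := pd_congr_on hO (fun q hq => (hn q hq).2.2.1) (ey, 0) hq
    rw [pd_mul ((cm q hq).pd _).diff (cA q hq).diff] at e2 e3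
    have e4 : pd (ey, 0) (fun q => -(uDrift Φ q ^ 2 * uScale Φ q)) q
        = -(uDrift Φ q ^ 2 * pd (ey, 0) (uScale Φ) q) := by
      have : (fun q => -(uDrift Φ q ^ 2 * uScale Φ q))
          = fun q => (fun _ => (-1 : ℝ)) q * (uDrift Φ q ^ 2 * uScale Φ q) := by ext; ring
      have d2 : DifferentiableAt ℝ (fun q => uDrift Φ q ^ 2) q := (cm q hq).diff.fun_pow 2
      rw [this, pd_mul (differentiableAt_const _) (d2.fun_mul (cA q hq).diff), pd_const,
        pd_mul d2 (cA q hq).diff, pd_pow2 (cm q hq).diff, (hn q hq).1.2.1]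
      ring
    rw [e4, e2, e3, (hmt q hq).2.1] at e1
    refine (mul_eq_zero.1 ?_).resolve_right (hΦ.determiningEquations (hball hq)).u_u_ne
    have e5 := (hn q hq).2.2.1
    have e6 := (hn q hq).2.2.2
    change _ * uScale Φ q = 0
    linear_combination e1 - pd (et, 0) (uDrift Φ) q * e6 - uDrift Φ q ^ 2 * e5
  have hκ : ∀ q ∈ Metric.ball p₀ ε, pd (et, 0) (uDrift Φ) q = pd (et, 0) (uDrift Φ) p₀ :=
    fun q hq => eq_of_pd_eq_zero (fun q hq => ((cm q hq).pd _).diff) hmtt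
      (fun q hq => (hmt q hq).1) (fun q hq => (hmt q hq).2.1) (fun q hq => (hmt q hq).2.2) hq
  set κ := pd (et, 0) (uDrift Φ) p₀ with hκd
  refine ⟨κ, uDrift Φ p₀ - κ * p₀.1.1, fun q hq => ⟨?_, hκ q hq⟩⟩
  have hg : ∀ q : Total, DifferentiableAt ℝ (fun q : Total => κ * q.1.1) q := fun q => by fun_prop
  have hgv : ∀ v q : Total, pd v (fun q : Total => κ * q.1.1 + (uDrift Φ p₀ - κ * p₀.1.1)) q
      = κ * v.1.1 := fun v q => by
    rw [pd_add (hg q) (differentiableAt_const _), pd_const,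
      pd_mul (differentiableAt_const _) (by fun_prop), pd_const, pd_t_coord]
    ring
  refine eq_of_pd_eq (G := fun q : Total => κ * q.1.1 + (uDrift Φ p₀ - κ * p₀.1.1))
    (fun q hq => (cm q hq).diff) (fun q _ => (hg q).fun_add (differentiableAt_const _)) (by ring)
    (fun q hq => ?_) hq
  rw [hgv, hgv, hgv, hgv, (hn q hq).1.1, (hn q hq).1.2.1, (hn q hq).1.2.2, hκ q hq]
  simp

/-- A point symmetry whose `t` and `x` components are normalised near a point. -/
theorem IsPointSymmetry.normalised_base (hΦ : IsPointSymmetry Φ)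
    (hball : Metric.ball p₀ ε ⊆ Φ.source) (hD : ∀ q ∈ Metric.ball p₀ ε, xScale Φ q = 1) :
    ∃ l : Fin 4 → ℝ, ∃ σ : ℝ, ∀ q ∈ Metric.ball p₀ ε, xComp Φ q = xHat l q.1 ∧
      yComp Φ q = yHat l q.1 ∧ uScale Φ q = σ * Real.exp (expL l q.1) := by
  have hO : IsOpen (Metric.ball p₀ ε) := Metric.isOpen_ball
  have cX := fun q hq => (hΦ.comp_contDiffAt (p := q) (hball hq)).2.1
  have cY := fun q hq => (hΦ.comp_contDiffAt (p := q) (hball hq)).2.2.1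
  have cA : ∀ q ∈ Metric.ball p₀ ε, ContDiffAt ℝ ∞ (uScale Φ) q := fun q hq =>
    (hΦ.comp_contDiffAt (hball hq)).2.2.2.pd _
  have hDv : ∀ v, ∀ q ∈ Metric.ball p₀ ε, pd v (xScale Φ) q = 0 := fun v q hq => by
    rw [pd_congr_on hO (G := fun _ => 1) hD v hq, pd_const]
  have hdet := fun q hq => hΦ.determiningEquations (p := q) (hball hq)
  have hn := fun q hq => hΦ.normalised_equations (q := q) hball hD hq
  obtain ⟨κ, μ, hm⟩ := hΦ.normalised_drift hball hD
  -- With drift κt + μ one has X_t = 2(κt + μ) and Y_t = X − x. So κ = 3λ₃ and μ = λ₂, while λ₁ and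
  -- λ₀ are the constants of integration, read off at `p₀`.
  set l₁ := xComp Φ p₀ - (p₀.1.2.1 + κ * p₀.1.1 ^ 2 + 2 * μ * p₀.1.1) with hl₁
  set l₀ := yComp Φ p₀ - (p₀.1.2.2 + κ / 3 * p₀.1.1 ^ 3 + μ * p₀.1.1 ^ 2 + l₁ * p₀.1.1) with hl₀
  set l : Fin 4 → ℝ := ![l₀, l₁, μ, κ / 3] with hl
  have e0 : l 0 = l₀ := rfl
  have e1 : l 1 = l₁ := rfl
  have e2 : l 2 = μ := rfl
  have e3 : l 3 = κ / 3 := rfl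
  have dx : ∀ b, DifferentiableAt ℝ (xHat l) b := fun b => (contDiff_xHat l).contDiffAt.diff
  have dy : ∀ b, DifferentiableAt ℝ (yHat l) b := fun b => (contDiff_yHat l).contDiffAt.diff
  have dL : ∀ b, DifferentiableAt ℝ (expL l) b := fun b => (contDiff_expL l).contDiffAt.diff
  have hx : ∀ q ∈ Metric.ball p₀ ε, xComp Φ q = xHat l q.1 := by
    intro q hq
    refine eq_of_pd_eq (G := fun q => xHat l q.1) (fun q hq => (cX q hq).diff)
      (fun q _ => DifferentiableAt.comp q (dx q.1) differentiableAt_fst) ?_ (fun q hq => ?_) hq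
    · simp only [xHat, e1, e2, e3]
      rw [hl₁]
      ring
    · have h1 := (hΦ.x_y_eq (hball hq)).2
      rw [hDv _ q hq, mul_zero] at h1
      have h2 := (hm q hq).1
      rw [uDrift, hD q hq, xDrift, h1] at h2
      refine ⟨?_, ?_, ?_, ?_⟩
      · rw [pd_comp_fst (dx _), pd_of_hasDerivAt (dx _) (hasDerivAt_xHat_line l _ _), e2, e3]
        linear_combination 2 * h2
      · rw [pd_comp_fst (dx _), pd_of_hasDerivAt (dx _) (hasDerivAt_xHat_line l _ _)]
        simpa using hD q hq
      · rw [pd_comp_fst (dx _), pd_of_hasDerivAt (dx _) (hasDerivAt_xHat_line l _ _), h1]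
        simp
      · rw [pd_comp_fst (dx _), pd_of_hasDerivAt (dx _) (hasDerivAt_xHat_line l _ _),
          (hdet q hq).x_u]
        simp
  have hy : ∀ q ∈ Metric.ball p₀ ε, yComp Φ q = yHat l q.1 := by
    intro q hq
    refine eq_of_pd_eq (G := fun q => yHat l q.1) (fun q hq => (cY q hq).diff)
      (fun q _ => DifferentiableAt.comp q (dy q.1) differentiableAt_fst) ?_ (fun q hq => ?_) hq
    · simp only [yHat, e0, e1, e2, e3]
      rw [hl₀]
      ring
    · have h1 := (hΦ.x_y_eq (hball hq)).1
      have h2 := (hΦ.scale_x (hball hq)).2.2.1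
      rw [hD q hq] at h1 h2
      rw [hx q hq, xHat] at h1
      refine ⟨?_, ?_, ?_, ?_⟩
      · rw [pd_comp_fst (dy _), pd_of_hasDerivAt (dy _) (hasDerivAt_yHat_line l _ _)]
        linear_combination h1
      · rw [pd_comp_fst (dy _), pd_of_hasDerivAt (dy _) (hasDerivAt_yHat_line l _ _),
          (hdet q hq).y_x]
        simp
      · rw [pd_comp_fst (dy _), pd_of_hasDerivAt (dy _) (hasDerivAt_yHat_line l _ _), h2]
        simp
      · rw [pd_comp_fst (dy _), pd_of_hasDerivAt (dy _) (hasDerivAt_yHat_line l _ _),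
          (hdet q hq).y_u]
        simp
  -- Dividing the scale by the expected exponential leaves a function with zero derivatives; its
  -- constant value is σ.
  set g : Base → ℝ := fun b => Real.exp (-expL l b) with hg
  have dg : ∀ b, DifferentiableAt ℝ g b := fun b => (dL b).neg.exp
  have hgv : ∀ v b, pd v g b = -g b * (3 * l 3 * (v.2.2 - (v.1 * b.2.1 + b.1 * v.2.1))
      - l 2 * v.2.1 - (9 * l 3 ^ 2 * b.1 ^ 2 + 6 * l 3 * l 2 * b.1 + l 2 ^ 2) * v.1) := by
    intro v b
    have := (hasDerivAt_expL_line l b v).neg.exp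
    rw [pd_of_hasDerivAt (dg b) this]
    simp [hg]
    ring
  have dG : ∀ q : Total, DifferentiableAt ℝ (fun q : Total => g q.1) q := fun q =>
    DifferentiableAt.comp (g := g) q (dg q.1) differentiableAt_fst
  have hA : ∀ q ∈ Metric.ball p₀ ε, uScale Φ q * g q.1 = uScale Φ p₀ * g p₀.1 := by
    intro q hq
    have hder : ∀ v, ∀ q ∈ Metric.ball p₀ ε, pd v (fun q => uScale Φ q * g q.1) q
        = pd v (uScale Φ) q * g q.1 + uScale Φ q * pd v.1 g q.1 := fun v q hq => by
      rw [pd_mul (cA q hq).diff (dG q), pd_comp_fst (dg _)]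
    refine eq_of_pd_eq_zero (F := fun q => uScale Φ q * g q.1)
      (fun q hq => (cA q hq).diff.fun_mul (dG q)) (fun q hq => ?_) (fun q hq => ?_)
      (fun q hq => ?_) (fun q hq => ?_) hq
    · obtain ⟨-, -, h1, h2⟩ := hn q hq
      rw [(hm q hq).2] at h1
      rw [(hm q hq).1] at h2
      rw [hder _ q hq, hgv, e2, e3]
      linear_combination g q.1 * h2 - g q.1 * q.1.2.1 * h1
    · obtain ⟨-, h1, -⟩ := hn q hq
      rw [(hm q hq).1] at h1
      rw [hder _ q hq, hgv, e2, e3, h1]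
      ring
    · obtain ⟨-, -, h1, -⟩ := hn q hq
      rw [(hm q hq).2] at h1
      rw [hder _ q hq, hgv, e2, e3, h1]
      ring
    · rw [hder _ q hq, hgv]
      have := (hdet q hq).u_uu
      change pd (0, 1) (uScale Φ) q = 0 at this
      rw [this]
      simp
  refine ⟨l, uScale Φ p₀ * g p₀.1, fun q hq => ⟨hx q hq, hy q hq, ?_⟩⟩
  rw [← hA q hq, mul_assoc, hg, ← Real.exp_add]
  simp

/-- A point symmetry whose `t` and `x` components are normalised near a point has the stated
form there. -/
theorem IsPointSymmetry.formAt_of_normalised (hΦ : IsPointSymmetry Φ) (hε : 0 < ε)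
    (hball : Metric.ball p₀ ε ⊆ Φ.source) (hT : ∀ q ∈ Metric.ball p₀ ε, tComp Φ q = q.1.1)
    (hD : ∀ q ∈ Metric.ball p₀ ε, xScale Φ q = 1) : FormAt Φ p₀ := by
  have hp₀ : p₀ ∈ Metric.ball p₀ ε := Metric.mem_ball_self hε
  obtain ⟨l, σ, h⟩ := hΦ.normalised_base hball hD
  have hσ : σ ≠ 0 := by
    rintro rfl
    have := (hΦ.determiningEquations (hball hp₀)).u_u_ne
    exact this (by
      rw [show pd (0, 1) (uComp Φ) p₀ = uScale Φ p₀ from rfl, (h p₀ hp₀).2.2, zero_mul])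
  have hmem : ∀ q : Total, q ∈ Metric.ball p₀ ε ↔
      q.1 ∈ Metric.ball p₀.1 ε ∧ q.2 ∈ Metric.ball p₀.2 ε := fun q => by
    simp only [Metric.mem_ball, Prod.dist_eq, max_lt_iff]
  set M : Base → ℝ := fun b => multiplier 1 l σ b with hM
  have hden : ∀ t, den (1 : SL2) t ≠ 0 := fun t => by rw [den_one]; exact one_ne_zero
  have hM0 : ∀ b, M b ≠ 0 := fun b => multiplier_ne_zero l (hden _) hσ
  have hbase : ∀ q ∈ Metric.ball p₀ ε, (Φ q).1 = baseMap 1 l q.1 := fun q hq => by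
    rw [baseMap_one, ← (h q hq).1, ← (h q hq).2.1, ← hT q hq]
  -- On the ball the u component is affine in u with slope `M`, so it is determined by its values on
  -- the slice u = `p₀.2`.
  set f : Base → ℝ := fun b => uComp Φ (b, p₀.2) / M b - p₀.2 with hf
  have hU : ∀ q ∈ Metric.ball p₀ ε, uComp Φ q = M q.1 * (q.2 + f q.1) := by
    rintro ⟨b, v⟩ hq
    have hb := ((hmem _).1 hq).1
    have hderiv : ∀ w ∈ Metric.ball p₀.2 ε,
        HasDerivAt (fun w => uComp Φ (b, w) - M b * w) 0 w := by
      intro w hw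
      have hbw : (b, w) ∈ Metric.ball p₀ ε := (hmem _).2 ⟨hb, hw⟩
      have h1 := (hΦ.comp_contDiffAt (hball hbw)).2.2.2.diff.hasFDerivAt.comp_hasDerivAt w
        ((hasDerivAt_const w b).prodMk (hasDerivAt_id w))
      refine (h1.sub ((hasDerivAt_id w).const_mul (M b))).congr_deriv ?_
      have := (h _ hbw).2.2
      rw [← multiplier_one] at this
      rw [mul_one]
      exact sub_eq_zero.2 this
    have := Metric.isOpen_ball.is_const_of_deriv_eq_zero (convex_ball p₀.2 ε).isPreconnected
      (fun w hw => (hderiv w hw).differentiableAt.differentiableWithinAt)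
      (fun w hw => (hderiv w hw).deriv) ((hmem _).1 hq).2 ((hmem _).1 hp₀).2
    have hM' := hM0 b
    simp only [hf]
    field_simp
    linear_combination this
  have hform : ∀ q ∈ Metric.ball p₀ ε, Φ q = formula 1 l σ f q := fun q hq =>
    Prod.ext (hbase q hq) (hU q hq)
  have hnear : ∀ᶠ y in 𝓝 p₀.1, (y, p₀.2) ∈ Metric.ball p₀ ε := by
    filter_upwards [Metric.ball_mem_nhds p₀.1 hε] with y hy
    exact (hmem _).2 ⟨hy, Metric.mem_ball_self hε⟩
  refine ⟨1, l, σ, f, hσ, hden _, ?_, Filter.eventuallyEq_of_mem (Metric.ball_mem_nhds p₀ hε) hform⟩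
  have hB : (fun y => (Φ (y, p₀.2)).1) =ᶠ[𝓝 p₀.1] baseMap 1 l := by
    filter_upwards [hnear] with y hy using hbase _ hy
  -- The constant `p₀.2` is a solution, and its image is the image of `p₀.2 + f` under the
  -- homogeneous transformation. Hence `p₀.2 + f`, and so `f`, is a solution.
  obtain ⟨u', hu', hpush, -⟩ := hΦ.push (b := p₀.1) (u := fun _ => p₀.2) (hball hp₀)
    (solAt_const _ _) (by rw [hB.fderiv_eq]; exact fderiv_baseMap_injective l (hden _))
  have hs : SolAt (fun b => p₀.2 + f b) p₀.1 := by
    refine (solAt_baseMap_iff (l := l) hσ (hden _) (u' := u') ?_).2 ?_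
    · filter_upwards [hnear, hpush] with y h1 h2
      rw [hbase _ h1] at h2
      rw [h2]
      exact hU _ h1
    · have := hbase p₀ hp₀
      rw [← this]
      exact hu'
  exact (hs.add (solAt_const (-p₀.2) _)).congr (Filter.Eventually.of_forall fun y => by simp)

end Kolmogorov

/-! ### Local classification, the pseudogroup, and global forms -/

namespace Kolmogorov

theorem contDiffOn_zero (Ω : Set Base) : ContDiffOn ℝ ∞ (0 : Base → ℝ) Ω := contDiffOn_const

/-- The transformation with the given parameters and with `f = 0`. -/
noncomputable abbrev homogeneous (A : SL2) (l : Fin 4 → ℝ) {σ : ℝ} (hσ : σ ≠ 0) :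
    OpenPartialHomeomorph Total Total :=
  transformation A l hσ isOpen_univ (contDiffOn_zero _)

/-- Point symmetries are locally of the stated form. -/
theorem IsPointSymmetry.formAt {Φ : OpenPartialHomeomorph Total Total} (hΦ : IsPointSymmetry Φ)
    {p : Total} (hp : p ∈ Φ.source) : FormAt Φ p := by
  obtain ⟨ε, hε, hball⟩ := Metric.isOpen_iff.1 Φ.open_source p hp
  obtain ⟨A, hA⟩ := hΦ.exists_moebius hε hball
  -- Composing with the inverse element of SL(2, ℝ) makes the t component the identity and
  -- multiplies the x scale by the denominator of `A`, which gives 1. The form of Φ is recovered by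
  -- composing back with `Θ.symm`.
  set Θ := homogeneous A⁻¹ 0 one_ne_zero with hΘ
  have hform : HasForm A⁻¹ 0 1 0 Set.univ Θ := hasForm_transformation _ _ _
  have hT : ∀ q ∈ Metric.ball p ε, tComp Φ q = (baseMap A 0 q.1).1 := fun q hq => (hA q hq).2.2
  have hd : ∀ q ∈ Metric.ball p ε, den A⁻¹ (tComp Φ q) * den A q.1.1 = 1 := fun q hq => by
    rw [hT q hq, ← den_mul A⁻¹ A 0 (hA q hq).1, inv_mul_cancel, den_one]
  have hd0 : ∀ q ∈ Metric.ball p ε, den A⁻¹ (tComp Φ q) ≠ 0 := fun q hq =>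
    left_ne_zero_of_mul_eq_one (hd q hq)
  have hmem : ∀ q ∈ Metric.ball p ε, Φ q ∈ Θ.source := fun q hq => ⟨trivial, hd0 q hq⟩
  have hsol : IsSolutionOn 0 Set.univ := (isSolutionOn_iff isOpen_univ).2 fun b _ => solAt_zero b
  have hball' : Metric.ball p ε ⊆ (Φ.trans Θ).source := fun q hq => by
    rw [Φ.trans_source]
    exact ⟨hball hq, hmem q hq⟩
  have hsymm := hΦ.trans_homogeneous one_ne_zero hform
  have h := hsymm.formAt_of_normalised hε hball' (fun q hq => ?_) (fun q hq => ?_)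
  · refine (h.trans (Ψ := Θ.symm) ?_).congr ?_
    · exact (hform.formAt one_ne_zero isOpen_univ hsol _
        (hmem p (Metric.mem_ball_self hε))).symm (hmem p (Metric.mem_ball_self hε))
    · filter_upwards [Metric.ball_mem_nhds p hε] with q hq
      exact (Θ.left_inv (hmem q hq)).symm
  · have h1 : tComp (Φ.trans Θ) q = (baseMap A⁻¹ 0 (baseMap A 0 q.1)).1 := by
      change (A⁻¹ 0 0 * tComp Φ q + A⁻¹ 0 1) / den A⁻¹ (tComp Φ q) = _
      rw [hT q hq]
      rfl
    rw [h1, baseMap_comp _ _ _ _ (hA q hq).1 (by rw [← hT q hq]; exact hd0 q hq), inv_mul_cancel,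
      baseMap_one]
  · obtain ⟨-, cX, cY, -⟩ := hΦ.comp_contDiffAt (hball hq)
    have h1 : ∀ q ∈ Metric.ball p ε, xComp (Φ.trans Θ) q = xComp Φ q * den A q.1.1
        - yComp Φ q * (3 * A⁻¹ 1 0 * den A q.1.1 ^ 2) := fun q hq => by
      change xHat 0 (Φ q).1 / den A⁻¹ (tComp Φ q)
        - 3 * A⁻¹ 1 0 * yHat 0 (Φ q).1 / den A⁻¹ (tComp Φ q) ^ 2 = _
      rw [eq_inv_of_mul_eq_one_left (hd q hq), xHat_zero, yHat_zero]
      have := (hA q hq).1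
      field_simp
    have dd : DifferentiableAt ℝ (fun q : Total => den A q.1.1) q :=
      DifferentiableAt.comp q (contDiff_den A).contDiffAt.diff differentiableAt_fst
    have dd2 : DifferentiableAt ℝ (fun q : Total => 3 * A⁻¹ 1 0 * den A q.1.1 ^ 2) q :=
      (dd.fun_pow 2).const_mul _
    have hden : pd (ex, 0) (fun q : Total => den A q.1.1) q = 0 := by
      rw [pd_comp_fst (g := fun b : Base => den A b.1) (contDiff_den A).contDiffAt.diff,
        pd_of_hasDerivAt (contDiff_den A).contDiffAt.diff (hasDerivAt_den_line A _ _), mul_zero]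
    rw [xScale, pd_congr_on Metric.isOpen_ball h1 _ hq,
      pd_sub (cX.diff.fun_mul dd) (cY.diff.fun_mul dd2), pd_mul cX.diff dd, pd_mul cY.diff dd2,
      hden, pd_mul (differentiableAt_const _) (dd.fun_pow 2), pd_const, pd_pow2 dd, hden,
      (hΦ.determiningEquations (hball hq)).y_x]
    linear_combination (hA q hq).2.1

theorem isPointSymmetry_iff_formAt {Φ : OpenPartialHomeomorph Total Total} :
    IsPointSymmetry Φ ↔ ∀ p ∈ Φ.source, FormAt Φ p :=
  ⟨fun h _ hp => h.formAt hp, isPointSymmetry_of_formAt⟩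

/-- The pseudogroup of point symmetries. -/
def symmetryGroupoid : StructureGroupoid Total where
  members := {Φ | ∀ p ∈ Φ.source, FormAt Φ p}
  trans' Φ Ψ hΦ hΨ p hp := by
    rw [Φ.trans_source] at hp
    exact (hΦ p hp.1).trans (hΨ _ hp.2)
  symm' Φ hΦ p hp := by
    have := (hΦ _ (Φ.map_target hp)).symm (Φ.map_target hp)
    rwa [Φ.right_inv hp] at this
  id_mem' p _ := formAt_id p
  locality' Φ hΦ p hp := by
    obtain ⟨s, hs, hps, h⟩ := hΦ p hp
    exact h p (by rw [Φ.restr_source, hs.interior_eq]; exact ⟨hp, hps⟩)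
  mem_of_eqOnSource' Φ Ψ hΦ h p hp := by
    have hp' : p ∈ Φ.source := h.1 ▸ hp
    exact (hΦ p hp').congr (h.2.eventuallyEq_of_mem (Ψ.open_source.mem_nhds hp))

/-- `Φ` has the stated form with the given parameters in a neighbourhood of `p`. -/
def FormWith (A : SL2) (l : Fin 4 → ℝ) (σ : ℝ) (Φ : Total → Total) (p : Total) : Prop :=
  den A p.1.1 ≠ 0 ∧ ∃ f : Base → ℝ, SolAt f p.1 ∧ Φ =ᶠ[𝓝 p] formula A l σ f

theorem FormWith.eventually {A : SL2} {l : Fin 4 → ℝ} {σ : ℝ} {Φ : Total → Total} {p : Total}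
    (h : FormWith A l σ Φ p) : ∀ᶠ q in 𝓝 p, FormWith A l σ Φ q := by
  obtain ⟨hd, f, hf, h⟩ := h
  filter_upwards [continuous_fst.continuousAt.eventually (eventually_den_ne A hd),
    continuous_fst.continuousAt.eventually hf.eventually_nhds, h.eventually_nhds] with q h1 h2 h3
  exact ⟨h1, f, h2, h3⟩

theorem FormWith.unique {A A' : SL2} {l l' : Fin 4 → ℝ} {σ σ' : ℝ} {Φ : Total → Total}
    {p : Total} (hσ : σ ≠ 0) (h : FormWith A l σ Φ p) (h' : FormWith A' l' σ' Φ p) :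
    A = A' ∧ l = l' ∧ σ = σ' := by
  obtain ⟨hd, f, hf, h⟩ := h
  obtain ⟨hd', f', hf', h'⟩ := h'
  have := params_unique hσ hd hd' (h.symm.trans h')
  exact ⟨this.1, this.2.1, this.2.2.1⟩

/-- On a connected domain the parameters are constant. -/
theorem exists_formWith {Φ : OpenPartialHomeomorph Total Total} (hs : IsPreconnected Φ.source)
    (h : ∀ p ∈ Φ.source, FormAt Φ p) : ∃ (A : SL2) (l : Fin 4 → ℝ) (σ : ℝ), σ ≠ 0 ∧
      ∀ p ∈ Φ.source, FormWith A l σ Φ p := by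
  rcases Φ.source.eq_empty_or_nonempty with he | ⟨p₀, hp₀⟩
  · exact ⟨1, 0, 1, one_ne_zero, fun p hp => absurd hp (by simp [he])⟩
  obtain ⟨A, l, σ, f, hσ, hd, hf, hΦ⟩ := h p₀ hp₀
  refine ⟨A, l, σ, hσ, ?_⟩
  -- The points with the given parameters and the points with some other parameters form open sets,
  -- disjoint by rigidity and covering the domain.
  refine hs.subset_left_of_subset_union (u := {p | FormWith A l σ Φ p})
    (v := {p | ∃ (A' : SL2) (l' : Fin 4 → ℝ) (σ' : ℝ), ¬(A = A' ∧ l = l' ∧ σ = σ') ∧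
      FormWith A' l' σ' Φ p}) (isOpen_iff_mem_nhds.2 fun p hp => hp.eventually)
    (isOpen_iff_mem_nhds.2 fun p ⟨A', l', σ', hne, hp⟩ =>
      hp.eventually.mono fun q hq => ⟨A', l', σ', hne, hq⟩) ?_ ?_ ⟨p₀, hp₀, hd, f, hf, hΦ⟩
  · exact Set.disjoint_left.2 fun p hp ⟨A', l', σ', hne, hp'⟩ => hne (hp.unique hσ hp')
  · intro p hp
    obtain ⟨A', l', σ', f', -, hd', hf', hΦ'⟩ := h p hp
    have : FormWith A' l' σ' Φ p := ⟨hd', f', hf', hΦ'⟩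
    by_cases he : A = A' ∧ l = l' ∧ σ = σ'
    · obtain ⟨rfl, rfl, rfl⟩ := he
      exact Or.inl this
    · exact Or.inr ⟨A', l', σ', he, this⟩

theorem exists_global_form {Φ : OpenPartialHomeomorph Total Total} (hs : IsPreconnected Φ.source)
    (hfib : ∀ b : Base, IsPreconnected {v : ℝ | (b, v) ∈ Φ.source})
    (h : ∀ p ∈ Φ.source, FormAt Φ p) :
    ∃ (A : SL2) (l : Fin 4 → ℝ) (σ : ℝ) (f : Base → ℝ),
      σ ≠ 0 ∧ IsSolutionOn f (Prod.fst '' Φ.source) ∧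
      ∀ q ∈ Φ.source, den A q.1.1 ≠ 0 ∧ Φ q = formula A l σ f q := by
  obtain ⟨A, l, σ, hσ, hform⟩ := exists_formWith hs h
  -- This is the summand as a function on the total space. Locally it depends on (t, x, y) only, so
  -- it is constant on each connected fibre and descends to the projection.
  set k : Total → ℝ := fun p => (multiplier A l σ p.1)⁻¹ * (Φ p).2 - p.2 with hk
  have hkf : ∀ {p : Total} {f : Base → ℝ}, den A p.1.1 ≠ 0 → Φ =ᶠ[𝓝 p] formula A l σ f →
      ∀ᶠ q in 𝓝 p, k q = f q.1 := by
    intro p f hd he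
    filter_upwards [he, continuous_fst.continuousAt.eventually (eventually_den_ne A hd)]
      with q h1 h2
    simp only [hk, h1, formula]
    rw [← mul_assoc, inv_mul_cancel₀ (multiplier_ne_zero l h2 hσ)]
    ring
  have hconst : ∀ (b : Base) (v w : ℝ), (b, v) ∈ Φ.source → (b, w) ∈ Φ.source →
      k (b, v) = k (b, w) := by
    intro b v w hv hw
    have hder : ∀ s ∈ {v : ℝ | (b, v) ∈ Φ.source}, HasDerivAt (fun s => k (b, s)) 0 s := by
      intro s hs
      obtain ⟨hd, f, -, he⟩ := hform (b, s) hs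
      have hc : ContinuousAt (fun s : ℝ => (b, s)) s := by fun_prop
      exact (hasDerivAt_const s (f b)).congr_of_eventuallyEq (hc.eventually (hkf hd he))
    have ho : IsOpen {v : ℝ | (b, v) ∈ Φ.source} := Φ.open_source.preimage (by fun_prop)
    exact ho.is_const_of_deriv_eq_zero (hfib b)
      (fun s hs => (hder s hs).differentiableAt.differentiableWithinAt)
      (fun s hs => (hder s hs).deriv) hv hw
  classical
  set f : Base → ℝ := fun b => if hb : ∃ v, (b, v) ∈ Φ.source then k (b, hb.choose) else 0 with hf
  have hfk : ∀ q ∈ Φ.source, f q.1 = k q := by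
    intro q hq
    have hb : ∃ v, (q.1, v) ∈ Φ.source := ⟨q.2, hq⟩
    simp only [hf, dif_pos hb]
    exact hconst _ _ _ hb.choose_spec hq
  refine ⟨A, l, σ, f, hσ, ?_, fun q hq => ?_⟩
  · rw [isSolutionOn_iff (isOpenMap_fst _ Φ.open_source)]
    rintro _ ⟨q, hq, rfl⟩
    obtain ⟨hd, g, hg, he⟩ := hform q hq
    refine hg.congr ?_
    have hc : ContinuousAt (fun b : Base => (b, q.2)) q.1 := by fun_prop
    filter_upwards [hc.eventually (hkf hd he), hc.eventually (Φ.open_source.mem_nhds hq)]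
      with b h1 h2
    rw [← h1]
    exact (hfk _ h2).symm
  · obtain ⟨hd, g, hg, he⟩ := hform q hq
    refine ⟨hd, ?_⟩
    have h1 := (hkf hd he).self_of_nhds
    rw [he.self_of_nhds, formula, formula, hfk q hq, h1]

end Kolmogorov

/-! ### Closure properties of G and its splitting -/

namespace Kolmogorov

variable {A A' : SL2} {l l' : Fin 4 → ℝ} {σ σ' : ℝ} {f f' : Base → ℝ} {Ω Ω' : Set Base}
  {Φ Ψ : OpenPartialHomeomorph Total Total}

theorem isSolutionOn_zero : IsSolutionOn 0 Set.univ :=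
  (isSolutionOn_iff isOpen_univ).2 fun b _ => solAt_zero b

theorem HasForm.apply (h : HasForm A l σ f Ω Φ) {p : Total} (hp : p ∈ Φ.source) :
    Φ p = formula A l σ f p := h.2 hp

theorem HasForm.mem_source (h : HasForm A l σ f Ω Φ) {p : Total} :
    p ∈ Φ.source ↔ p.1 ∈ Ω ∧ den A p.1.1 ≠ 0 := by
  rw [h.1]; rfl

theorem HasForm.mem_trans_source (h : HasForm A l σ f Ω Φ) (h' : HasForm A' l' σ' f' Ω' Ψ)
    {p : Total} : p ∈ (Φ.trans Ψ).source ↔ (p.1 ∈ Ω ∧ den A p.1.1 ≠ 0) ∧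
      baseMap A l p.1 ∈ Ω' ∧ den A' (baseMap A l p.1).1 ≠ 0 := by
  rw [Φ.trans_source, Set.mem_inter_iff, Set.mem_preimage, h.mem_source, h'.mem_source]
  refine and_congr_right fun hp => ?_
  rw [h.apply (h.mem_source.2 hp)]
  rfl

theorem HasForm.trans_apply (h : HasForm A l σ f Ω Φ) (h' : HasForm A' l' σ' f' Ω' Ψ)
    {p : Total} (hp : p ∈ (Φ.trans Ψ).source) :
    Φ.trans Ψ p = formula A' l' σ' f' (formula A l σ f p) := by
  rw [Φ.trans_source] at hp
  rw [← h.apply hp.1, ← h'.apply hp.2]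
  rfl

/-- The domain of the summand of a composition. -/
def compDomain (A : SL2) (l : Fin 4 → ℝ) (A' : SL2) (Ω Ω' : Set Base) : Set Base :=
  {b | (b ∈ Ω ∧ den A b.1 ≠ 0) ∧ baseMap A l b ∈ Ω' ∧ den A' (baseMap A l b).1 ≠ 0}

theorem isOpen_compDomain (hΩ : IsOpen Ω) (hΩ' : IsOpen Ω') :
    IsOpen (compDomain A l A' Ω Ω') := by
  have h := hΩ.inter (isOpen_preimage_baseMap (A := A) (l := l)
    (hΩ'.inter (isOpen_den_ne A')))
  convert h using 1
  ext b
  simp only [compDomain, Set.mem_ofPred_eq, Set.mem_inter_iff]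
  tauto

theorem isSolutionOn_compSummand (hσ : σ ≠ 0) (hΩ : IsOpen Ω) (hΩ' : IsOpen Ω')
    (hf : IsSolutionOn f Ω) (hf' : IsSolutionOn f' Ω') :
    IsSolutionOn (compSummand A l σ f f') (compDomain A l A' Ω Ω') :=
  (isSolutionOn_iff (isOpen_compDomain hΩ hΩ')).2 fun b hb =>
    ((isSolutionOn_iff hΩ).1 hf b hb.1.1).compSummand hσ hb.1.2
      ((isSolutionOn_iff hΩ').1 hf' _ hb.2.1)

theorem HasForm.trans (hσ : σ ≠ 0) (h : HasForm A l σ f Ω Φ) (h' : HasForm A' l' σ' f' Ω' Ψ) :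
    HasForm (A' * A) (l + pull A l') (σ' * σ * Real.exp (cocycle A l l'))
      (compSummand A l σ f f') (compDomain A l A' Ω Ω') (Φ.trans Ψ) := by
  refine ⟨?_, fun p hp => ?_⟩
  · ext p
    rw [h.mem_trans_source h']
    -- The natural domain also demands a non-zero denominator for the product matrix. On the domain
    -- of the composition this is automatic, since the denominators multiply.
    refine ⟨fun hp => ⟨hp, ?_⟩, fun hp => hp.1⟩
    rw [den_mul A' A l hp.1.2]
    exact mul_ne_zero hp.2.2 hp.1.2
  · have hp' := (h.mem_trans_source h').1 hp
    rw [h.trans_apply h' hp, formula_comp hσ hp'.1.2 hp'.2.2]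

theorem HasForm.symm (hσ : σ ≠ 0) (h : HasForm A l σ f Ω Φ) :
    HasForm A⁻¹ (invShift A l) (invScale A l σ) (invSummand A l σ f)
      {b | den A⁻¹ b.1 ≠ 0 ∧ baseMap A⁻¹ (invShift A l) b ∈ Ω} Φ.symm := by
  have key : ∀ q ∈ Φ.target, Φ.symm q = formulaInv A l σ f q ∧ den A⁻¹ q.1.1 ≠ 0 := by
    intro q hq
    have hp := Φ.map_target hq
    have hd := (h.mem_source.1 hp).2
    have hq' := h.apply hp
    rw [Φ.right_inv hq] at hq'
    refine ⟨?_, ?_⟩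
    · conv_rhs => rw [hq']
      rw [formulaInv_formula hσ hd]
    · rw [hq']
      exact den_inv_ne l hd
  refine ⟨?_, fun q hq => ?_⟩
  · ext q
    constructor
    · intro hq
      have h1 := key q hq
      have h2 := (h.mem_source.1 (Φ.map_target hq)).1
      rw [h1.1] at h2
      exact ⟨⟨h1.2, h2⟩, h1.2⟩
    · rintro ⟨⟨h1, h2⟩, -⟩
      have h3 : formulaInv A l σ f q ∈ Φ.source := h.mem_source.2 ⟨h2, den_ne_of_inv _ h1⟩
      have h4 := Φ.map_source h3
      rwa [h.apply h3, formula_formulaInv hσ h1] at h4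
  · rw [(key q hq).1, formulaInv_eq hσ (key q hq).2]

theorem isSolutionOn_invSummand (hσ : σ ≠ 0) (hΩ : IsOpen Ω) (hf : IsSolutionOn f Ω) :
    IsSolutionOn (invSummand A l σ f)
      {b | den A⁻¹ b.1 ≠ 0 ∧ baseMap A⁻¹ (invShift A l) b ∈ Ω} := by
  refine (isSolutionOn_iff (isOpen_preimage_baseMap hΩ)).2 fun b hb => ?_
  have := ((isSolutionOn_iff hΩ).1 hf _ hb.2).invSummand (l := l) hσ (den_ne_of_inv _ hb.1)
  rwa [baseMap_inv_right l hb.1] at this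

theorem groupG_trans (hΦ : Φ ∈ groupG) (hΨ : Ψ ∈ groupG) : Φ.trans Ψ ∈ groupG := by
  obtain ⟨A, l, σ, f, Ω, hσ, hΩ, hf, h⟩ := hΦ
  obtain ⟨A', l', σ', f', Ω', hσ', hΩ', hf', h'⟩ := hΨ
  exact ⟨_, _, _, _, _, mul_ne_zero (mul_ne_zero hσ' hσ) (Real.exp_ne_zero _),
    isOpen_compDomain hΩ hΩ', isSolutionOn_compSummand hσ hΩ hΩ' hf hf', h.trans hσ h'⟩

theorem groupG_symm (hΦ : Φ ∈ groupG) : Φ.symm ∈ groupG := by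
  obtain ⟨A, l, σ, f, Ω, hσ, hΩ, hf, h⟩ := hΦ
  exact ⟨_, _, _, _, _, invScale_ne_zero l hσ, isOpen_preimage_baseMap hΩ,
    isSolutionOn_invSummand hσ hΩ hf, h.symm hσ⟩

theorem groupEss_subset_groupG : groupEss ⊆ groupG := fun _ ⟨A, l, σ, hσ, h⟩ =>
  ⟨A, l, σ, 0, Set.univ, hσ, isOpen_univ, isSolutionOn_zero, h⟩

theorem formula_one (f : Base → ℝ) (p : Total) : formula 1 0 1 f p = (p.1, p.2 + f p.1) := by
  rw [formula, baseMap_one_zero, multiplier_one_zero, one_mul]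

theorem mem_groupLin_iff : Φ ∈ groupLin ↔ ∃ (f : Base → ℝ) (Ω : Set Base), IsOpen Ω ∧
    IsSolutionOn f Ω ∧ HasForm 1 0 1 f Ω Φ := by
  simp only [groupLin, HasForm, naturalDomain, Set.EqOn, formula_one, den_one, Set.mem_ofPred_eq,
    ne_eq, one_ne_zero, not_false_eq_true, and_true]

theorem groupLin_subset_groupG : groupLin ⊆ groupG := fun L hL => by
  obtain ⟨f, Ω, hΩ, hf, h⟩ := mem_groupLin_iff.1 hL
  exact ⟨1, 0, 1, f, Ω, one_ne_zero, hΩ, hf, h⟩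

theorem pair_zero_left (l : Fin 4 → ℝ) : pair 0 l = 0 := by simp [pair]

theorem cocycle_zero_right (A : SL2) (l : Fin 4 → ℝ) : cocycle A l 0 = 0 := by
  simp [cocycle, pullShift, pull_zero, pair_zero_left]

theorem groupLin_trans (hΦ : Φ ∈ groupLin) (hΨ : Ψ ∈ groupLin) : Φ.trans Ψ ∈ groupLin := by
  obtain ⟨f, Ω, hΩ, hf, h⟩ := mem_groupLin_iff.1 hΦ
  obtain ⟨f', Ω', hΩ', hf', h'⟩ := mem_groupLin_iff.1 hΨ
  have := h.trans one_ne_zero h'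
  rw [cocycle_zero_right, pull_zero, Real.exp_zero, mul_one, mul_one, mul_one, add_zero] at this
  exact mem_groupLin_iff.2 ⟨_, _, isOpen_compDomain hΩ hΩ',
    isSolutionOn_compSummand one_ne_zero hΩ hΩ' hf hf', this⟩

theorem groupLin_symm (hΦ : Φ ∈ groupLin) : Φ.symm ∈ groupLin := by
  obtain ⟨f, Ω, hΩ, hf, h⟩ := mem_groupLin_iff.1 hΦ
  have := h.symm one_ne_zero
  have h0 : invShift 1 0 = 0 := by rw [invShift, pull_zero, neg_zero]
  have h1 : invScale 1 0 1 = 1 := by simp [invScale, pull_zero, pair_zero_left]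
  have hs := isSolutionOn_invSummand (A := 1) (l := 0) one_ne_zero hΩ hf
  have ho := isOpen_preimage_baseMap (A := 1⁻¹) (l := invShift 1 0) hΩ
  rw [inv_one, h0, h1] at this
  rw [inv_one, h0] at hs ho
  exact mem_groupLin_iff.2 ⟨_, _, ho, hs, this⟩

/-- `G^lin` is normal in `G`. -/
theorem groupLin_conj (hΦ : Φ ∈ groupG) (hΨ : Ψ ∈ groupLin) :
    (Φ.symm.trans Ψ).trans Φ ∈ groupLin := by
  obtain ⟨A, l, σ, f, Ω, hσ, hΩ, hf, h⟩ := hΦ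
  obtain ⟨f', Ω', hΩ', hf', h'⟩ := mem_groupLin_iff.1 hΨ
  have hs := h.symm hσ
  have hs0 := invScale_ne_zero l (A := A) hσ
  have h1 := hs.trans hs0 h'
  have h10 : 1 * invScale A l σ * Real.exp (cocycle A⁻¹ (invShift A l) 0) ≠ 0 := by
    rw [one_mul]; exact mul_ne_zero hs0 (Real.exp_ne_zero _)
  have h2 := h1.trans h10 h
  have ho := isOpen_preimage_baseMap (A := A⁻¹) (l := invShift A l) hΩ
  have s1 := isSolutionOn_compSummand (A := A⁻¹) (A' := 1) (l := invShift A l) hs0 ho hΩ'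
    (isSolutionOn_invSummand hσ hΩ hf) hf'
  have o1 := isOpen_compDomain (A := A⁻¹) (A' := 1) (l := invShift A l) ho hΩ'
  have s2 := isSolutionOn_compSummand (A := 1 * A⁻¹) (A' := A) (l := invShift A l + pull A⁻¹ 0)
    h10 o1 hΩ s1 hf
  have o2 := isOpen_compDomain (A := 1 * A⁻¹) (A' := A) (l := invShift A l + pull A⁻¹ 0) o1 hΩ
  refine mem_groupLin_iff.2 ⟨_, _, o2, s2, ?_⟩
  -- Conjugation cancels the matrix, the shift and, through the cocycle of the inverse, the scale.
  -- Only the summand survives.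
  have e1 : A * (1 * A⁻¹) = 1 := by rw [one_mul, mul_inv_cancel]
  have e2 : invShift A l + pull A⁻¹ 0 + pull (1 * A⁻¹) l = 0 := by
    rw [pull_zero, add_zero, one_mul, invShift_add_pull]
  have e3 : σ * (1 * invScale A l σ * Real.exp (cocycle A⁻¹ (invShift A l) 0))
      * Real.exp (cocycle (1 * A⁻¹) (invShift A l + pull A⁻¹ 0) l) = 1 := by
    rw [cocycle_zero_right, pull_zero, add_zero, one_mul, one_mul, cocycle_inv_right, invScale,
      Real.exp_neg, Real.exp_zero]
    field_simp
  rwa [e1, e2, e3] at h2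

theorem HasForm.eqOnSource (h : HasForm A l σ f Ω Φ) (h' : HasForm A l σ f Ω Ψ) : Φ ≈ Ψ :=
  ⟨h.1.trans h'.1.symm, fun p hp => by
    rw [h.apply hp, h'.apply (by rw [h'.1, ← h.1]; exact hp)]⟩

theorem hasForm_refl : HasForm 1 0 1 0 Set.univ (OpenPartialHomeomorph.refl Total) :=
  ⟨by ext p; simp [naturalDomain, den_one], fun p _ => by simp [formula_one]⟩

/-- The splitting of a transformation into the addition of `f`, a shift with a scaling, and an
element of `SL(2, ℝ)`. -/
theorem HasForm.decompose {L R S : OpenPartialHomeomorph Total Total} (hσ : σ ≠ 0)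
    (h : HasForm A l σ f Ω Φ) (hL : HasForm 1 0 1 f Ω L) (hR : HasForm 1 l σ 0 Set.univ R)
    (hS : HasForm A 0 1 0 Set.univ S) : Φ ≈ (L.trans R).trans S := by
  have hsrc : ∀ p, p ∈ Φ.source ↔ p ∈ ((L.trans R).trans S).source := by
    intro p
    rw [h.mem_source, (hL.trans one_ne_zero hR).mem_trans_source hS]
    simp [compDomain, den_one, pull_one, baseMap_one, xHat_zero, yHat_zero]
  refine ⟨Set.ext hsrc, fun p hp => ?_⟩
  have hp' := (hsrc p).1 hp
  have hLR : p ∈ (L.trans R).source := by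
    rw [OpenPartialHomeomorph.trans_source] at hp'
    exact hp'.1
  have hd := (h.mem_source.1 hp).2
  have e : ((L.trans R).trans S) p = S ((L.trans R) p) := rfl
  have hS' : (L.trans R) p ∈ S.source := by
    rw [OpenPartialHomeomorph.trans_source] at hp'
    exact hp'.2
  have e2 : formula 1 l σ 0 (formula 1 0 1 f p) = formula 1 l σ f p := by
    rw [formula_one]
    simp [formula]
  rw [e, hS.apply hS', hL.trans_apply hR hLR, e2, h.apply hp, formula_comp hσ (by simp [den_one])
    (by rwa [baseMap_one]), pull_zero, add_zero, cocycle_zero_right, Real.exp_zero, mul_one,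
    mul_one, one_mul]
  simp [formula, compSummand]

theorem HasForm.lin_trans_ess {L E : OpenPartialHomeomorph Total Total}
    (hL : HasForm 1 0 1 f Ω L) (hE : HasForm A l σ 0 Set.univ E) :
    HasForm A l σ f Ω (L.trans E) := by
  refine ⟨?_, fun p hp => ?_⟩
  · ext p
    rw [hL.mem_trans_source hE]
    simp [den_one, baseMap_one_zero, naturalDomain]
  · rw [hL.trans_apply hE hp, formula_one]
    simp [formula]

theorem exists_ess_lin (hΦ : Φ ∈ groupG) : ∃ E ∈ groupEss, ∃ L ∈ groupLin, Φ ≈ L.trans E := by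
  obtain ⟨A, l, σ, f, Ω, hσ, hΩ, hf, h⟩ := hΦ
  have hE := hasForm_transformation (A := A) (l := l) hσ isOpen_univ (contDiffOn_zero _)
  have hL := hasForm_transformation (A := 1) (l := 0) one_ne_zero hΩ hf.1
  exact ⟨_, ⟨A, l, σ, hσ, hE⟩, _, mem_groupLin_iff.2 ⟨f, Ω, hΩ, hf, hL⟩,
    h.eqOnSource (hL.lin_trans_ess hE)⟩

theorem HasForm.params_eq (hσ : σ ≠ 0) (h : HasForm A l σ f Ω Φ) (h' : HasForm A' l' σ' f' Ω' Ψ)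
    (he : Φ ≈ Ψ) {p : Total} (hp : p ∈ Φ.source) :
    A = A' ∧ l = l' ∧ σ = σ' ∧ f p.1 = f' p.1 := by
  have hp' : p ∈ Ψ.source := he.1 ▸ hp
  have key : formula A l σ f =ᶠ[𝓝 p] formula A' l' σ' f' := by
    filter_upwards [Φ.open_source.mem_nhds hp] with q hq
    rw [← h.apply hq, ← h'.apply (he.1 ▸ hq), he.2 hq]
  obtain ⟨h1, h2, h3, h4⟩ := params_unique hσ (h.mem_source.1 hp).2 (h'.mem_source.1 hp').2 key
  exact ⟨h1, h2, h3, h4.self_of_nhds⟩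

/-- Both products carry their parameters openly, and rigidity at one point of the domain identifies
those of `E` and `E'`. Without such a point nothing would be determined. -/
theorem ess_lin_unique {E E' L L' : OpenPartialHomeomorph Total Total} (hE : E ∈ groupEss)
    (hE' : E' ∈ groupEss) (hL : L ∈ groupLin) (hL' : L' ∈ groupLin)
    (h : L.trans E ≈ L'.trans E') (hne : (L.trans E).source.Nonempty) :
    E ≈ E' ∧ Set.EqOn L L' (L.trans E).source := by
  obtain ⟨A, l, σ, hσ, hE⟩ := hE
  obtain ⟨A', l', σ', hσ', hE'⟩ := hE'
  obtain ⟨f, Ω, hΩ, hf, hL⟩ := mem_groupLin_iff.1 hL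
  obtain ⟨f', Ω', hΩ', hf', hL'⟩ := mem_groupLin_iff.1 hL'
  have key := fun p hp => (hL.lin_trans_ess hE).params_eq hσ (hL'.lin_trans_ess hE') h (p := p) hp
  refine ⟨?_, fun p hp => ?_⟩
  · obtain ⟨p, hp⟩ := hne
    obtain ⟨rfl, rfl, rfl, -⟩ := key p hp
    exact hE.eqOnSource hE'
  · have hp' : p ∈ (L'.trans E').source := h.1 ▸ hp
    rw [OpenPartialHomeomorph.trans_source] at hp'
    have hp2 := hp
    rw [OpenPartialHomeomorph.trans_source] at hp2
    rw [hL.apply hp2.1, hL'.apply hp'.1, formula_one, formula_one, (key p hp).2.2.2]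

theorem exists_den_ne (A : SL2) : ∃ t : ℝ, den A t ≠ 0 := by
  by_contra! h
  have h0 := h 0
  have h1 := h 1
  have := det_eq A
  simp only [den] at h0 h1
  have e1 : A 1 1 = 0 := by linear_combination h0
  have e2 : A 1 0 = 0 := by linear_combination h1 - h0
  rw [e1, e2] at this
  simp at this

theorem HasForm.nonempty (h : HasForm A l σ f Set.univ Φ) : Φ.source.Nonempty := by
  obtain ⟨t, ht⟩ := exists_den_ne A
  exact ⟨((t, 0, 0), 0), h.mem_source.2 ⟨trivial, ht⟩⟩

theorem ess_inter_lin (hE : Φ ∈ groupEss) (hL : Φ ∈ groupLin) :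
    Φ ≈ OpenPartialHomeomorph.refl Total := by
  obtain ⟨A, l, σ, hσ, h⟩ := hE
  obtain ⟨f, Ω, hΩ, hf, h'⟩ := mem_groupLin_iff.1 hL
  obtain ⟨p, hp⟩ := h.nonempty
  obtain ⟨rfl, rfl, rfl, -⟩ := h.params_eq hσ h' (Setoid.refl _) hp
  exact h.eqOnSource hasForm_refl

end Kolmogorov

/-! ### The modified composition -/

namespace Kolmogorov

section ModifiedComposition

theorem den_eq_zero_subsingleton (A : SL2) : {t : ℝ | den A t = 0}.Subsingleton := by
  intro t ht s hs
  have h := det_eq A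
  have ht' : A 1 0 * t + A 1 1 = 0 := ht
  have hs' : A 1 0 * s + A 1 1 = 0 := hs
  linear_combination (s - t) * h - A 0 0 * s * ht' + A 0 0 * t * hs' - A 0 1 * ht' + A 0 1 * hs'

theorem dense_den_ne (A B : SL2) : Dense {p : Total | den A p.1.1 ≠ 0 ∧ den B p.1.1 ≠ 0} := by
  have h : ({t : ℝ | den A t = 0} ∪ {t | den B t = 0}).Countable :=
    (den_eq_zero_subsingleton A).countable.union (den_eq_zero_subsingleton B).countable
  have hd := (h.dense_compl ℝ).preimage (f := fun p : Total => p.1.1)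
    (isOpenMap_fst.comp isOpenMap_fst)
  convert hd using 1
  ext p
  simp

/-- The transformation with the composed parameters is the modified composition. -/
theorem isModifiedComp_of_hasForm {A A' : SL2} {l l' : Fin 4 → ℝ} {σ σ' : ℝ}
    {Φ₁ Φ₂ Ψ : OpenPartialHomeomorph Total Total} (hσ : σ ≠ 0)
    (h₁ : HasForm A' l' σ' 0 Set.univ Φ₁) (h₂ : HasForm A l σ 0 Set.univ Φ₂)
    (h : HasForm (A' * A) (l + pull A l') (σ' * σ * Real.exp (cocycle A l l')) 0 Set.univ Ψ) :
    IsModifiedComp Φ₁ Φ₂ Ψ := by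
  set C := (Φ₂.trans Φ₁).source with hC
  have memC : ∀ {p : Total}, p ∈ C ↔ den A p.1.1 ≠ 0 ∧ den (A' * A) p.1.1 ≠ 0 := by
    intro p
    rw [hC, h₂.mem_trans_source h₁]
    simp only [Set.mem_univ, true_and]
    refine and_congr_right fun hp => ?_
    rw [den_mul A' A l hp]
    exact ⟨fun h => mul_ne_zero h hp, left_ne_zero_of_mul⟩
  have mem : ∀ {p : Total}, p ∈ Ψ.source ↔ den (A' * A) p.1.1 ≠ 0 := by
    intro p
    rw [h.mem_source]
    simp
  have happly : ∀ p ∈ C, formula (A' * A) (l + pull A l') (σ' * σ * Real.exp (cocycle A l l')) 0 p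
      = Φ₂.trans Φ₁ p := by
    intro p hp
    have hp' := (h₂.mem_trans_source h₁).1 hp
    rw [h₂.trans_apply h₁ hp, formula_comp hσ hp'.1.2 hp'.2.2]
    simp [formula, compSummand]
  have hclosure : ∀ p, p ∈ closure C := by
    have : C = {p : Total | den A p.1.1 ≠ 0 ∧ den (A' * A) p.1.1 ≠ 0} := Set.ext fun p => memC
    rw [this]
    exact dense_den_ne A (A' * A)
  have hlim : ∀ p ∈ Ψ.source, Filter.Tendsto (Φ₂.trans Φ₁) (𝓝[C] p) (𝓝 (Ψ p)) := by
    intro p hp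
    rw [h.apply hp]
    have hc : ContinuousAt (formula (A' * A) (l + pull A l')
        (σ' * σ * Real.exp (cocycle A l l')) 0) p :=
      (contDiffAt_formula (mem.1 hp) contDiffAt_const).continuousAt
    exact (hc.mono_left nhdsWithin_le_nhds).congr' (eventually_mem_nhdsWithin.mono happly)
  refine ⟨?_, hlim⟩
  -- The composition extends across the zeros of the inner denominator but not across those of the
  -- denominator of the product. A finite limit of t̃ there would make the numerator vanish too,
  -- contradicting determinant one.
  have hS : {p | p ∈ closure C ∧ ∃ q, Filter.Tendsto (Φ₂.trans Φ₁) (𝓝[C] p) (𝓝 q)} = Ψ.source := by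
    ext p
    refine ⟨?_, fun hp => ⟨hclosure p, _, hlim p hp⟩⟩
    rintro ⟨hp, q, hq⟩
    rw [mem]
    intro h0
    have : (𝓝[C] p).NeBot := mem_closure_iff_nhdsWithin_neBot.1 hp
    set B := A' * A with hB
    have t1 : Filter.Tendsto (fun r : Total => (Φ₂.trans Φ₁ r).1.1) (𝓝[C] p) (𝓝 q.1.1) :=
      ((continuous_fst.comp continuous_fst).tendsto q).comp hq
    have cden : Continuous fun r : Total => den B r.1.1 :=
      (contDiff_den B).continuous.comp continuous_fst
    have t2 : Filter.Tendsto (fun r : Total => den B r.1.1) (𝓝[C] p) (𝓝 0) := by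
      rw [← h0]
      exact (cden.tendsto p).mono_left nhdsWithin_le_nhds
    have t3 := t1.mul t2
    have cnum : Continuous fun r : Total => B 0 0 * r.1.1 + B 0 1 := by fun_prop
    have t4 : Filter.Tendsto (fun r : Total => B 0 0 * r.1.1 + B 0 1) (𝓝[C] p)
        (𝓝 (B 0 0 * p.1.1 + B 0 1)) := (cnum.tendsto p).mono_left nhdsWithin_le_nhds
    have t5 : Filter.Tendsto (fun r : Total => B 0 0 * r.1.1 + B 0 1) (𝓝[C] p)
        (𝓝 (q.1.1 * 0)) := t3.congr' (eventually_mem_nhdsWithin.mono fun r hr => by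
      rw [← happly r hr]
      exact div_mul_cancel₀ (B 0 0 * r.1.1 + B 0 1) (memC.1 hr).2)
    have e := tendsto_nhds_unique t4 t5
    have hdet := det_eq B
    have h0' : B 1 0 * p.1.1 + B 1 1 = 0 := h0
    exact one_ne_zero (α := ℝ) (by linear_combination B 0 0 * h0' - B 1 0 * e - hdet)
  rw [hS, Ψ.open_source.interior_eq]

end ModifiedComposition

/-! ### The Heisenberg group and the action of SL(2, ℝ) on it -/

section HeisenbergGroup

/-- The element of the Heisenberg group for the shift by `l` and the logarithm `c` of a scale. -/
def heisOf (l : Fin 4 → ℝ) (c : ℝ) : heisenbergGroup := heis (3 * l 3) (-l 2) (l 0) (l 1) c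

/-- The shift of an element of the Heisenberg group. -/
noncomputable def heisShift (h : heisenbergGroup) : Fin 4 → ℝ :=
  ![h.1.1 1 3, h.1.1 2 3, -h.1.1 0 2, h.1.1 0 1 / 3]

/-- The logarithmic scale of an element of the Heisenberg group. -/
def heisLog (h : heisenbergGroup) : ℝ := h.1.1 0 3

theorem heisShift_heisOf (l : Fin 4 → ℝ) (c : ℝ) : heisShift (heisOf l c) = l := by
  apply fin4_ext <;> simp [heisShift, heisOf, heis, heisGL, heisMatrix]

theorem heisLog_heisOf (l : Fin 4 → ℝ) (c : ℝ) : heisLog (heisOf l c) = c := by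
  simp [heisLog, heisOf, heis, heisGL, heisMatrix]

theorem exists_heisOf (h : heisenbergGroup) : ∃ l c, h = heisOf l c := by
  obtain ⟨_, a₁, a₂, b₁, b₂, c, rfl⟩ := h
  refine ⟨![b₁, b₂, -a₂, a₁ / 3], c, Subtype.ext ?_⟩
  have : 3 * (a₁ / 3) = a₁ := by ring
  simp [heisOf, heis, this]

theorem heisOf_shift_log (h : heisenbergGroup) : heisOf (heisShift h) (heisLog h) = h := by
  obtain ⟨l, c, rfl⟩ := exists_heisOf h
  rw [heisShift_heisOf, heisLog_heisOf]

theorem heisOf_mul (l l' : Fin 4 → ℝ) (c c' : ℝ) :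
    heisOf l c * heisOf l' c' = heisOf (l + l') (c + c' + pair l l') := by
  refine Subtype.ext (Units.ext ((heisMatrix_mul _ _ _ _ _ _ _ _ _ _).trans ?_))
  simp only [heisOf, heis, heisGL, pair, Pi.add_apply]
  congr 1 <;> ring

theorem heisOf_zero : heisOf 0 0 = 1 := by
  refine Subtype.ext (Units.ext ?_)
  simp [heisOf, heis, heisGL, heisMatrix_zero]

theorem heisShift_one : heisShift 1 = 0 := by rw [← heisOf_zero, heisShift_heisOf]

theorem heisLog_one : heisLog 1 = 0 := by rw [← heisOf_zero, heisLog_heisOf]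

theorem heisShift_mul (h h' : heisenbergGroup) :
    heisShift (h * h') = heisShift h + heisShift h' := by
  obtain ⟨l, c, rfl⟩ := exists_heisOf h
  obtain ⟨l', c', rfl⟩ := exists_heisOf h'
  simp only [heisOf_mul, heisShift_heisOf]

theorem heisLog_mul (h h' : heisenbergGroup) :
    heisLog (h * h') = heisLog h + heisLog h' + pair (heisShift h) (heisShift h') := by
  obtain ⟨l, c, rfl⟩ := exists_heisOf h
  obtain ⟨l', c', rfl⟩ := exists_heisOf h'
  simp only [heisOf_mul, heisShift_heisOf, heisLog_heisOf]

/-- The right action of `SL(2, ℝ)` on the Heisenberg group. -/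
noncomputable def heisPull (A : SL2) (h : heisenbergGroup) : heisenbergGroup :=
  heisOf (pull A (heisShift h)) (heisLog h + pullShift A (heisShift h))

theorem heisShift_pull (A : SL2) (h : heisenbergGroup) :
    heisShift (heisPull A h) = pull A (heisShift h) := heisShift_heisOf _ _

theorem heisLog_pull (A : SL2) (h : heisenbergGroup) :
    heisLog (heisPull A h) = heisLog h + pullShift A (heisShift h) := heisLog_heisOf _ _

theorem heisPull_heisPull (A B : SL2) (h : heisenbergGroup) :
    heisPull B (heisPull A h) = heisPull (A * B) h := by
  rw [heisPull, heisShift_pull, heisLog_pull, heisPull, pull_mul]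
  congr 1
  simp only [pullShift, pull_mul]
  ring

theorem heisPull_one (h : heisenbergGroup) : heisPull 1 h = h := by
  rw [heisPull, pull_one, pullShift, pull_one, sub_self, zero_div, add_zero, heisOf_shift_log]

/-- `pull` alone does not preserve the cocycle `pair`. Its antisymmetrization is invariant, so the
defect is a symmetric form, hence the coboundary of the quadratic function `pullShift` that corrects
the central coordinate. -/
theorem heisPull_mul (A : SL2) (h h' : heisenbergGroup) :
    heisPull A (h * h') = heisPull A h * heisPull A h' := by
  simp only [heisPull, heisOf_mul, heisShift_mul, heisLog_mul, pull_add]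
  congr 1
  have := pair_pull_antisymm A (heisShift h) (heisShift h')
  simp only [pullShift, pull_add, pair_add_left, pair_add_right]
  linear_combination (-1 / 2) * this

/-- The automorphism of the Heisenberg group induced by an element of `SL(2, ℝ)`. -/
noncomputable def heisAut (A : SL2) : MulAut heisenbergGroup where
  toFun := heisPull A⁻¹
  invFun := heisPull A
  left_inv h := by rw [heisPull_heisPull, inv_mul_cancel, heisPull_one]
  right_inv h := by rw [heisPull_heisPull, mul_inv_cancel, heisPull_one]
  map_mul' := heisPull_mul A⁻¹

/-- The action of `SL(2, ℝ)` defining the semidirect product. -/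
noncomputable def essAction : SL2 →* MulAut (heisenbergGroup × ℤˣ) where
  toFun A := (heisAut A).prodCongr (MulEquiv.refl _)
  map_one' := by
    ext1 n
    exact Prod.ext (by
      change heisPull 1⁻¹ n.1 = n.1
      rw [inv_one, heisPull_one]) rfl
  map_mul' A B := by
    ext1 n
    exact Prod.ext (by
      change heisPull (A * B)⁻¹ n.1 = heisPull A⁻¹ (heisPull B⁻¹ n.1)
      rw [heisPull_heisPull, mul_inv_rev]) rfl

theorem essAction_inv_apply (A : SL2) (n : heisenbergGroup × ℤˣ) :
    essAction A⁻¹ n = (heisPull A n.1, n.2) := by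
  change (heisPull A⁻¹⁻¹ n.1, n.2) = _
  rw [inv_inv]

end HeisenbergGroup

/-! ### The isomorphism with the semidirect product -/

section EssentialGroup

/-- The semidirect product of `SL(2, ℝ)` and the product of the Heisenberg group and `ℤ₂`. -/
abbrev EssGroup : Type := (heisenbergGroup × ℤˣ) ⋊[essAction] SL2

/-- The element `n` for which `g` is the product of an element of `SL(2, ℝ)` and `n`. -/
noncomputable def rightFactor (g : EssGroup) : heisenbergGroup × ℤˣ :=
  essAction g.right⁻¹ g.left

/-- `SemidirectProduct` stores an element with the normal factor on the left, whereas the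
transformations apply the shift first, which corresponds to A · n. In the latter order the product
law is that of the parameters. -/
theorem rightFactor_mul (g g' : EssGroup) :
    rightFactor (g * g') = essAction g'.right⁻¹ (rightFactor g) * rightFactor g' := by
  simp only [rightFactor, SemidirectProduct.mul_left, SemidirectProduct.mul_right, mul_inv_rev,
    map_mul, MulAut.mul_apply]
  have e : essAction g.right⁻¹ (essAction g.right g'.left) = g'.left := by
    rw [← MulAut.mul_apply, ← map_mul, inv_mul_cancel, map_one, MulAut.one_apply]
  rw [e]

theorem rightFactor_inr_mul_inl (A : SL2) (n : heisenbergGroup × ℤˣ) :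
    rightFactor (SemidirectProduct.inr A * SemidirectProduct.inl n) = n := by
  simp only [rightFactor, SemidirectProduct.mul_left, SemidirectProduct.mul_right,
    SemidirectProduct.right_inr, SemidirectProduct.left_inr, SemidirectProduct.left_inl,
    SemidirectProduct.right_inl, mul_one, one_mul]
  rw [← MulAut.mul_apply, ← map_mul, inv_mul_cancel, map_one, MulAut.one_apply]

theorem rightFactor_ext {g g' : EssGroup} (h : g.right = g'.right)
    (h' : rightFactor g = rightFactor g') : g = g' := by
  refine SemidirectProduct.ext ?_ h
  rw [rightFactor, rightFactor, h] at h'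
  exact (essAction g'.right⁻¹).injective h'

/-- The parameters `λ₀, …, λ₃` of an element of the semidirect product. -/
noncomputable def essShift (g : EssGroup) : Fin 4 → ℝ := heisShift (rightFactor g).1

/-- The parameter `σ` of an element of the semidirect product. -/
noncomputable def essScale (g : EssGroup) : ℝ :=
  (((rightFactor g).2 : ℤ) : ℝ) * Real.exp (heisLog (rightFactor g).1)

theorem essScale_ne_zero (g : EssGroup) : essScale g ≠ 0 := by
  refine mul_ne_zero ?_ (Real.exp_ne_zero _)
  exact_mod_cast (rightFactor g).2.ne_zero

theorem essShift_mul (g g' : EssGroup) :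
    essShift (g * g') = essShift g' + pull g'.right (essShift g) := by
  rw [essShift, rightFactor_mul, essAction_inv_apply, Prod.fst_mul, heisShift_mul, heisShift_pull,
    add_comm]
  rfl

theorem essScale_mul (g g' : EssGroup) : essScale (g * g') =
    essScale g * essScale g' * Real.exp (cocycle g'.right (essShift g') (essShift g)) := by
  rw [essScale, rightFactor_mul, essAction_inv_apply, Prod.fst_mul, Prod.snd_mul, heisLog_mul,
    heisLog_pull, heisShift_pull, essScale, essScale, cocycle, essShift, essShift]
  simp only [Real.exp_add, Units.val_mul, Int.cast_mul]
  ring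

theorem rightFactor_one : rightFactor 1 = 1 := by simp [rightFactor]

theorem essShift_one : essShift 1 = 0 := by rw [essShift, rightFactor_one]; exact heisShift_one

theorem essScale_one : essScale 1 = 1 := by
  rw [essScale, rightFactor_one]
  simp [heisLog_one]

theorem eq_of_params_eq {g g' : EssGroup} (hA : g.right = g'.right)
    (hl : essShift g = essShift g') (hσ : essScale g = essScale g') : g = g' := by
  have hz : (rightFactor g).2 = (rightFactor g').2 ∧
      heisLog (rightFactor g).1 = heisLog (rightFactor g').1 := by
    simp only [essScale] at hσ
    have p := Real.exp_pos (heisLog (rightFactor g).1)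
    have p' := Real.exp_pos (heisLog (rightFactor g').1)
    rcases Int.units_eq_one_or (rightFactor g).2 with h | h <;>
    rcases Int.units_eq_one_or (rightFactor g').2 with h' | h' <;> rw [h, h'] at hσ ⊢
    · exact ⟨rfl, Real.exp_injective (by simpa using hσ)⟩
    · simp at hσ; linarith
    · simp at hσ; linarith
    · exact ⟨rfl, Real.exp_injective (by simpa using hσ)⟩
  refine rightFactor_ext hA (Prod.ext ?_ hz.1)
  rw [← heisOf_shift_log (rightFactor g).1, ← heisOf_shift_log (rightFactor g').1, hz.2]
  exact congrArg (heisOf · _) hl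

/-- The transformation corresponding to an element of the semidirect product. -/
noncomputable def essMap (g : EssGroup) : OpenPartialHomeomorph Total Total :=
  homogeneous g.right (essShift g) (essScale_ne_zero g)

theorem hasForm_essMap (g : EssGroup) :
    HasForm g.right (essShift g) (essScale g) 0 Set.univ (essMap g) :=
  hasForm_transformation (essScale_ne_zero g) isOpen_univ (contDiffOn_zero _)

theorem essMap_mem (g : EssGroup) : essMap g ∈ groupEss :=
  ⟨_, _, _, essScale_ne_zero g, hasForm_essMap g⟩

theorem hasForm_essMap_inr_inl (A : SL2) (l : Fin 4 → ℝ) (c : ℝ) (z : ℤˣ) :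
    HasForm A l (((z : ℤ) : ℝ) * Real.exp c) 0 Set.univ
      (essMap (SemidirectProduct.inr A * SemidirectProduct.inl (heisOf l c, z))) := by
  have := hasForm_essMap (SemidirectProduct.inr A * SemidirectProduct.inl (heisOf l c, z))
  rwa [essShift, essScale, rightFactor_inr_mul_inl, heisShift_heisOf, heisLog_heisOf,
    SemidirectProduct.mul_right, SemidirectProduct.right_inr, SemidirectProduct.right_inl,
    mul_one] at this

theorem exists_units_mul_exp {σ : ℝ} (hσ : σ ≠ 0) :
    ∃ (z : ℤˣ) (c : ℝ), σ = ((z : ℤ) : ℝ) * Real.exp c := by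
  rcases lt_or_gt_of_ne hσ with h | h
  · exact ⟨-1, Real.log (-σ), by rw [Real.exp_log (by linarith)]; simp⟩
  · exact ⟨1, Real.log σ, by rw [Real.exp_log h]; simp⟩

theorem exists_essMap {Φ : OpenPartialHomeomorph Total Total} (hΦ : Φ ∈ groupEss) :
    ∃ g, essMap g ≈ Φ := by
  obtain ⟨A, l, σ, hσ, h⟩ := hΦ
  obtain ⟨z, c, rfl⟩ := exists_units_mul_exp hσ
  exact ⟨_, (hasForm_essMap_inr_inl A l c z).eqOnSource h⟩

theorem essMap_injective {g g' : EssGroup} (h : essMap g ≈ essMap g') : g = g' := by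
  obtain ⟨p, hp⟩ := (hasForm_essMap g).nonempty
  obtain ⟨h1, h2, h3, -⟩ :=
    (hasForm_essMap g).params_eq (essScale_ne_zero g) (hasForm_essMap g') h hp
  exact eq_of_params_eq h1 h2 h3

theorem isModifiedComp_essMap (g g' : EssGroup) :
    IsModifiedComp (essMap g) (essMap g') (essMap (g * g')) := by
  have := hasForm_essMap (g * g')
  rw [essShift_mul, essScale_mul, SemidirectProduct.mul_right] at this
  exact isModifiedComp_of_hasForm (essScale_ne_zero g') (hasForm_essMap g) (hasForm_essMap g') this

theorem essMap_one : essMap 1 ≈ OpenPartialHomeomorph.refl Total := by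
  have := hasForm_essMap 1
  rw [essShift_one, essScale_one, SemidirectProduct.one_right] at this
  exact this.eqOnSource hasForm_refl

/-- The parameters of `g⁻¹` are solved for from the product law applied to `g * g⁻¹ = 1`, and they
agree with those of the inverse map. -/
theorem essMap_inv (g : EssGroup) : essMap g⁻¹ ≈ (essMap g).symm := by
  have h := hasForm_essMap g⁻¹
  have h' := (hasForm_essMap g).symm (essScale_ne_zero g)
  have e0 : (g⁻¹).right = g.right⁻¹ := rfl
  have e1 : essShift g⁻¹ = invShift g.right (essShift g) := by
    have := essShift_mul g g⁻¹
    rw [mul_inv_cancel, essShift_one, e0] at this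
    rw [invShift]
    exact eq_neg_of_add_eq_zero_left this.symm
  have e2 : essScale g⁻¹ = invScale g.right (essShift g) (essScale g) := by
    have := essScale_mul g g⁻¹
    rw [mul_inv_cancel, essScale_one, e0, e1, cocycle_inv_right, Real.exp_neg] at this
    have h0 := essScale_ne_zero g
    have h1 := Real.exp_ne_zero ((pair (pull g.right⁻¹ (essShift g)) (pull g.right⁻¹ (essShift g))
      + pair (essShift g) (essShift g)) / 2)
    rw [invScale]
    field_simp at this ⊢
    exact this.symm
  rw [e0, e1, e2] at h
  have e3 : invSummand g.right (essShift g) (essScale g) 0 = 0 := by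
    ext b
    simp [invSummand]
  rw [e3] at h'
  refine ⟨?_, fun p hp => ?_⟩
  · rw [h.1, h'.1]
    ext p
    simp [naturalDomain]
  · have hp' : p ∈ (essMap g).symm.source := by
      rw [h'.mem_source]
      have := (h.mem_source.1 hp).2
      exact ⟨⟨this, trivial⟩, this⟩
    rw [h.apply hp, h'.apply hp']

end EssentialGroup

end Kolmogorov

/-! ### Assembly of the theorem -/

theorem mainTheorem1 :
    -- the point symmetries form a pseudogroup
    (∃ 𝒢 : StructureGroupoid Kolmogorov.Total,
      ∀ Φ : OpenPartialHomeomorph Kolmogorov.Total Kolmogorov.Total,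
        Φ ∈ 𝒢 ↔ Kolmogorov.IsPointSymmetry Φ) ∧
    -- every transformation of the stated form exists on its natural domain and is a point symmetry
    (∀ (A : Kolmogorov.SL2) (l : Fin 4 → ℝ) (σ : ℝ) (f : Kolmogorov.Base → ℝ)
        (Ω : Set Kolmogorov.Base),
      σ ≠ 0 → IsOpen Ω → Kolmogorov.IsSolutionOn f Ω →
      ∃ Φ : OpenPartialHomeomorph Kolmogorov.Total Kolmogorov.Total,
        Kolmogorov.HasForm A l σ f Ω Φ ∧ Kolmogorov.IsPointSymmetry Φ) ∧
    -- point symmetries are exactly the local diffeomorphisms that are locally of the stated form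
    (∀ Φ : OpenPartialHomeomorph Kolmogorov.Total Kolmogorov.Total,
      Kolmogorov.IsPointSymmetry Φ ↔
        ∀ p ∈ Φ.source, ∃ (A : Kolmogorov.SL2) (l : Fin 4 → ℝ) (σ : ℝ)
          (f : Kolmogorov.Base → ℝ) (Ω : Set Kolmogorov.Base),
          σ ≠ 0 ∧ IsOpen Ω ∧ Kolmogorov.IsSolutionOn f Ω ∧
          ∀ᶠ q in nhds p, q ∈ Kolmogorov.naturalDomain A Ω ∧
            Φ q = Kolmogorov.formula A l σ f q) ∧
    -- they are globally of the stated form if the domain and its vertical fibres are connected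
    (∀ Φ : OpenPartialHomeomorph Kolmogorov.Total Kolmogorov.Total,
      IsPreconnected Φ.source →
      (∀ b : Kolmogorov.Base, IsPreconnected {v : ℝ | (b, v) ∈ Φ.source}) →
      (Kolmogorov.IsPointSymmetry Φ ↔
        ∃ (A : Kolmogorov.SL2) (l : Fin 4 → ℝ) (σ : ℝ) (f : Kolmogorov.Base → ℝ),
          σ ≠ 0 ∧ Kolmogorov.IsSolutionOn f (Prod.fst '' Φ.source) ∧
          ∀ q ∈ Φ.source, Kolmogorov.den A q.1.1 ≠ 0 ∧
            Φ q = Kolmogorov.formula A l σ f q)) ∧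
    -- each transformation is the composition of the addition of `f`, of a transformation with
    -- the parameters `λ₀, …, λ₃, σ` and of one from `SL(2, ℝ)`
    (∀ (A : Kolmogorov.SL2) (l : Fin 4 → ℝ) (σ : ℝ) (f : Kolmogorov.Base → ℝ)
        (Ω : Set Kolmogorov.Base)
        (Φ L R S : OpenPartialHomeomorph Kolmogorov.Total Kolmogorov.Total),
      σ ≠ 0 → IsOpen Ω → Kolmogorov.IsSolutionOn f Ω →
      Kolmogorov.HasForm A l σ f Ω Φ → Kolmogorov.HasForm 1 0 1 f Ω L →
      Kolmogorov.HasForm 1 l σ 0 Set.univ R → Kolmogorov.HasForm A 0 1 0 Set.univ S →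
      Φ ≈ (L.trans R).trans S) ∧
    -- `G` and `G^lin` are closed under composition and inversion, and `G^lin` is normal in `G`
    (∀ Φ ∈ Kolmogorov.groupG, ∀ Ψ ∈ Kolmogorov.groupG, Φ.trans Ψ ∈ Kolmogorov.groupG) ∧
    (∀ Φ ∈ Kolmogorov.groupG, Φ.symm ∈ Kolmogorov.groupG) ∧
    Kolmogorov.groupEss ⊆ Kolmogorov.groupG ∧
    Kolmogorov.groupLin ⊆ Kolmogorov.groupG ∧
    (∀ L ∈ Kolmogorov.groupLin, ∀ L' ∈ Kolmogorov.groupLin,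
      L.trans L' ∈ Kolmogorov.groupLin) ∧
    (∀ L ∈ Kolmogorov.groupLin, L.symm ∈ Kolmogorov.groupLin) ∧
    (∀ Φ ∈ Kolmogorov.groupG, ∀ L ∈ Kolmogorov.groupLin,
      (Φ.symm.trans L).trans Φ ∈ Kolmogorov.groupLin) ∧
    -- `G = G^ess ⋉ G^lin`
    (∀ Φ ∈ Kolmogorov.groupG, ∃ E ∈ Kolmogorov.groupEss, ∃ L ∈ Kolmogorov.groupLin,
      Φ ≈ L.trans E) ∧
    (∀ E ∈ Kolmogorov.groupEss, ∀ E' ∈ Kolmogorov.groupEss,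
      ∀ L ∈ Kolmogorov.groupLin, ∀ L' ∈ Kolmogorov.groupLin,
      L.trans E ≈ L'.trans E' → (L.trans E).source.Nonempty →
      E ≈ E' ∧ Set.EqOn L L' (L.trans E).source) ∧
    (∀ E ∈ Kolmogorov.groupEss, E ∈ Kolmogorov.groupLin →
      E ≈ OpenPartialHomeomorph.refl Kolmogorov.Total) ∧
    -- under the modified composition, `G^ess ≅ SL(2, ℝ) ⋉ (H(2, ℝ) × ℤ₂)`
    (∃ (φ : Kolmogorov.SL2 →* MulAut (Kolmogorov.heisenbergGroup × ℤˣ))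
        (e : (Kolmogorov.heisenbergGroup × ℤˣ) ⋊[φ] Kolmogorov.SL2 →
          OpenPartialHomeomorph Kolmogorov.Total Kolmogorov.Total),
      (∀ g, e g ∈ Kolmogorov.groupEss) ∧
      (∀ Φ ∈ Kolmogorov.groupEss, ∃ g, e g ≈ Φ) ∧
      (∀ g g', e g ≈ e g' → g = g') ∧
      (∀ g g', Kolmogorov.IsModifiedComp (e g) (e g') (e (g * g'))) ∧
      e 1 ≈ OpenPartialHomeomorph.refl Kolmogorov.Total ∧
      (∀ g, e g⁻¹ ≈ (e g).symm) ∧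
      ∀ (A : Kolmogorov.SL2) (l : Fin 4 → ℝ) (c : ℝ) (z : ℤˣ),
        Kolmogorov.HasForm A l (((z : ℤ) : ℝ) * Real.exp c) 0 Set.univ
          (e (SemidirectProduct.inr A *
            SemidirectProduct.inl
              (Kolmogorov.heis (3 * l 3) (-l 2) (l 0) (l 1) c, z)))) := by
  refine ⟨⟨Kolmogorov.symmetryGroupoid, fun Φ => Kolmogorov.isPointSymmetry_iff_formAt.symm⟩,
    fun A l σ f Ω hσ hΩ hf => ⟨Kolmogorov.transformation A l hσ hΩ hf.1,
      Kolmogorov.hasForm_transformation hσ hΩ hf.1, Kolmogorov.isPointSymmetry_of_formAt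
        ((Kolmogorov.hasForm_transformation hσ hΩ hf.1).formAt hσ hΩ hf)⟩,
    fun Φ => ?_, fun Φ hs hfib => ⟨fun h => Kolmogorov.exists_global_form hs hfib
      fun p hp => h.formAt hp, ?_⟩,
    fun A l σ f Ω Φ L R S hσ _ _ h hL hR hS => h.decompose hσ hL hR hS,
    fun Φ hΦ Ψ hΨ => Kolmogorov.groupG_trans hΦ hΨ, fun Φ hΦ => Kolmogorov.groupG_symm hΦ,
    Kolmogorov.groupEss_subset_groupG, Kolmogorov.groupLin_subset_groupG,
    fun L hL L' hL' => Kolmogorov.groupLin_trans hL hL',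
    fun L hL => Kolmogorov.groupLin_symm hL,
    fun Φ hΦ L hL => Kolmogorov.groupLin_conj hΦ hL,
    fun Φ hΦ => Kolmogorov.exists_ess_lin hΦ,
    fun E hE E' hE' L hL L' hL' h hne => Kolmogorov.ess_lin_unique hE hE' hL hL' h hne,
    fun E hE hE' => Kolmogorov.ess_inter_lin hE hE',
    Kolmogorov.essAction, Kolmogorov.essMap, Kolmogorov.essMap_mem,
    fun Φ hΦ => Kolmogorov.exists_essMap hΦ, fun g g' h => Kolmogorov.essMap_injective h,
    Kolmogorov.isModifiedComp_essMap, Kolmogorov.essMap_one, Kolmogorov.essMap_inv,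
    Kolmogorov.hasForm_essMap_inr_inl⟩
  · rw [Kolmogorov.isPointSymmetry_iff_formAt]
    exact forall₂_congr fun p _ => Kolmogorov.formAt_iff
  · rintro ⟨A, l, σ, f, hσ, hf, h⟩
    have ho := isOpenMap_fst _ Φ.open_source
    exact Kolmogorov.isPointSymmetry_of_formAt fun p hp =>
      ⟨A, l, σ, f, hσ, (h p hp).1,
        (Kolmogorov.isSolutionOn_iff ho).1 hf _ (Set.mem_image_of_mem _ hp),
        Filter.eventuallyEq_of_mem (Φ.open_source.mem_nhds hp) fun q hq => (h q hq).2⟩
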